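/- **Conventions.** A *site* is a small-generated site $(\mathcal C,J)$: a locally small, possibly large category $\mathcal C$ with a Grothendieck topology $J$ and a small set of objects such that every object is covered by the arrows factoring through objects of this set. Sheaves are sheaves of small sets; write $\iota_J:\mathrm{Sh}(\mathcal C,J)\to\widehat{\mathcal C}=[\mathcal C^{op},\mathbf{Set}]$ for the inclusion, $\mathfrak a_J$ for sheafification, and $\mathrm{rest}_F:\widehat{\mathcal D}\to\widehat{\mathcal C}$, $X\mapsto X\circ F^{op}$, for restriction along a functor $F:\mathcal C\to\mathcal D$. A functor $f:(\mathcal C,J)\to(\mathcal D,K)$ is *cover-preserving* if for every $J$-covering sieve $S$ the sieve generated by the $f(u)$, $u\in S$, is $K$-covering. It is *covering-flat* if for every finite diagram $(c_i)$ in $\mathcal C$ and every cone $(v_i:d\to f(c_i))$ in $\mathcal D$, the sieve of arrows $w:d'\to d$ for which there are a cone $(a_i:c\to c_i)$ in $\mathcal C$ and an arrow $t:d'\to f(c)$ with $f(a_i)t=v_iw$ for all $i$ is $K$-covering. It is *cover-lifting* if for every $c$ and every $K$-covering sieve $S$ on $f(c)$, the sieve of arrows $u$ into $c$ with $f(u)\in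 S$ is $J$-covering. A *morphism of sites* is a functor that is cover-preserving and covering-flat; a *comorphism of sites* is a cover-lifting functor. With all natural transformations as 2-cells these are the 1-cells of 2-categories $\mathbf{Site}^\flat$ and $\mathbf{Site}^\sharp$. A Grothendieck topos is a category equivalent to the category of sheaves on a small site; the 2-category $\mathbf{Top}$ has as 1-cells the geometric morphisms $p=(p^*\dashv p_*)$, $p^*$ preserving finite limits, and as 2-cells $p\Rightarrow q$ the natural transformations $p^*\Rightarrow q^*$. A *double category* has horizontal and vertical arrows, each forming a category on the same objects, and cells bounded by squares, with strictly associative and unital horizontal and vertical pasting satisfying the interchange law. Its *horizontal 2-category* consists of the horizontal arrows and the cells whose vertical sides are identities, its *vertical 2-category* of the vertical arrows and the cells whose horizontal sides are identities. A *double functor* is given by a map on objects, maps on horizontal arrows, on vertical arrows and on cells, and invertible coherence cells that make it pseudofunctorial (associativity and unit laws) on horizontal and on vertical arrows; its action on cells is compatible, through the coherence cells, with identity cells and with horizontal and vertical pasting. In particular it induces pseudofunctors on the horizontal and vertical 2-categories. The *lax quintet* double category $\mathbf{Top}^\square_{lax}$ has topoi as objects, geometric morphisms as horizontal and as vertical arrows,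 and, as cells with top $p$, left side $q$, right side $r$ and bottom $s$, the 2-cells $r\circ p\Rightarrow s\circ q$. **Theorem.** (a) There is a double category $\mathbf{Site}^\natural_{lax}$ whose objects are the sites, whose horizontal arrows are the morphisms of sites, whose vertical arrows are the comorphisms of sites, and whose cells with top $f:\mathcal A\to\mathcal B$, left side $G:\mathcal A\to\mathcal C$, right side $K:\mathcal B\to\mathcal D$ and bottom $h:\mathcal C\to\mathcal D$ are the natural transformations $\phi:Kf\Rightarrow hG$. There are embeddings $h$ of $\mathbf{Site}^\flat$ as its horizontal 2-category and $v$ of $(\mathbf{Site}^\sharp)^{co}$ as its vertical 2-category, bijective on objects, on 1-cells, and from 2-cells to the respective cells with identity sides ($co$ reverses 2-cells). Equivalently, $h$ embeds $(\mathbf{Site}^\flat)^{op}$ ($op$ reverses 1-cells) as the horizontal 2-category of the horizontal opposite of $\mathbf{Site}^\natural_{lax}$. (b) There is a double functor from the horizontal opposite of $\mathbf{Site}^\natural_{lax}$ to $\mathbf{Top}^\square_{lax}$ (horizontally contravariant, vertically covariant) such that, up to isomorphisms of functors compatible with all the data: * it sends a site $(\mathcal C,J)$ to $\mathrm{Sh}(\mathcal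 C,J)$; * it sends a morphism of sites $f:(\mathcal C,J)\to(\mathcal D,K)$ to a geometric morphism $\mathrm{Sh}(f):\mathrm{Sh}(\mathcal D,K)\to\mathrm{Sh}(\mathcal C,J)$ whose direct image is restriction of sheaves along $f$, with horizontal coherence cells the mates of the canonical identifications of restriction along an identity or a composite; * it sends a comorphism of sites $G:(\mathcal C,J)\to(\mathcal D,K)$ to a geometric morphism $C_G:\mathrm{Sh}(\mathcal C,J)\to\mathrm{Sh}(\mathcal D,K)$ whose inverse image is $\mathfrak a_J\,\mathrm{rest}_G\,\iota_K$, with vertical coherence cells induced by the counit and unit of sheafification; * it sends a cell $\phi:Kf\Rightarrow hG$ as above to the 2-cell $C_G\circ\mathrm{Sh}(f)\Rightarrow\mathrm{Sh}(h)\circ C_K$ of $\mathbf{Top}$ given by the transformation $\mathrm{Sh}(f)^*C_G^*\Rightarrow C_K^*\mathrm{Sh}(h)^*$ that is the mate, under $\mathrm{Sh}(f)^*\dashv\mathrm{Sh}(f)_*$ and $\mathrm{Sh}(h)^*\dashv\mathrm{Sh}(h)_*$, of the transformation $C_G^*\mathrm{Sh}(h)_*\Rightarrow\mathrm{Sh}(f)_*C_K^*$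 induced, through sheafification, by $X\phi^{op}:\mathrm{rest}_G\mathrm{rest}_hX\to\mathrm{rest}_f\mathrm{rest}_KX$. (c) This double functor restricts along $h$ to a pseudofunctor $\mathrm{Sh}:(\mathbf{Site}^\flat)^{op}\to\mathbf{Top}$ and along $v$ to a pseudofunctor $C:(\mathbf{Site}^\sharp)^{co}\to\mathbf{Top}$: they agree on objects, 1-cells, 2-cells and coherence 2-cells. -/

import Mathlib

open CategoryTheory Bicategory Opposite Limits

universe u w a b v₁ v₂ v₃ u₁ u₂ u₃ v₄ v₅ v₆ u₄

/-- A double category: horizontal arrows `H` and vertical arrows `V` each form a category on the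
same objects, and a cell `Sq f F G g` has top `f`, left side `F`, right side `G`, bottom `g`.
`sqV`, `sqH` are vertical and horizontal pasting, in diagrammatic order. `sqIdH f` is the identity
cell on the horizontal arrow `f` (a unit for `sqV`), `sqIdV F` is the identity cell on the vertical
arrow `F` (a unit for `sqH`). The unit and associativity laws of pasting compare cells whose
boundaries are equal only by the laws of the two categories, hence the `HEq`. -/
structure DoubleCat where
  Obj : Type u₁
  H : Obj → Obj → Type v₁
  hId (A : Obj) : H A A
  hComp {A B C : Obj} : H A B → H B C → H A C
  hId_comp {A B : Obj} (f : H A B) : hComp (hId A) f = f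
  hComp_id {A B : Obj} (f : H A B) : hComp f (hId B) = f
  hComp_assoc {A B C D : Obj} (f : H A B) (g : H B C) (h : H C D) :
    hComp (hComp f g) h = hComp f (hComp g h)
  V : Obj → Obj → Type v₂
  vId (A : Obj) : V A A
  vComp {A B C : Obj} : V A B → V B C → V A C
  vId_comp {A B : Obj} (F : V A B) : vComp (vId A) F = F
  vComp_id {A B : Obj} (F : V A B) : vComp F (vId B) = F
  vComp_assoc {A B C D : Obj} (F : V A B) (G : V B C) (K : V C D) :
    vComp (vComp F G) K = vComp F (vComp G K)
  Sq {A B C D : Obj} (top : H A B) (left : V A C) (right : V B D) (bot : H C D) : Type v₃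
  sqIdH {A B : Obj} (f : H A B) : Sq f (vId A) (vId B) f
  sqIdV {A C : Obj} (F : V A C) : Sq (hId A) F F (hId C)
  sqV {A B A' B' A'' B'' : Obj} {f : H A B} {F : V A A'} {G : V B B'} {f' : H A' B'}
    {F' : V A' A''} {G' : V B' B''} {f'' : H A'' B''} :
    Sq f F G f' → Sq f' F' G' f'' → Sq f (vComp F F') (vComp G G') f''
  sqH {A A' A'' B B' B'' : Obj} {f : H A A'} {f' : H A' A''} {F : V A B} {F' : V A' B'}
    {F'' : V A'' B''} {g : H B B'} {g' : H B' B''} :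
    Sq f F F' g → Sq f' F' F'' g' → Sq (hComp f f') F F'' (hComp g g')
  sqV_id_left {A B C D : Obj} {f : H A B} {F : V A C} {G : V B D} {g : H C D}
    (α : Sq f F G g) : HEq (sqV (sqIdH f) α) α
  sqV_id_right {A B C D : Obj} {f : H A B} {F : V A C} {G : V B D} {g : H C D}
    (α : Sq f F G g) : HEq (sqV α (sqIdH g)) α
  sqV_assoc {A₀ B₀ A₁ B₁ A₂ B₂ A₃ B₃ : Obj}
    {f₀ : H A₀ B₀} {f₁ : H A₁ B₁} {f₂ : H A₂ B₂} {f₃ : H A₃ B₃}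
    {F₀ : V A₀ A₁} {F₁ : V A₁ A₂} {F₂ : V A₂ A₃} {G₀ : V B₀ B₁} {G₁ : V B₁ B₂} {G₂ : V B₂ B₃}
    (α : Sq f₀ F₀ G₀ f₁) (β : Sq f₁ F₁ G₁ f₂) (γ : Sq f₂ F₂ G₂ f₃) :
    HEq (sqV (sqV α β) γ) (sqV α (sqV β γ))
  sqH_id_left {A B C D : Obj} {f : H A B} {F : V A C} {G : V B D} {g : H C D}
    (α : Sq f F G g) : HEq (sqH (sqIdV F) α) α
  sqH_id_right {A B C D : Obj} {f : H A B} {F : V A C} {G : V B D} {g : H C D}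
    (α : Sq f F G g) : HEq (sqH α (sqIdV G)) α
  sqH_assoc {A₀ B₀ A₁ B₁ A₂ B₂ A₃ B₃ : Obj}
    {F₀ : V A₀ B₀} {F₁ : V A₁ B₁} {F₂ : V A₂ B₂} {F₃ : V A₃ B₃}
    {f₀ : H A₀ A₁} {f₁ : H A₁ A₂} {f₂ : H A₂ A₃} {g₀ : H B₀ B₁} {g₁ : H B₁ B₂} {g₂ : H B₂ B₃}
    (α : Sq f₀ F₀ F₁ g₀) (β : Sq f₁ F₁ F₂ g₁) (γ : Sq f₂ F₂ F₃ g₂) :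
    HEq (sqH (sqH α β) γ) (sqH α (sqH β γ))
  sqIdH_comp {A B C : Obj} (f : H A B) (g : H B C) :
    sqH (sqIdH f) (sqIdH g) = sqIdH (hComp f g)
  sqIdV_comp {A B C : Obj} (F : V A B) (G : V B C) :
    sqV (sqIdV F) (sqIdV G) = sqIdV (vComp F G)
  sqIdH_id (A : Obj) : sqIdH (hId A) = sqIdV (vId A)
  interchange {A₀ B₀ C₀ A₁ B₁ C₁ A₂ B₂ C₂ : Obj}
    {f₀ : H A₀ B₀} {g₀ : H B₀ C₀} {f₁ : H A₁ B₁} {g₁ : H B₁ C₁} {f₂ : H A₂ B₂} {g₂ : H B₂ C₂}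
    {F₀ : V A₀ A₁} {G₀ : V B₀ B₁} {K₀ : V C₀ C₁} {F₁ : V A₁ A₂} {G₁ : V B₁ B₂} {K₁ : V C₁ C₂}
    (α : Sq f₀ F₀ G₀ f₁) (β : Sq g₀ G₀ K₀ g₁) (γ : Sq f₁ F₁ G₁ f₂) (δ : Sq g₁ G₁ K₁ g₂) :
    sqV (sqH α β) (sqH γ δ) = sqH (sqV α γ) (sqV β δ)

namespace DoubleCat

/-- The horizontal opposite: horizontal arrows are reversed, cells are reflected. -/
def hop (D : DoubleCat.{v₁, v₂, v₃, u₁}) : DoubleCat.{v₁, v₂, v₃, u₁} where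
  Obj := D.Obj
  H A B := D.H B A
  hId := D.hId
  hComp f g := D.hComp g f
  hId_comp := D.hComp_id
  hComp_id := D.hId_comp
  hComp_assoc f g h := (D.hComp_assoc h g f).symm
  V := D.V
  vId := D.vId
  vComp := D.vComp
  vId_comp := D.vId_comp
  vComp_id := D.vComp_id
  vComp_assoc := D.vComp_assoc
  Sq f F G g := D.Sq f G F g
  sqIdH := D.sqIdH
  sqIdV := D.sqIdV
  sqV := D.sqV
  sqH α β := D.sqH β α
  sqV_id_left := D.sqV_id_left
  sqV_id_right := D.sqV_id_right
  sqV_assoc := D.sqV_assoc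
  sqH_id_left := D.sqH_id_right
  sqH_id_right := D.sqH_id_left
  sqH_assoc α β γ := (D.sqH_assoc γ β α).symm
  sqIdH_comp f g := D.sqIdH_comp g f
  sqIdV_comp := D.sqIdV_comp
  sqIdH_id := D.sqIdH_id
  interchange α β γ δ := D.interchange β α δ γ

/-- The sub double category on all objects, with the horizontal arrows satisfying `P`, the vertical
arrows satisfying `Q`, and all cells between them. -/
def restrict (D : DoubleCat.{v₁, v₂, v₃, u₁})
    (P : ∀ ⦃A B : D.Obj⦄, D.H A B → Prop) (Q : ∀ ⦃A B : D.Obj⦄, D.V A B → Prop)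
    (P_id : ∀ A, P (D.hId A)) (P_comp : ∀ ⦃A B C⦄ (f : D.H A B) (g : D.H B C),
      P f → P g → P (D.hComp f g))
    (Q_id : ∀ A, Q (D.vId A)) (Q_comp : ∀ ⦃A B C⦄ (F : D.V A B) (G : D.V B C),
      Q F → Q G → Q (D.vComp F G)) : DoubleCat.{v₁, v₂, v₃, u₁} where
  Obj := D.Obj
  H A B := {f : D.H A B // P f}
  hId A := ⟨D.hId A, P_id A⟩
  hComp f g := ⟨D.hComp f.1 g.1, P_comp f.1 g.1 f.2 g.2⟩
  hId_comp f := Subtype.ext (D.hId_comp f.1)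
  hComp_id f := Subtype.ext (D.hComp_id f.1)
  hComp_assoc f g h := Subtype.ext (D.hComp_assoc f.1 g.1 h.1)
  V A B := {F : D.V A B // Q F}
  vId A := ⟨D.vId A, Q_id A⟩
  vComp F G := ⟨D.vComp F.1 G.1, Q_comp F.1 G.1 F.2 G.2⟩
  vId_comp F := Subtype.ext (D.vId_comp F.1)
  vComp_id F := Subtype.ext (D.vComp_id F.1)
  vComp_assoc F G K := Subtype.ext (D.vComp_assoc F.1 G.1 K.1)
  Sq f F G g := D.Sq f.1 F.1 G.1 g.1
  sqIdH f := D.sqIdH f.1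
  sqIdV F := D.sqIdV F.1
  sqV := D.sqV
  sqH := D.sqH
  sqV_id_left := D.sqV_id_left
  sqV_id_right := D.sqV_id_right
  sqV_assoc := D.sqV_assoc
  sqH_id_left := D.sqH_id_left
  sqH_id_right := D.sqH_id_right
  sqH_assoc := D.sqH_assoc
  sqIdH_comp f g := D.sqIdH_comp f.1 g.1
  sqIdV_comp F G := D.sqIdV_comp F.1 G.1
  sqIdH_id := D.sqIdH_id
  interchange := D.interchange

/-- Invertibility of a horizontally globular cell under vertical pasting. -/
def InvertibleV (D : DoubleCat.{v₁, v₂, v₃, u₁}) {A B : D.Obj} {f g : D.H A B}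
    (α : D.Sq f (D.vId A) (D.vId B) g) : Prop :=
  ∃ β : D.Sq g (D.vId A) (D.vId B) f,
    HEq (D.sqV α β) (D.sqIdH f) ∧ HEq (D.sqV β α) (D.sqIdH g)

/-- Invertibility of a vertically globular cell under horizontal pasting. -/
def InvertibleH (D : DoubleCat.{v₁, v₂, v₃, u₁}) {A B : D.Obj} {F G : D.V A B}
    (α : D.Sq (D.hId A) F G (D.hId B)) : Prop :=
  ∃ β : D.Sq (D.hId A) G F (D.hId B),
    HEq (D.sqH α β) (D.sqIdV F) ∧ HEq (D.sqH β α) (D.sqIdV G)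

end DoubleCat

section Quintet
variable {K : Type u₁} [Bicategory.{v₂, v₁} K]

theorem heq_of_eqToHom_comm {x y : K} {f f' g g' : x ⟶ y} (hf : f = f') (hg : g = g')
    (α : f ⟶ g) (β : f' ⟶ g') (h : α ≫ eqToHom hg = eqToHom hf ≫ β) : HEq α β := by
  subst hf; subst hg; simpa using h

theorem heq_of_iso_comm {x y : K} {f f' g g' : x ⟶ y} (i : f ≅ f') (j : g ≅ g')
    (hf : f = f') (hg : g = g') (hi : i.hom = eqToHom hf) (hj : j.hom = eqToHom hg)
    (α : f ⟶ g) (β : f' ⟶ g') (h : α ≫ j.hom = i.hom ≫ β) : HEq α β :=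
  heq_of_eqToHom_comm hf hg α β (by rw [← hi, ← hj, h])

variable [Bicategory.Strict K]

theorem whiskerLeft_associator_eq {p x y z w : K} (e : p ⟶ x) (f : x ⟶ y) (g : y ⟶ z) (h : z ⟶ w) :
    (whiskerLeftIso e (α_ f g h)).hom = eqToHom (by simp only [Bicategory.Strict.assoc]) := by
  simp [Bicategory.Strict.associator_eqToIso]

/-- The lax quintet double category of a strict bicategory (a 2-category): both kinds of arrows are
the 1-cells of `K`, and a cell with top `f`, left side `F`, right side `G`, bottom `g` is a lax
square, that is, a 2-cell `f ≫ G ⟶ F ≫ g`. -/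
def quintet (K : Type u₁) [Bicategory.{v₂, v₁} K] [Bicategory.Strict K] :
    DoubleCat.{v₁, v₁, v₂, u₁} where
  Obj := K
  H x y := x ⟶ y
  hId x := 𝟙 x
  hComp f g := f ≫ g
  hId_comp := Bicategory.Strict.id_comp
  hComp_id := Bicategory.Strict.comp_id
  hComp_assoc := Bicategory.Strict.assoc
  V x y := x ⟶ y
  vId x := 𝟙 x
  vComp f g := f ≫ g
  vId_comp := Bicategory.Strict.id_comp
  vComp_id := Bicategory.Strict.comp_id
  vComp_assoc := Bicategory.Strict.assoc
  Sq f F G g := f ≫ G ⟶ F ≫ g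
  sqIdH f := (ρ_ f).hom ≫ (λ_ f).inv
  sqIdV F := (λ_ F).hom ≫ (ρ_ F).inv
  sqV {_ _ _ _ _ _ f F G f' F' G' f''} α β :=
    (α_ f G G').inv ≫ α ▷ G' ≫ (α_ F f' G').hom ≫ F ◁ β ≫ (α_ F F' f'').inv
  sqH {_ _ _ _ _ _ f f' F F' F'' g g'} α β :=
    (α_ f f' F'').hom ≫ f ◁ β ≫ (α_ f F' g').inv ≫ α ▷ g' ≫ (α_ F g g').hom
  sqV_id_left {_ _ _ _ f F G g} α := by
    refine heq_of_iso_comm (whiskerLeftIso f (λ_ G)) (whiskerRightIso (λ_ F) g)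
      (by simp only [Bicategory.Strict.id_comp]) (by simp only [Bicategory.Strict.id_comp])
      (by simp [Bicategory.Strict.leftUnitor_eqToIso])
      (by simp [Bicategory.Strict.leftUnitor_eqToIso]) _ _ ?_
    simp
  sqV_id_right {_ _ _ _ f F G g} α := by
    refine heq_of_iso_comm (whiskerLeftIso f (ρ_ G)) (whiskerRightIso (ρ_ F) g)
      (by simp only [Bicategory.Strict.comp_id]) (by simp only [Bicategory.Strict.comp_id])
      (by simp [Bicategory.Strict.rightUnitor_eqToIso])
      (by simp [Bicategory.Strict.rightUnitor_eqToIso]) _ _ ?_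
    simp
  sqV_assoc {_ _ _ _ _ _ _ _ f₀ f₁ f₂ f₃ F₀ F₁ F₂ G₀ G₁ G₂} α β γ := by
    refine heq_of_iso_comm (whiskerLeftIso f₀ (α_ G₀ G₁ G₂)) (whiskerRightIso (α_ F₀ F₁ F₂) f₃)
      (by simp only [Bicategory.Strict.assoc]) (by simp only [Bicategory.Strict.assoc])
      (by simp [Bicategory.Strict.associator_eqToIso])
      (by simp [Bicategory.Strict.associator_eqToIso]) _ _ ?_
    simp
  sqH_id_left {_ _ _ _ f F G g} α := by
    refine heq_of_iso_comm (whiskerRightIso (λ_ f) G) (whiskerLeftIso F (λ_ g))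
      (by simp only [Bicategory.Strict.id_comp]) (by simp only [Bicategory.Strict.id_comp])
      (by simp [Bicategory.Strict.leftUnitor_eqToIso])
      (by simp [Bicategory.Strict.leftUnitor_eqToIso]) _ _ ?_
    simp
  sqH_id_right {_ _ _ _ f F G g} α := by
    refine heq_of_iso_comm (whiskerRightIso (ρ_ f) G) (whiskerLeftIso F (ρ_ g))
      (by simp only [Bicategory.Strict.comp_id]) (by simp only [Bicategory.Strict.comp_id])
      (by simp [Bicategory.Strict.rightUnitor_eqToIso])
      (by simp [Bicategory.Strict.rightUnitor_eqToIso]) _ _ ?_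
    simp
  sqH_assoc {_ _ _ _ _ _ _ _ F₀ F₁ F₂ F₃ f₀ f₁ f₂ g₀ g₁ g₂} α β γ := by
    refine heq_of_iso_comm (whiskerRightIso (α_ f₀ f₁ f₂) F₃) (whiskerLeftIso F₀ (α_ g₀ g₁ g₂))
      (by simp only [Bicategory.Strict.assoc]) (by simp only [Bicategory.Strict.assoc])
      (by simp [Bicategory.Strict.associator_eqToIso])
      (by simp [Bicategory.Strict.associator_eqToIso]) _ _ ?_
    simp
  sqIdH_comp f g := by simp
  sqIdV_comp F G := by simp
  sqIdH_id x := by simp [unitors_equal]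
  interchange {_ _ _ _ _ _ _ _ _ f₀ g₀ f₁ g₁ f₂ g₂ F₀ G₀ K₀ F₁ G₁ K₁} α β γ δ := by
    calc
      _ = (α_ (f₀ ≫ g₀) K₀ K₁).inv ≫ (α_ f₀ g₀ K₀).hom ▷ K₁ ≫ (f₀ ◁ β) ▷ K₁ ≫
          ((α_ f₀ G₀ g₁).inv ▷ K₁ ≫ (α_ (f₀ ≫ G₀) g₁ K₁).hom) ≫
          (α ▷ (g₁ ≫ K₁) ≫ (F₀ ≫ f₁) ◁ δ) ≫ (α_ F₀ f₁ (G₁ ≫ g₂)).hom ≫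
          F₀ ◁ ((α_ f₁ G₁ g₂).inv ≫ γ ▷ g₂ ≫ (α_ F₁ f₂ g₂).hom) ≫
          (α_ F₀ F₁ (f₂ ≫ g₂)).inv := by bicategory
      _ = _ := by
        rw [← whisker_exchange]
        bicategory
end Quintet

section LocallyFull

/-- A class of 1-cells of `K` that contains the identities and is closed under composition. -/
class IsWide {K : Type u₁} [Bicategory.{v₂, v₁} K] (P : ∀ ⦃x y : K⦄, (x ⟶ y) → Prop) : Prop where
  id_mem (x : K) : P (𝟙 x)
  comp_mem ⦃x y z : K⦄ (f : x ⟶ y) (g : y ⟶ z) : P f → P g → P (f ≫ g)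

/-- The locally full sub-2-category of `K` on all objects, with the 1-cells in `P` and all 2-cells
between them. -/
structure LocallyFull {K : Type u₁} [Bicategory.{v₂, v₁} K]
    (P : ∀ ⦃x y : K⦄, (x ⟶ y) → Prop) where
  of : K

namespace LocallyFull

variable {K : Type u₁} [Bicategory.{v₂, v₁} K] {P : ∀ ⦃x y : K⦄, (x ⟶ y) → Prop}

instance [IsWide P] : CategoryStruct (LocallyFull P) where
  Hom X Y := {f : X.of ⟶ Y.of // P f}
  id X := ⟨𝟙 X.of, IsWide.id_mem X.of⟩
  comp f g := ⟨f.1 ≫ g.1, IsWide.comp_mem f.1 g.1 f.2 g.2⟩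

variable [IsWide P]

/-- The 2-cells of a locally full sub-2-category: all 2-cells of `K`. -/
@[ext]
structure Hom₂ {X Y : LocallyFull P} (f g : X ⟶ Y) where
  hom : f.1 ⟶ g.1

@[simps]
instance (X Y : LocallyFull P) : Category (X ⟶ Y) where
  Hom f g := Hom₂ f g
  id f := ⟨𝟙 f.1⟩
  comp η θ := ⟨η.hom ≫ θ.hom⟩

@[ext]
theorem hom₂_ext {X Y : LocallyFull P} {f g : X ⟶ Y} {η θ : f ⟶ g} (h : η.hom = θ.hom) : η = θ :=
  Hom₂.ext h

/-- Invertible 2-cells of the sub-2-category. -/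
@[simps]
def isoMk {X Y : LocallyFull P} {f g : X ⟶ Y} (e : f.1 ≅ g.1) : f ≅ g where
  hom := ⟨e.hom⟩
  inv := ⟨e.inv⟩

@[simp] theorem comp_val {X Y Z : LocallyFull P} (f : X ⟶ Y) (g : Y ⟶ Z) :
  (f ≫ g).1 = f.1 ≫ g.1 := rfl
@[simp] theorem id_val (X : LocallyFull P) : (𝟙 X : X ⟶ X).1 = 𝟙 X.of := rfl

instance : Bicategory (LocallyFull P) where
  homCategory := inferInstance
  whiskerLeft {_ _ _} f {_ _} η := Hom₂.mk (f.1 ◁ Hom₂.hom η)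
  whiskerRight {_ _ _} {_ _} η h := Hom₂.mk (Hom₂.hom η ▷ h.1)
  associator f g h := isoMk (f := (f ≫ g) ≫ h) (g := f ≫ g ≫ h) (α_ f.1 g.1 h.1)
  leftUnitor {X _} f := isoMk (f := 𝟙 X ≫ f) (g := f) (λ_ f.1)
  rightUnitor {_ Y} f := isoMk (f := f ≫ 𝟙 Y) (g := f) (ρ_ f.1)
  whisker_exchange {_ _ _ _ _ _ _} η θ :=
    hom₂_ext (whisker_exchange (Hom₂.hom η) (Hom₂.hom θ))

end LocallyFull
end LocallyFull

section Co

/-- The 2-cell dual of `K`: same objects and 1-cells, reversed 2-cells. -/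
structure Co (K : Type u₁) where
  of : K

namespace Co
variable {K : Type u₁} [Bicategory.{v₂, v₁} K]

/-- The 1-cells of `Co K`: those of `K`. -/
@[ext]
structure Hom (X Y : Co K) where
  hom : X.of ⟶ Y.of

instance : CategoryStruct (Co K) where
  Hom := Hom
  id X := ⟨𝟙 X.of⟩
  comp f g := ⟨f.hom ≫ g.hom⟩

@[simp] theorem comp_hom {X Y Z : Co K} (f : X ⟶ Y) (g : Y ⟶ Z) :
    (f ≫ g).hom = f.hom ≫ g.hom := rfl
@[simp] theorem id_hom (X : Co K) : (𝟙 X : X ⟶ X).hom = 𝟙 X.of := rfl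

/-- The 2-cells `f ⟶ g` of `Co K`: the 2-cells `g ⟶ f` of `K`. -/
@[ext]
structure Hom₂ {X Y : Co K} (f g : X ⟶ Y) where
  hom : g.hom ⟶ f.hom

instance (X Y : Co K) : Category (X ⟶ Y) where
  Hom f g := Hom₂ f g
  id f := ⟨𝟙 f.hom⟩
  comp η θ := ⟨θ.hom ≫ η.hom⟩

@[simp] theorem comp₂_hom {X Y : Co K} {f g h : X ⟶ Y} (η : f ⟶ g) (θ : g ⟶ h) :
    (η ≫ θ).hom = θ.hom ≫ η.hom := rfl
@[simp] theorem id₂_hom {X Y : Co K} (f : X ⟶ Y) : Hom₂.hom (𝟙 f) = 𝟙 f.hom := rfl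

@[ext]
theorem hom₂_ext {X Y : Co K} {f g : X ⟶ Y} {η θ : f ⟶ g} (h : η.hom = θ.hom) : η = θ :=
  Hom₂.ext h

/-- Invertible 2-cells of `Co K`. -/
@[simps]
def isoMk {X Y : Co K} {f g : X ⟶ Y} (e : f.hom ≅ g.hom) : f ≅ g where
  hom := ⟨e.inv⟩
  inv := ⟨e.hom⟩

instance : Bicategory (Co K) where
  homCategory := inferInstance
  whiskerLeft {_ _ _} f {_ _} η := Hom₂.mk (f.hom ◁ Hom₂.hom η)
  whiskerRight {_ _ _} {_ _} η h := Hom₂.mk (Hom₂.hom η ▷ h.hom)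
  associator f g h := isoMk (f := (f ≫ g) ≫ h) (g := f ≫ g ≫ h) (α_ f.hom g.hom h.hom)
  leftUnitor {X _} f := isoMk (f := 𝟙 X ≫ f) (g := f) (λ_ f.hom)
  rightUnitor {_ Y} f := isoMk (f := f ≫ 𝟙 Y) (g := f) (ρ_ f.hom)
  whisker_exchange {_ _ _ _ _ _ _} η θ :=
    hom₂_ext (whisker_exchange (Hom₂.hom η) (Hom₂.hom θ)).symm

end Co
end Co

section GrothTopos

/-- A Grothendieck topos: a category equivalent to the sheaves of sets on a small site. -/
structure GrothTopos where
  E : Type a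
  [cat : Category.{b} E]
  exists_site : ∃ (C : Type u) (_ : SmallCategory C) (J : GrothendieckTopology C),
    Nonempty (E ≌ Sheaf J (Type u))

attribute [instance] GrothTopos.cat

/-- A geometric morphism `E ⟶ F`: a direct image `E ⥤ F` with a left adjoint inverse image that
preserves finite limits. -/
structure GeomMorph (E F : GrothTopos.{u, a, b}) where
  direct : E.E ⥤ F.E
  inverse : F.E ⥤ E.E
  adj : inverse ⊣ direct
  lex : PreservesFiniteLimits inverse

namespace GeomMorph

theorem ext' {E F : GrothTopos.{u, a, b}} {f g : GeomMorph E F} (h₁ : f.direct = g.direct)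
    (h₂ : f.inverse = g.inverse) (h₃ : HEq f.adj g.adj) : f = g := by
  cases f; cases g; dsimp at h₁ h₂ h₃; subst h₁ h₂; cases h₃; rfl

instance : CategoryStruct GrothTopos.{u, a, b} where
  Hom := GeomMorph
  id E :=
    { direct := 𝟭 _
      inverse := 𝟭 _
      adj := Adjunction.id
      lex := inferInstance }
  comp f g :=
    { direct := f.direct ⋙ g.direct
      inverse := g.inverse ⋙ f.inverse
      adj := g.adj.comp f.adj
      lex := by
        have := f.lex
        have := g.lex
        exact comp_preservesFiniteLimits _ _ }

@[simp] theorem comp_inverse {E F G : GrothTopos.{u, a, b}} (f : E ⟶ F) (g : F ⟶ G) :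
    (f ≫ g).inverse = g.inverse ⋙ f.inverse := rfl
@[simp] theorem id_inverse (E : GrothTopos.{u, a, b}) : (𝟙 E : E ⟶ E).inverse = 𝟭 _ := rfl

/-- A geometric transformation `f ⟶ g`: a natural transformation from the inverse image of `f` to
that of `g`. -/
@[ext]
structure Hom₂ {E F : GrothTopos.{u, a, b}} (f g : E ⟶ F) where
  hom : f.inverse ⟶ g.inverse

@[simps]
instance (E F : GrothTopos.{u, a, b}) : Category (E ⟶ F) where
  Hom f g := Hom₂ f g
  id f := ⟨𝟙 f.inverse⟩
  comp η θ := ⟨η.hom ≫ θ.hom⟩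

@[ext]
theorem hom₂_ext {E F : GrothTopos.{u, a, b}} {f g : E ⟶ F} {η θ : f ⟶ g}
    (h : η.hom = θ.hom) : η = θ :=
  Hom₂.ext h

/-- Invertible geometric transformations. -/
@[simps]
def isoMk {E F : GrothTopos.{u, a, b}} {f g : E ⟶ F} (e : f.inverse ≅ g.inverse) :
    f ≅ g where
  hom := ⟨e.hom⟩
  inv := ⟨e.inv⟩

instance : Bicategory GrothTopos.{u, a, b} where
  homCategory := inferInstance
  whiskerLeft {_ _ _} f {_ _} η := Hom₂.mk (Functor.whiskerRight (Hom₂.hom η) f.inverse)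
  whiskerRight {_ _ _} {_ _} η h := Hom₂.mk (Functor.whiskerLeft h.inverse (Hom₂.hom η))
  associator f g h := isoMk (f := (f ≫ g) ≫ h) (g := f ≫ g ≫ h)
    (Functor.associator h.inverse g.inverse f.inverse).symm
  leftUnitor {E _} f := isoMk (f := 𝟙 E ≫ f) (g := f) (Functor.rightUnitor f.inverse)
  rightUnitor {_ F} f := isoMk (f := f ≫ 𝟙 F) (g := f) (Functor.leftUnitor f.inverse)

theorem eqToHom_hom {E F : GrothTopos.{u, a, b}} {f g : E ⟶ F} (h : f = g) :
    (eqToHom h).hom = eqToHom (congrArg GeomMorph.inverse h) := by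
  subst h; rfl

theorem iso_ext {E F : GrothTopos.{u, a, b}} {f g : E ⟶ F} {e e' : f ≅ g}
    (h : ∀ X, e.hom.hom.app X = e'.hom.hom.app X) : e = e' := by
  apply Iso.ext; apply hom₂_ext; apply NatTrans.ext; funext X; exact h X

instance : Bicategory.Strict GrothTopos.{u, a, b} where
  id_comp f := ext' rfl rfl (heq_of_eq (by ext; simp [CategoryStruct.id, CategoryStruct.comp]))
  comp_id f := ext' rfl rfl (heq_of_eq (by ext; simp [CategoryStruct.id, CategoryStruct.comp]))
  assoc f g h := ext' rfl rfl (heq_of_eq (by ext; simp [CategoryStruct.id, CategoryStruct.comp]))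
  leftUnitor_eqToIso f := iso_ext fun X => by
    rw [eqToIso.hom, eqToHom_hom]; rfl
  rightUnitor_eqToIso f := iso_ext fun X => by
    rw [eqToIso.hom, eqToHom_hom]; rfl
  associator_eqToIso f g h := iso_ext fun X => by
    rw [eqToIso.hom, eqToHom_hom]; rfl

end GeomMorph

end GrothTopos

/-- An embedding, full on objects, of `B` as the horizontal 2-category of `D`: bijections from the
objects, the 1-cells and the 2-cells of `B` to the objects, the horizontal arrows and the cells
with identity vertical sides of `D`, compatible with identities and with all compositions. -/
structure HorizontalEmbedding (B : Type u₄) [Bicategory.{v₅, v₄} B]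
    (D : DoubleCat.{v₁, v₂, v₃, u₁}) where
  obj : B ≃ D.Obj
  map {x y : B} : (x ⟶ y) ≃ D.H (obj x) (obj y)
  cell {x y : B} {f g : x ⟶ y} :
    (f ⟶ g) ≃ D.Sq (map f) (D.vId (obj x)) (D.vId (obj y)) (map g)
  map_id (x : B) : map (𝟙 x) = D.hId (obj x)
  map_comp {x y z : B} (f : x ⟶ y) (g : y ⟶ z) : map (f ≫ g) = D.hComp (map f) (map g)
  cell_id {x y : B} (f : x ⟶ y) : cell (𝟙 f) = D.sqIdH (map f)
  cell_comp {x y : B} {f g h : x ⟶ y} (η : f ⟶ g) (θ : g ⟶ h) :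
    HEq (cell (η ≫ θ)) (D.sqV (cell η) (cell θ))
  cell_whiskerLeft {x y z : B} (f : x ⟶ y) {g h : y ⟶ z} (η : g ⟶ h) :
    HEq (cell (f ◁ η)) (D.sqH (D.sqIdH (map f)) (cell η))
  cell_whiskerRight {x y z : B} {f g : x ⟶ y} (η : f ⟶ g) (h : y ⟶ z) :
    HEq (cell (η ▷ h)) (D.sqH (cell η) (D.sqIdH (map h)))

/-- An embedding, full on objects, of `B` as the vertical 2-category of `D`: bijections from the
objects, the 1-cells and the 2-cells of `B` to the objects, the vertical arrows and the cells
with identity horizontal sides of `D`, compatible with identities and with all compositions. -/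
structure VerticalEmbedding (B : Type u₄) [Bicategory.{v₅, v₄} B]
    (D : DoubleCat.{v₁, v₂, v₃, u₁}) where
  obj : B ≃ D.Obj
  map {x y : B} : (x ⟶ y) ≃ D.V (obj x) (obj y)
  cell {x y : B} {F G : x ⟶ y} :
    (F ⟶ G) ≃ D.Sq (D.hId (obj x)) (map F) (map G) (D.hId (obj y))
  map_id (x : B) : map (𝟙 x) = D.vId (obj x)
  map_comp {x y z : B} (F : x ⟶ y) (G : y ⟶ z) : map (F ≫ G) = D.vComp (map F) (map G)
  cell_id {x y : B} (F : x ⟶ y) : cell (𝟙 F) = D.sqIdV (map F)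
  cell_comp {x y : B} {F G K : x ⟶ y} (η : F ⟶ G) (θ : G ⟶ K) :
    HEq (cell (η ≫ θ)) (D.sqH (cell η) (cell θ))
  cell_whiskerLeft {x y z : B} (F : x ⟶ y) {G K : y ⟶ z} (η : G ⟶ K) :
    HEq (cell (F ◁ η)) (D.sqV (D.sqIdV (map F)) (cell η))
  cell_whiskerRight {x y z : B} {F G : x ⟶ y} (η : F ⟶ G) (K : y ⟶ z) :
    HEq (cell (η ▷ K)) (D.sqV (cell η) (D.sqIdV (map K)))

section LaxSquares

variable {K : Type u₁} [Bicategory.{v₂, v₁} K] [Bicategory.Strict K]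

/-- Lax squares with identity vertical sides, top `f` and bottom `g` are 2-cells `f ⟶ g`. -/
def hCell {x y : K} {f g : x ⟶ y} : (f ⟶ g) ≃ (quintet K).Sq f (𝟙 x) (𝟙 y) g where
  toFun η := (ρ_ f).hom ≫ η ≫ (λ_ g).inv
  invFun α := (ρ_ f).inv ≫ CategoryStruct.comp (obj := x ⟶ y) α (λ_ g).hom
  left_inv η := by simp
  right_inv (α : f ≫ 𝟙 y ⟶ 𝟙 x ≫ g) := by simp; rfl

/-- Lax squares with identity horizontal sides, left side `F` and right side `G` are 2-cells
`G ⟶ F`. -/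
def vCell {x y : K} {F G : x ⟶ y} : (G ⟶ F) ≃ (quintet K).Sq (𝟙 x) F G (𝟙 y) where
  toFun η := (λ_ G).hom ≫ η ≫ (ρ_ F).inv
  invFun α := (λ_ G).inv ≫ CategoryStruct.comp (obj := x ⟶ y) α (ρ_ F).hom
  left_inv η := by simp
  right_inv (α : 𝟙 x ≫ G ⟶ F ≫ 𝟙 y) := by simp; rfl

theorem hCell_comp {x y : K} {f g h : x ⟶ y} (η : f ⟶ g) (θ : g ⟶ h) :
    HEq (hCell (η ≫ θ)) ((quintet K).sqV (hCell η) (hCell θ)) := by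
  refine heq_of_iso_comm (K := K) (whiskerLeftIso f (λ_ (𝟙 y)).symm)
    (whiskerRightIso (λ_ (𝟙 x)).symm h) (by simp only [Bicategory.Strict.id_comp])
    (by simp only [Bicategory.Strict.id_comp]) (by simp [Bicategory.Strict.leftUnitor_eqToIso])
    (by simp [Bicategory.Strict.leftUnitor_eqToIso]) ((ρ_ f).hom ≫ (η ≫ θ) ≫ (λ_ h).inv)
    ((α_ f (𝟙 y) (𝟙 y)).inv ≫ ((ρ_ f).hom ≫ η ≫ (λ_ g).inv) ▷ 𝟙 y ≫ (α_ (𝟙 x) g (𝟙 y)).hom ≫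
      𝟙 x ◁ ((ρ_ g).hom ≫ θ ≫ (λ_ h).inv) ≫ (α_ (𝟙 x) (𝟙 x) h).inv) ?_
  simp only [whiskerLeftIso_hom, whiskerRightIso_hom, Iso.symm_hom]
  bicategory

theorem vCell_comp {x y : K} {F G L : x ⟶ y} (η : G ⟶ F) (θ : L ⟶ G) :
    HEq (vCell (θ ≫ η)) ((quintet K).sqH (vCell η) (vCell θ)) := by
  refine heq_of_iso_comm (K := K) (whiskerRightIso (λ_ (𝟙 x)).symm L)
    (whiskerLeftIso F (λ_ (𝟙 y)).symm) (by simp only [Bicategory.Strict.id_comp])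
    (by simp only [Bicategory.Strict.id_comp]) (by simp [Bicategory.Strict.leftUnitor_eqToIso])
    (by simp [Bicategory.Strict.leftUnitor_eqToIso]) ((λ_ L).hom ≫ (θ ≫ η) ≫ (ρ_ F).inv)
    ((α_ (𝟙 x) (𝟙 x) L).hom ≫ 𝟙 x ◁ ((λ_ L).hom ≫ θ ≫ (ρ_ G).inv) ≫ (α_ (𝟙 x) G (𝟙 y)).inv ≫
      ((λ_ G).hom ≫ η ≫ (ρ_ F).inv) ▷ 𝟙 y ≫ (α_ F (𝟙 y) (𝟙 y)).hom) ?_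
  simp only [whiskerLeftIso_hom, whiskerRightIso_hom, Iso.symm_hom]
  bicategory

theorem hCell_whiskerLeft {x y z : K} (f : x ⟶ y) {g h : y ⟶ z} (η : g ⟶ h) :
    hCell (f ◁ η) = (quintet K).sqH ((quintet K).sqIdH f) (hCell η) := by
  change (ρ_ (f ≫ g)).hom ≫ f ◁ η ≫ (λ_ (f ≫ h)).inv =
    (α_ f g (𝟙 z)).hom ≫ f ◁ ((ρ_ g).hom ≫ η ≫ (λ_ h).inv) ≫ (α_ f (𝟙 y) h).inv ≫
      ((ρ_ f).hom ≫ (λ_ f).inv) ▷ h ≫ (α_ (𝟙 x) f h).hom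
  bicategory

theorem hCell_whiskerRight {x y z : K} {f g : x ⟶ y} (η : f ⟶ g) (h : y ⟶ z) :
    hCell (η ▷ h) = (quintet K).sqH (hCell η) ((quintet K).sqIdH h) := by
  change (ρ_ (f ≫ h)).hom ≫ η ▷ h ≫ (λ_ (g ≫ h)).inv =
    (α_ f h (𝟙 z)).hom ≫ f ◁ ((ρ_ h).hom ≫ (λ_ h).inv) ≫ (α_ f (𝟙 y) h).inv ≫
      ((ρ_ f).hom ≫ η ≫ (λ_ g).inv) ▷ h ≫ (α_ (𝟙 x) g h).hom
  bicategory

theorem vCell_whiskerLeft {x y z : K} (F : x ⟶ y) {G L : y ⟶ z} (η : L ⟶ G) :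
    vCell (F ◁ η) = (quintet K).sqV ((quintet K).sqIdV F) (vCell η) := by
  change (λ_ (F ≫ L)).hom ≫ F ◁ η ≫ (ρ_ (F ≫ G)).inv =
    (α_ (𝟙 x) F L).inv ≫ ((λ_ F).hom ≫ (ρ_ F).inv) ▷ L ≫ (α_ F (𝟙 y) L).hom ≫
      F ◁ ((λ_ L).hom ≫ η ≫ (ρ_ G).inv) ≫ (α_ F G (𝟙 z)).inv
  bicategory

theorem vCell_whiskerRight {x y z : K} {F G : x ⟶ y} (η : G ⟶ F) (L : y ⟶ z) :
    vCell (η ▷ L) = (quintet K).sqV (vCell η) ((quintet K).sqIdV L) := by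
  change (λ_ (G ≫ L)).hom ≫ η ▷ L ≫ (ρ_ (F ≫ L)).inv =
    (α_ (𝟙 x) G L).inv ≫ ((λ_ G).hom ≫ η ≫ (ρ_ F).inv) ▷ L ≫ (α_ F (𝟙 y) L).hom ≫
      F ◁ ((λ_ L).hom ≫ (ρ_ L).inv) ≫ (α_ F L (𝟙 z)).inv
  bicategory

/-- The double category on the objects of `K` whose horizontal arrows are the 1-cells in `P`, whose
vertical arrows are the 1-cells in `Q`, and whose cells are the lax squares between them. -/
def laxSquares (P Q : ∀ ⦃x y : K⦄, (x ⟶ y) → Prop) [IsWide P] [IsWide Q] :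
    DoubleCat.{v₁, v₁, v₂, u₁} :=
  (quintet K).restrict P Q (fun x => IsWide.id_mem (P := P) x)
    (fun _ _ _ f g => IsWide.comp_mem (P := P) f g) (fun x => IsWide.id_mem (P := Q) x)
    (fun _ _ _ F G => IsWide.comp_mem (P := Q) F G)

variable (P Q : ∀ ⦃x y : K⦄, (x ⟶ y) → Prop) [IsWide P] [IsWide Q]

/-- The 1-cells in `P`, with all 2-cells, are the horizontal 2-category of `laxSquares P Q`. -/
def laxSquares.h : HorizontalEmbedding (LocallyFull P) (laxSquares P Q) where
  obj := ⟨fun X => X.of, fun x => ⟨x⟩, fun _ => rfl, fun _ => rfl⟩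
  map := Equiv.refl _
  cell := Equiv.trans ⟨fun η => η.hom, fun η => ⟨η⟩, fun _ => rfl, fun _ => rfl⟩ hCell
  map_id _ := rfl
  map_comp _ _ := rfl
  cell_id f := congrArg ((ρ_ f.1).hom ≫ ·) (Category.id_comp _)
  cell_comp η θ := hCell_comp η.hom θ.hom
  cell_whiskerLeft {_ _ _} f {_ _} η := heq_of_eq (hCell_whiskerLeft f.1 η.hom)
  cell_whiskerRight {_ _ _} {_ _} η h := heq_of_eq (hCell_whiskerRight η.hom h.1)

/-- The 1-cells in `Q`, with all 2-cells reversed, are the vertical 2-category of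
`laxSquares P Q`. -/
def laxSquares.v : VerticalEmbedding (Co (LocallyFull Q)) (laxSquares P Q) where
  obj := ⟨fun X => X.of.of, fun x => ⟨⟨x⟩⟩, fun _ => rfl, fun _ => rfl⟩
  map := ⟨fun F => F.hom, fun F => ⟨F⟩, fun _ => rfl, fun _ => rfl⟩
  cell := Equiv.trans ⟨fun η => η.hom.hom, fun η => ⟨⟨η⟩⟩, fun _ => rfl, fun _ => rfl⟩ vCell
  map_id _ := rfl
  map_comp _ _ := rfl
  cell_id F := congrArg ((λ_ F.hom.1).hom ≫ ·) (Category.id_comp _)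
  cell_comp η θ := vCell_comp η.hom.hom θ.hom.hom
  cell_whiskerLeft {_ _ _} F {_ _} η := heq_of_eq (vCell_whiskerLeft F.hom.1 η.hom.hom)
  cell_whiskerRight {_ _ _} {_ _} η L := heq_of_eq (vCell_whiskerRight η.hom.hom L.hom.1)

end LaxSquares

/-- A double functor `D ⟶ E` acting as `o` on objects, pseudofunctorial on horizontal arrows (through
the invertible cells `unitH`, `compH`) and on vertical arrows (through the invertible cells
`unitV`, `compV`). These satisfy the associativity and unit laws, and the action `mapSq` on cells
is compatible with identity cells and with pasting in both directions. -/
structure DoublePseudofunctor (D : DoubleCat.{v₁, v₂, v₃, u₁}) (E : DoubleCat.{v₄, v₅, v₆, u₂})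
    (o : D.Obj → E.Obj) where
  mapH {A B : D.Obj} : D.H A B → E.H (o A) (o B)
  mapV {A B : D.Obj} : D.V A B → E.V (o A) (o B)
  mapSq {A B A' B' : D.Obj} {f : D.H A B} {F : D.V A A'} {G : D.V B B'} {g : D.H A' B'} :
    D.Sq f F G g → E.Sq (mapH f) (mapV F) (mapV G) (mapH g)
  unitH (A : D.Obj) : E.Sq (E.hId (o A)) (E.vId (o A)) (E.vId (o A)) (mapH (D.hId A))
  compH {A B C : D.Obj} (f : D.H A B) (g : D.H B C) :
    E.Sq (E.hComp (mapH f) (mapH g)) (E.vId (o A)) (E.vId (o C)) (mapH (D.hComp f g))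
  unitV (A : D.Obj) : E.Sq (E.hId (o A)) (E.vId (o A)) (mapV (D.vId A)) (E.hId (o A))
  compV {A B C : D.Obj} (F : D.V A B) (G : D.V B C) :
    E.Sq (E.hId (o A)) (E.vComp (mapV F) (mapV G)) (mapV (D.vComp F G)) (E.hId (o C))
  unitH_invertible (A : D.Obj) : E.InvertibleV (unitH A)
  compH_invertible {A B C : D.Obj} (f : D.H A B) (g : D.H B C) : E.InvertibleV (compH f g)
  unitV_invertible (A : D.Obj) : E.InvertibleH (unitV A)
  compV_invertible {A B C : D.Obj} (F : D.V A B) (G : D.V B C) : E.InvertibleH (compV F G)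
  compH_assoc {A B C A' : D.Obj} (f : D.H A B) (g : D.H B C) (h : D.H C A') :
    HEq (E.sqV (E.sqH (compH f g) (E.sqIdH (mapH h))) (compH (D.hComp f g) h))
      (E.sqV (E.sqH (E.sqIdH (mapH f)) (compH g h)) (compH f (D.hComp g h)))
  unitH_compH {A B : D.Obj} (f : D.H A B) :
    HEq (E.sqV (E.sqH (unitH A) (E.sqIdH (mapH f))) (compH (D.hId A) f)) (E.sqIdH (mapH f))
  compH_unitH {A B : D.Obj} (f : D.H A B) :
    HEq (E.sqV (E.sqH (E.sqIdH (mapH f)) (unitH B)) (compH f (D.hId B))) (E.sqIdH (mapH f))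
  compV_assoc {A B C A' : D.Obj} (F : D.V A B) (G : D.V B C) (K : D.V C A') :
    HEq (E.sqH (E.sqV (compV F G) (E.sqIdV (mapV K))) (compV (D.vComp F G) K))
      (E.sqH (E.sqV (E.sqIdV (mapV F)) (compV G K)) (compV F (D.vComp G K)))
  unitV_compV {A B : D.Obj} (F : D.V A B) :
    HEq (E.sqH (E.sqV (unitV A) (E.sqIdV (mapV F))) (compV (D.vId A) F)) (E.sqIdV (mapV F))
  compV_unitV {A B : D.Obj} (F : D.V A B) :
    HEq (E.sqH (E.sqV (E.sqIdV (mapV F)) (unitV B)) (compV F (D.vId B))) (E.sqIdV (mapV F))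
  mapSq_sqIdV {A B : D.Obj} (F : D.V A B) :
    HEq (E.sqV (unitH A) (mapSq (D.sqIdV F))) (E.sqV (E.sqIdV (mapV F)) (unitH B))
  mapSq_sqH {A A' A'' B B' B'' : D.Obj} {f : D.H A A'} {f' : D.H A' A''} {F : D.V A B}
    {F' : D.V A' B'} {F'' : D.V A'' B''} {g : D.H B B'} {g' : D.H B' B''}
    (α : D.Sq f F F' g) (β : D.Sq f' F' F'' g') :
    HEq (E.sqV (compH f f') (mapSq (D.sqH α β)))
      (E.sqV (E.sqH (mapSq α) (mapSq β)) (compH g g'))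
  mapSq_sqIdH {A B : D.Obj} (f : D.H A B) :
    HEq (E.sqH (unitV A) (mapSq (D.sqIdH f))) (E.sqH (E.sqIdH (mapH f)) (unitV B))
  mapSq_sqV {A B A' B' A'' B'' : D.Obj} {f : D.H A B} {F : D.V A A'} {G : D.V B B'}
    {f' : D.H A' B'} {F' : D.V A' A''} {G' : D.V B' B''} {f'' : D.H A'' B''}
    (α : D.Sq f F G f') (β : D.Sq f' F' G' f'') :
    HEq (E.sqH (compV F F') (mapSq (D.sqV α β)))
      (E.sqH (E.sqV (mapSq α) (mapSq β)) (compV G G'))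

section Restriction

variable {B : Type u₄} [Bicategory.{v₅, v₄} B] {D : DoubleCat.{v₁, v₂, v₃, u₁}}
  {K : Type u₂} [Bicategory.{v₆, u₃} K] [Bicategory.Strict K] {o : D.Obj → K}

/-- The image of a horizontal arrow, as a 1-cell of `K`. -/
def DoublePseudofunctor.hMap (F : DoublePseudofunctor D (quintet K) o) {x y : D.Obj}
    (f : D.H x y) : o x ⟶ o y :=
  F.mapH f

/-- The image of a vertical arrow, as a 1-cell of `K`. -/
def DoublePseudofunctor.vMap (F : DoublePseudofunctor D (quintet K) o) {x y : D.Obj}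
    (f : D.V x y) : o x ⟶ o y :=
  F.mapV f

/-- The horizontally contravariant double functor `F`, with values in the quintets of `K`, restricts
along `h` to the pseudofunctor `S`: they agree on objects, 1-cells, 2-cells and coherence 2-cells.
A horizontally globular cell is sent by `F` to a cell whose vertical sides are images of identities;
it is turned into a 2-cell `θ` of `K` by means of `unitV`. -/
structure RestrictsAlongHorizontal (h : HorizontalEmbedding B D)
    (F : DoublePseudofunctor D.hop (quintet K) o) (S : Bᵒᵖ ⥤ᵖ K) : Prop where
  obj (x : B) : S.obj (op x) = o (h.obj x)
  map {x y : B} (f : x ⟶ y) : HEq (S.map f.op) (F.hMap (h.map f))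
  map₂ {x y : B} {f g : x ⟶ y} (η : f ⟶ g) :
    ∃ θ : F.hMap (h.map f) ⟶ F.hMap (h.map g),
      HEq (S.map₂ (Bicategory.Opposite.op2 η)) θ ∧
      HEq ((quintet K).sqH (F.unitV (h.obj y)) (F.mapSq (h.cell η)))
        ((quintet K).sqH (hCell θ) (F.unitV (h.obj x)))
  mapId (x : B) :
    ∃ θ : 𝟙 (o (h.obj x)) ⟶ F.hMap (D.hId (h.obj x)),
      HEq (S.mapId (op x)).inv θ ∧ F.unitH (h.obj x) = hCell θ
  mapComp {x y z : B} (f : x ⟶ y) (g : y ⟶ z) :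
    ∃ θ : F.hMap (h.map g) ≫ F.hMap (h.map f) ⟶ F.hMap (D.hComp (h.map f) (h.map g)),
      HEq (S.mapComp g.op f.op).inv θ ∧ F.compH (h.map g) (h.map f) = hCell θ

/-- The double functor `F`, with values in the quintets of `K`, restricts along `v` to the
pseudofunctor `S`: they agree on objects, 1-cells, 2-cells and coherence 2-cells. A vertically
globular cell is sent by `F` to a cell whose horizontal sides are images of identities; it is turned
into a 2-cell `θ` of `K` by means of `unitH`. -/
structure RestrictsAlongVertical (v : VerticalEmbedding B D)
    (F : DoublePseudofunctor D.hop (quintet K) o) (S : B ⥤ᵖ K) : Prop where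
  obj (x : B) : S.obj x = o (v.obj x)
  map {x y : B} (f : x ⟶ y) : HEq (S.map f) (F.vMap (v.map f))
  map₂ {x y : B} {f g : x ⟶ y} (η : f ⟶ g) :
    ∃ θ : F.vMap (v.map f) ⟶ F.vMap (v.map g),
      HEq (S.map₂ η) θ ∧
      HEq ((quintet K).sqV (F.unitH (v.obj x)) (F.mapSq (v.cell η)))
        ((quintet K).sqV (vCell θ) (F.unitH (v.obj y)))
  mapId (x : B) :
    ∃ θ : F.vMap (D.vId (v.obj x)) ⟶ 𝟙 (o (v.obj x)),
      HEq (S.mapId x).hom θ ∧ F.unitV (v.obj x) = vCell θ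
  mapComp {x y z : B} (f : x ⟶ y) (g : y ⟶ z) :
    ∃ θ : F.vMap (D.vComp (v.map f) (v.map g)) ⟶ F.vMap (v.map f) ≫ F.vMap (v.map g),
      HEq (S.mapComp f g).hom θ ∧ F.compV (v.map f) (v.map g) = vCell θ

end Restriction

section Sites

/-- A small-generated site: a locally small, possibly large category with a Grothendieck topology
for which some small set `P` of objects is dense: every object is covered by the arrows that
factor through objects in `P`. -/
structure SmallGenSite where
  C : Type w
  [cat : Category.{u} C]
  J : GrothendieckTopology C
  exists_small_dense : ∃ P : ObjectProperty C, ObjectProperty.Small.{u} P ∧ P.ι.IsCoverDense J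

attribute [instance] SmallGenSite.cat

namespace SmallGenSite

theorem exists_smallSite (X : SmallGenSite.{u, w}) :
    ∃ (C₀ : Type u) (_ : SmallCategory C₀) (J₀ : GrothendieckTopology C₀) (G : C₀ ⥤ X.C),
      G.IsDenseSubsite J₀ X.J := by
  obtain ⟨P, hP, hd⟩ := X.exists_small_dense
  have : EssentiallySmall.{u} P.FullSubcategory :=
    @essentiallySmall_fullSubcategory_mem X.C _ {x | P x} hP _
  let e := (equivSmallModel.{u} P.FullSubcategory).symm
  have : (e.functor ⋙ P.ι).IsCoverDense X.J := by
    refine ⟨fun U => X.J.superset_covering ?_ (hd.is_cover U)⟩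
    rintro V f ⟨⟨Y, g, h, fac⟩⟩
    exact ⟨⟨e.inverse.obj Y, g ≫ P.ι.map (e.counitIso.inv.app Y),
      P.ι.map (e.counitIso.hom.app Y) ≫ h, by
        rw [Category.assoc, ← P.ι.map_comp_assoc, Iso.inv_hom_id_app]
        exact (congrArg (g ≫ ·) (Category.id_comp h)).trans fac⟩⟩
  exact ⟨SmallModel.{u} P.FullSubcategory, inferInstance,
    (e.functor ⋙ P.ι).inducedTopology X.J, e.functor ⋙ P.ι, inferInstance⟩

theorem pushforward_isEquivalence (X : SmallGenSite.{u, w}) {C₀ : Type u} [SmallCategory C₀]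
    (J₀ : GrothendieckTopology C₀) (G : C₀ ⥤ X.C) [G.IsDenseSubsite J₀ X.J] :
    (G.sheafPushforwardContinuous (Type u) J₀ X.J).IsEquivalence := by
  infer_instance

instance (X : SmallGenSite.{u, w}) : HasSheafify X.J (Type u) := by
  obtain ⟨C₀, _, J₀, G, _⟩ := X.exists_smallSite
  have := X.pushforward_isEquivalence J₀ G
  exact Functor.IsDenseSubsite.hasSheafify_of_isEquivalence J₀ X.J G (A := Type u)

/-- The topos of sheaves of sets on a small-generated site. -/
def sheafTopos (X : SmallGenSite.{u, w}) : GrothTopos.{u, max w (u + 1), max w u} where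
  E := Sheaf X.J (Type u)
  exists_site := by
    obtain ⟨C₀, _, J₀, G, _⟩ := X.exists_smallSite
    have := X.pushforward_isEquivalence J₀ G
    exact ⟨C₀, inferInstance, J₀, ⟨(G.sheafPushforwardContinuous (Type u) J₀ X.J).asEquivalence⟩⟩

/-- Sites with all functors and all natural transformations form a 2-category, in which morphisms
and comorphisms of sites are singled out below. -/
@[ext]
structure Hom (X Y : SmallGenSite.{u, w}) where
  functor : X.C ⥤ Y.C

instance : CategoryStruct SmallGenSite.{u, w} where
  Hom := Hom
  id X := ⟨𝟭 X.C⟩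
  comp f g := ⟨f.functor ⋙ g.functor⟩

@[simp] theorem comp_functor {X Y Z : SmallGenSite.{u, w}} (f : X ⟶ Y) (g : Y ⟶ Z) :
    (f ≫ g).functor = f.functor ⋙ g.functor := rfl
@[simp] theorem id_functor (X : SmallGenSite.{u, w}) : (𝟙 X : X ⟶ X).functor = 𝟭 X.C := rfl

/-- The 2-cells: natural transformations. -/
@[ext]
structure Hom₂ {X Y : SmallGenSite.{u, w}} (f g : X ⟶ Y) where
  hom : f.functor ⟶ g.functor

@[simps]
instance (X Y : SmallGenSite.{u, w}) : Category (X ⟶ Y) where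
  Hom f g := Hom₂ f g
  id f := ⟨𝟙 f.functor⟩
  comp η θ := ⟨η.hom ≫ θ.hom⟩

@[ext]
theorem hom₂_ext {X Y : SmallGenSite.{u, w}} {f g : X ⟶ Y} {η θ : f ⟶ g}
    (h : η.hom = θ.hom) : η = θ :=
  Hom₂.ext h

/-- Invertible 2-cells. -/
@[simps]
def isoMk {X Y : SmallGenSite.{u, w}} {f g : X ⟶ Y} (e : f.functor ≅ g.functor) :
    f ≅ g where
  hom := ⟨e.hom⟩
  inv := ⟨e.inv⟩

instance : Bicategory SmallGenSite.{u, w} where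
  homCategory := inferInstance
  whiskerLeft {_ _ _} f {_ _} η := Hom₂.mk (Functor.whiskerLeft f.functor (Hom₂.hom η))
  whiskerRight {_ _ _} {_ _} η h := Hom₂.mk (Functor.whiskerRight (Hom₂.hom η) h.functor)
  associator f g h := isoMk (f := (f ≫ g) ≫ h) (g := f ≫ g ≫ h)
    (Functor.associator f.functor g.functor h.functor)
  leftUnitor {X _} f := isoMk (f := 𝟙 X ≫ f) (g := f) (Functor.leftUnitor f.functor)
  rightUnitor {_ Y} f := isoMk (f := f ≫ 𝟙 Y) (g := f) (Functor.rightUnitor f.functor)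

theorem eqToHom_hom {X Y : SmallGenSite.{u, w}} {f g : X ⟶ Y} (h : f = g) :
    (eqToHom h).hom = eqToHom (congrArg Hom.functor h) := by
  subst h; rfl

theorem iso_ext {X Y : SmallGenSite.{u, w}} {f g : X ⟶ Y} {e e' : f ≅ g}
    (h : ∀ A, e.hom.hom.app A = e'.hom.hom.app A) : e = e' := by
  apply Iso.ext; apply hom₂_ext; apply NatTrans.ext; funext A; exact h A

instance : Bicategory.Strict SmallGenSite.{u, w} where
  id_comp _ := rfl
  comp_id _ := rfl
  assoc _ _ _ := rfl
  leftUnitor_eqToIso f := iso_ext fun X => by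
    rw [eqToIso.hom, eqToHom_hom]; rfl
  rightUnitor_eqToIso f := iso_ext fun X => by
    rw [eqToIso.hom, eqToHom_hom]; rfl
  associator_eqToIso f g h := iso_ext fun X => by
    rw [eqToIso.hom, eqToHom_hom]; rfl

end SmallGenSite

section Classes

variable {C : Type u₁} [Category.{v₁} C] {D : Type u₂} [Category.{v₂} D]
  {E : Type u₃} [Category.{v₃} E]

/-- For a diagram `c` in `C` and a cone `v` over `c ⋙ f`, the sieve of those arrows into the vertex
of `v` along which the cone `v` factors through the image under `f` of a cone over `c`. -/
def coneSieve (f : C ⥤ D) {I : Type} [SmallCategory I] (c : I ⥤ C) (v : Cone (c ⋙ f)) :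
    Sieve v.pt where
  arrows d' w := ∃ (a : Cone c) (t : d' ⟶ f.obj a.pt), ∀ i, t ≫ f.map (a.π.app i) = w ≫ v.π.app i
  downward_closed := by
    rintro Y Z w ⟨a, t, h⟩ g
    exact ⟨a, g ≫ t, fun i => by rw [Category.assoc, h i, Category.assoc]⟩

/-- Covering-flat functors: `coneSieve f c v` is covering for every cone over a finite diagram. -/
def CoveringFlat (K : GrothendieckTopology D) (f : C ⥤ D) : Prop :=
  ∀ (I : Type) [SmallCategory I] [FinCategory I] (c : I ⥤ C) (v : Cone (c ⋙ f)),
    coneSieve f c v ∈ K v.pt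

theorem coveringFlat_id (J : GrothendieckTopology C) : CoveringFlat J (𝟭 C) := by
  intro I _ _ c v
  refine J.superset_covering ?_ (J.top_mem v.pt)
  intro Y w _
  exact ⟨⟨v.pt, ⟨fun i => v.π.app i, fun i j k => v.π.naturality k⟩⟩, w, fun i => rfl⟩

theorem CoveringFlat.comp {K : GrothendieckTopology D} {L : GrothendieckTopology E}
    {f : C ⥤ D} {g : D ⥤ E} (hf : CoveringFlat K f) (hg : CoveringFlat L g)
    (hg' : CoverPreserving K L g) : CoveringFlat L (f ⋙ g) := by
  intro I _ _ c v
  refine L.transitive (hg I (c ⋙ f) v) _ ?_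
  rintro Y w ⟨b, t, ht⟩
  refine L.superset_covering ?_ (L.pullback_stable t (hg'.cover_preserve (hf I c b)))
  rintro Z x ⟨d, r, y, ⟨a, s, hs⟩, hy⟩
  refine ⟨a, y ≫ g.map s, fun i => ?_⟩
  have h1 := hs i
  have h2 := ht i
  simp only [Functor.comp_map, Category.assoc] at *
  rw [← g.map_comp, h1, g.map_comp, ← Category.assoc, ← hy, Category.assoc, h2]

/-- Morphisms of sites: functors that are covering-flat and preserve covers. -/
structure IsSiteMorphism (J : GrothendieckTopology C) (K : GrothendieckTopology D)
    (f : C ⥤ D) : Prop where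
  coveringFlat : CoveringFlat K f
  coverPreserving : CoverPreserving J K f

theorem CoveringFlat.compatiblePreserving {K : GrothendieckTopology D} {f : C ⥤ D}
    (hf : CoveringFlat K f) : CompatiblePreserving.{w} K f := by
  constructor
  intro F Z T x hx Y₁ Y₂ X f₁ f₂ g₁ g₂ hg₁ hg₂ e
  let c : Cone (cospan g₁ g₂ ⋙ f) :=
    (Cone.postcompose (diagramIsoCospan (cospan g₁ g₂ ⋙ f)).inv).obj (PullbackCone.mk f₁ f₂ e)
  have hS := hf WalkingCospan (cospan g₁ g₂) c
  have hF := (isSheaf_iff_isSheaf_of_type _ _).1 F.property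
  refine (hF.isSeparated _ hS).ext ?_
  rintro W (w : W ⟶ X) ⟨a, t, ht⟩
  obtain ⟨p₁, p₂, h1, h2, h3⟩ : ∃ (p₁ : a.pt ⟶ Y₁) (p₂ : a.pt ⟶ Y₂),
      t ≫ f.map p₁ = w ≫ f₁ ∧ t ≫ f.map p₂ = w ≫ f₂ ∧ p₁ ≫ g₁ = p₂ ≫ g₂ :=
    ⟨a.π.app WalkingCospan.left, a.π.app WalkingCospan.right,
      (ht WalkingCospan.left).trans (congrArg (w ≫ ·) (Category.comp_id f₁)),
      (ht WalkingCospan.right).trans (congrArg (w ≫ ·) (Category.comp_id f₂)),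
      PullbackCone.condition (a : PullbackCone g₁ g₂)⟩
  have h4 : F.obj.map t.op (F.obj.map (f.map p₁).op (x g₁ hg₁)) =
      F.obj.map t.op (F.obj.map (f.map p₂).op (x g₂ hg₂)) :=
    congrArg (F.obj.map t.op) (hx _ _ hg₁ hg₂ h3)
  rw [← Functor.map_comp_apply, ← Functor.map_comp_apply, ← op_comp, ← op_comp, h1, h2,
    op_comp, op_comp, Functor.map_comp_apply, Functor.map_comp_apply] at h4
  exact h4

theorem IsSiteMorphism.isContinuous {J : GrothendieckTopology C} {K : GrothendieckTopology D}
    {f : C ⥤ D} (hf : IsSiteMorphism J K f) : f.IsContinuous J K :=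
  Functor.isContinuous_of_coverPreserving hf.coveringFlat.compatiblePreserving hf.coverPreserving

end Classes
end Sites

section DoubleSites

namespace SmallGenSite

/-- The class of morphisms of sites. -/
def IsMorphism ⦃X Y : SmallGenSite.{u, w}⦄ (f : X ⟶ Y) : Prop :=
  IsSiteMorphism X.J Y.J f.functor

/-- The class of comorphisms of sites: the cover-lifting functors. -/
def IsComorphism ⦃X Y : SmallGenSite.{u, w}⦄ (F : X ⟶ Y) : Prop :=
  F.functor.IsCocontinuous X.J Y.J

instance : IsWide IsMorphism.{u, w} where
  id_mem X := ⟨coveringFlat_id X.J, idCoverPreserving X.J⟩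
  comp_mem _ _ _ _ _ hf hg :=
    ⟨hf.coveringFlat.comp hg.coveringFlat hg.coverPreserving,
      CoverPreserving.comp _ _ hf.coverPreserving hg.coverPreserving⟩

instance : IsWide IsComorphism.{u, w} where
  id_mem X := isCocontinuous_id X.J
  comp_mem X Y Z f g hf hg := by
    have : f.functor.IsCocontinuous X.J Y.J := hf
    have : g.functor.IsCocontinuous Y.J Z.J := hg
    exact isCocontinuous_comp f.functor g.functor X.J Y.J

end SmallGenSite

/-- The 2-category of sites and morphisms of sites. -/
abbrev SiteFlat := LocallyFull SmallGenSite.IsMorphism.{u, w}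
/-- The 2-category of sites and comorphisms of sites. -/
abbrev SiteSharp := LocallyFull SmallGenSite.IsComorphism.{u, w}

/-- The double category of sites: horizontal arrows are the morphisms of sites, vertical arrows are
the comorphisms of sites, and a cell with top `f`, left side `G`, right side `K` and bottom `h` is
a natural transformation `f ⋙ K ⟶ G ⋙ h`. -/
def siteLax : DoubleCat.{max u w, max u w, max u w, max (u + 1) (w + 1)} :=
  laxSquares SmallGenSite.IsMorphism.{u, w} SmallGenSite.IsComorphism.{u, w}

/-- The horizontal embedding of the 2-category of sites and morphisms of sites. -/
def siteLaxH : HorizontalEmbedding SiteFlat.{u, w} siteLax.{u, w} :=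
  laxSquares.h _ _

/-- The vertical embedding of the 2-cell dual of the 2-category of sites and comorphisms of sites. -/
def siteLaxV : VerticalEmbedding (Co SiteSharp.{u, w}) siteLax.{u, w} :=
  laxSquares.v _ _

/-- The 2-category of Grothendieck topoi, of the size of the topoi of sheaves on small-generated
sites. -/
abbrev GTop := GrothTopos.{u, max w (u + 1), max w u}

/-- The lax quintet double category of Grothendieck topoi. -/
def toposLax :
    DoubleCat.{max w (u + 1), max w (u + 1), max w (u + 1), max (u + 2) (w + 1)} :=
  quintet GTop.{u, w}

end DoubleSites

section Sheafification

namespace SmallGenSite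

variable {X Y Z : SmallGenSite.{u, w}}

/-- The direct image along a morphism of sites: restriction of sheaves along it. -/
noncomputable def directImage (f : X ⟶ Y) (hf : IsMorphism f) :
    Sheaf Y.J (Type u) ⥤ Sheaf X.J (Type u) :=
  have : f.functor.IsContinuous X.J Y.J := hf.isContinuous
  f.functor.sheafPushforwardContinuous (Type u) X.J Y.J

/-- Restriction along the identity is the identity. -/
noncomputable def directImageId (X : SmallGenSite.{u, w}) (h : IsMorphism (𝟙 X)) :
    directImage (𝟙 X) h ≅ 𝟭 (Sheaf X.J (Type u)) :=
  Iso.refl _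

/-- Restriction along a composite is the composite of the restrictions. -/
noncomputable def directImageComp (f : X ⟶ Y) (hf : IsMorphism f) (g : Y ⟶ Z) (hg : IsMorphism g)
    (hfg : IsMorphism (f ≫ g)) :
    directImage (f ≫ g) hfg ≅ directImage g hg ⋙ directImage f hf :=
  Iso.refl _

/-- Restriction of presheaves along a functor. -/
def rest (F : X ⟶ Y) : (Y.Cᵒᵖ ⥤ Type u) ⥤ (X.Cᵒᵖ ⥤ Type u) :=
  (Functor.whiskeringLeft _ _ _).obj F.functor.op

/-- The inverse image along a comorphism of sites: restrict a sheaf, then sheafify. -/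
noncomputable def restSheaf (F : X ⟶ Y) : Sheaf Y.J (Type u) ⥤ Sheaf X.J (Type u) :=
  sheafToPresheaf Y.J (Type u) ⋙ rest F ⋙ presheafToSheaf X.J (Type u)

/-- The comparison for an identity: the counit of sheafification. -/
noncomputable def restSheafId (X : SmallGenSite.{u, w}) :
    restSheaf (𝟙 X) ⟶ 𝟭 (Sheaf X.J (Type u)) :=
  (sheafificationAdjunction X.J (Type u)).counit

/-- The comparison for a composite: induced by the unit of the intermediate sheafification. -/
noncomputable def restSheafComp (F : X ⟶ Y) (G : Y ⟶ Z) :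
    restSheaf (F ≫ G) ⟶ restSheaf G ⋙ restSheaf F :=
  Functor.whiskerLeft (sheafToPresheaf Z.J (Type u) ⋙ rest G)
    (Functor.whiskerRight (sheafificationAdjunction Y.J (Type u)).unit
      (rest F ⋙ presheafToSheaf X.J (Type u)))

/-- The transformation of restriction functors of presheaves induced by a lax square. -/
def restCell {A B C D : SmallGenSite.{u, w}} {f : A ⟶ B} {G : A ⟶ C} {K : B ⟶ D} {h : C ⟶ D}
    (φ : f ≫ K ⟶ G ≫ h) : rest h ⋙ rest G ⟶ rest K ⋙ rest f :=
  (Functor.whiskeringLeft _ _ (Type u)).map (NatTrans.op (Hom₂.hom φ))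

/-- The transformation between restrictions followed by sheafification that a lax square `φ` of sites
induces: `restCell φ`, followed by the unit of sheafification on `B`, sheafified on `A`. -/
noncomputable def crossCell {A B C D : SmallGenSite.{u, w}} {f : A ⟶ B} (hf : IsMorphism f)
    {G : A ⟶ C} {K : B ⟶ D} {h : C ⟶ D} (hh : IsMorphism h) (φ : f ≫ K ⟶ G ≫ h) :
    directImage h hh ⋙ restSheaf G ⟶ restSheaf K ⋙ directImage f hf :=
  let ι := sheafToPresheaf D.J (Type u)
  let a := presheafToSheaf A.J (Type u)
  let s : ι ⋙ (rest h ⋙ rest G) ⋙ a ⟶ ι ⋙ (rest K ⋙ rest f) ⋙ a :=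
    Functor.whiskerLeft ι (Functor.whiskerRight (restCell φ) a)
  let t : (ι ⋙ rest K) ⋙ rest f ⋙ a ⟶
      (ι ⋙ rest K) ⋙ (presheafToSheaf B.J (Type u) ⋙ sheafToPresheaf B.J (Type u)) ⋙ rest f ⋙ a :=
    Functor.whiskerLeft (ι ⋙ rest K)
      (Functor.whiskerRight (sheafificationAdjunction B.J (Type u)).unit (rest f ⋙ a))
  let e : (restSheaf K ⋙ directImage f hf) ⋙ sheafToPresheaf A.J (Type u) ⋙ a ⟶
      (restSheaf K ⋙ directImage f hf) ⋙ 𝟭 (Sheaf A.J (Type u)) :=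
    Functor.whiskerLeft (restSheaf K ⋙ directImage f hf)
      (sheafificationAdjunction A.J (Type u)).counit
  s ≫ t ≫ e

end SmallGenSite

section Images

variable (F : DoublePseudofunctor siteLax.{u, w}.hop toposLax.{u, w} SmallGenSite.sheafTopos)

/-- The geometric morphism `Sh(f)` that `F` assigns to a morphism of sites `f : X ⟶ Y`. -/
def geomH {X Y : SmallGenSite.{u, w}} (f : siteLax.H X Y) :
    GeomMorph Y.sheafTopos X.sheafTopos :=
  F.mapH f

/-- The geometric morphism `C_G` that `F` assigns to a comorphism of sites `G : X ⟶ Y`. -/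
def geomV {X Y : SmallGenSite.{u, w}} (G : siteLax.V X Y) :
    GeomMorph X.sheafTopos Y.sheafTopos :=
  F.mapV G

/-- The transformation of inverse images that `F` assigns to a lax square of sites, for the lax square
`Sh(f) ≫ C_G ⟶ C_K ≫ Sh(h)` of topoi. -/
def geomSq {A B C D : SmallGenSite.{u, w}} {f : siteLax.H A B} {G : siteLax.V A C}
    {K : siteLax.V B D} {h : siteLax.H C D} (φ : siteLax.Sq f G K h) :
    (geomV F G).inverse ⋙ (geomH F f).inverse ⟶ (geomH F h).inverse ⋙ (geomV F K).inverse :=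
  GeomMorph.Hom₂.hom (F.mapSq φ)

end Images

/-- Data exhibiting `F` as sheafification. The direct image of `Sh(f)` is restriction along `f`, and
the inverse image of `C_G` is restriction along `G` followed by sheafification; under these
identifications the coherence cells of `F` are the canonical ones, and the image of a lax square
`φ` is the mate, under the adjunctions of inverse and direct images of `Sh(h)` and `Sh(f)`, of the
transformation `crossCell φ`. -/
structure SheafificationDatum
    (F : DoublePseudofunctor siteLax.{u, w}.hop toposLax.{u, w} SmallGenSite.sheafTopos) where
  dir {X Y : SmallGenSite.{u, w}} (f : siteLax.H X Y) :
    (geomH F f).direct ≅ SmallGenSite.directImage f.1 f.2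
  inv {X Y : SmallGenSite.{u, w}} (G : siteLax.V X Y) :
    (geomV F G).inverse ≅ SmallGenSite.restSheaf G.1
  unitH (X : SmallGenSite.{u, w}) :
    conjugateEquiv (geomH F (siteLax.hId X)).adj Adjunction.id
        (GeomMorph.Hom₂.hom (hCell.symm (F.unitH X))) =
      (dir (siteLax.hId X)).hom ≫ (SmallGenSite.directImageId X _).hom
  compH {X Y Z : SmallGenSite.{u, w}} (f : siteLax.H X Y) (g : siteLax.H Y Z) :
    conjugateEquiv (geomH F (siteLax.hComp f g)).adj
        ((geomH F f).adj.comp (geomH F g).adj)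
        (GeomMorph.Hom₂.hom (hCell.symm (F.compH g f))) ≫ ((dir g).hom ◫ (dir f).hom) =
      (dir (siteLax.hComp f g)).hom ≫ (SmallGenSite.directImageComp f.1 f.2 g.1 g.2 _).hom
  unitV (X : SmallGenSite.{u, w}) :
    GeomMorph.Hom₂.hom (vCell.symm (F.unitV X)) =
      (inv (siteLax.vId X)).hom ≫ SmallGenSite.restSheafId X
  compV {X Y Z : SmallGenSite.{u, w}} (G : siteLax.V X Y) (K : siteLax.V Y Z) :
    GeomMorph.Hom₂.hom (vCell.symm (F.compV G K)) ≫ ((inv K).hom ◫ (inv G).hom) =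
      (inv (siteLax.vComp G K)).hom ≫ SmallGenSite.restSheafComp G.1 K.1
  cell {A B C D : SmallGenSite.{u, w}} {f : siteLax.H A B} {G : siteLax.V A C}
    {K : siteLax.V B D} {h : siteLax.H C D} (φ : siteLax.Sq f G K h) :
    (mateEquiv (geomH F h).adj (geomH F f).adj
        (TwoSquare.mk _ _ _ _ (geomSq F φ))).natTrans ≫ ((inv K).hom ◫ (dir f).hom) =
      ((dir h).hom ◫ (inv G).hom) ≫ SmallGenSite.crossCell f.2 h.2 φ

end Sheafification

/-!
A morphism of sites `f : X ⟶ Y` induces a geometric morphism because restriction of sheaves along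
`f` has a left exact left adjoint. Consider the comma category of arrows `d ⟶ f c` with its
projections to `Y` and to `X`. Covering-flatness of `f`, applied to empty diagrams, to pairs of
objects and to parallel pairs, says that the projection to `Y` is cover-dense, locally full and
locally faithful, so that sheaves on the comma category, for the induced topology, are sheaves on
`Y`. As the projection to `X` is left adjoint to `c ↦ (f c, c, 𝟙)`, restriction along it is left
adjoint to restriction along this section, and the inverse image is restriction to the comma
category followed by sheafification (`exists_inverseImage`). The comma category is again
small-generated, whence sheafification and the comparison lemma are available.

For a comorphism of sites `G`, restriction followed by sheafification is left exact and inverts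
local isomorphisms, so that the canonical comparison for a composite is invertible
(`IsComorphism.isIso_restSheafComp`). The right adjoint is right Kan extension, after restriction
to a small dense subsite (`IsComorphism.isLeftAdjoint_restSheaf`).

Every coherence law is then checked on components and by transposition. Maps out of the
sheafification of a restricted sheaf are determined by their composites with `toRestSheaf`, the
unit of sheafification; maps out of an inverse image along a morphism of sites by their composites
with `inverseImageUnit`. Both kinds of transposes reduce the laws to identities between
restrictions of presheaves: `crossCell_sqV`, `crossCell_sqH` and their globular versions are the
laws for lax squares before passing to mates, and `inverseImageCell_sqV`,
`inverseImageCell_sqH`, `inverseImageCell_hCell`, `inverseImageCell_vCell` those after it. Since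
the composition of geometric morphisms is strict, globular cells of quintets compose like 2-cells,
up to `HEq`; this turns the laws of a double functor into equations of natural transformations.
-/

/-! ### Dense subsites -/

section DenseSubsites

theorem isDenseSubsite_comp {C : Type u₁} [Category.{v₁} C] {D : Type u₂} [Category.{v₂} D]
    {E : Type u₃} [Category.{v₃} E] (J : GrothendieckTopology C) (K : GrothendieckTopology D)
    (L : GrothendieckTopology E) (G : C ⥤ D) (H : D ⥤ E) [G.IsDenseSubsite J K]
    [H.IsDenseSubsite K L] : (G ⋙ H).IsDenseSubsite J L := by
  have mem_iff {X : C} {S : Sieve X} : S.functorPushforward (G ⋙ H) ∈ L _ ↔ S ∈ J _ := by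
    rw [Sieve.functorPushforward_comp]
    exact (Functor.functorPushforward_mem_iff (J := K) (K := L) (G := H)).trans
      (Functor.functorPushforward_mem_iff (J := J) (K := K) (G := G))
  refine ⟨⟨fun U => ?_⟩, ⟨fun {U V} f => ?_⟩, ⟨fun {U V} f₁ f₂ h => ?_⟩, mem_iff⟩
  · have := Functor.IsDenseSubsite.isCoverDense J K G
    have := Functor.IsDenseSubsite.isCoverDense K L H
    refine L.transitive (H.is_cover_of_isCoverDense L U) _ ?_
    rintro V f ⟨⟨W, a, b, rfl⟩⟩
    rw [Sieve.pullback_comp]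
    refine L.pullback_stable a (L.superset_covering ?_
      ((Functor.functorPushforward_mem_iff (J := K) (K := L) (G := H)).2
        (G.is_cover_of_isCoverDense K W)))
    rintro T _ ⟨T', c, d, ⟨⟨R, p, q, rfl⟩⟩, rfl⟩
    exact ⟨⟨R, d ≫ H.map p, H.map q ≫ b, by simp⟩⟩
  · refine mem_iff.2 (J.transitive (G.cover_lift J K
      (Functor.IsDenseSubsite.imageSieve_mem K L H f)) _ ?_)
    rintro W g ⟨l, hl⟩
    refine J.superset_covering ?_ (Functor.IsDenseSubsite.imageSieve_mem J K G l)
    rintro T h ⟨m, hm⟩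
    exact ⟨m, by simp only [Functor.comp_map, hm, Functor.map_comp, hl, Category.assoc]⟩
  · refine mem_iff.2 (J.transitive (G.cover_lift J K
      (Functor.IsDenseSubsite.equalizer_mem K L H (G.map f₁) (G.map f₂) h)) _ ?_)
    intro W g hg
    have hg' : G.map g ≫ G.map f₁ = G.map g ≫ G.map f₂ := hg
    refine J.superset_covering ?_ (Functor.IsDenseSubsite.equalizer_mem J K G (g ≫ f₁) (g ≫ f₂)
      (by simpa using hg'))
    intro T h hh
    have hh' : h ≫ g ≫ f₁ = h ≫ g ≫ f₂ := hh
    change (h ≫ g) ≫ f₁ = (h ≫ g) ≫ f₂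
    simpa using hh'

/-- Local isomorphisms of presheaves may be detected on a dense subsite. -/
theorem W_of_whiskerLeft_of_isDenseSubsite {C : Type u₁} [Category.{v₁} C] {D : Type u₂}
    [Category.{v₂} D] (J : GrothendieckTopology C) (K : GrothendieckTopology D) (G : C ⥤ D)
    [G.IsDenseSubsite J K] {P Q : Dᵒᵖ ⥤ Type w} (α : P ⟶ Q)
    (h : J.W (Functor.whiskerLeft G.op α)) : K.W α := by
  have := Functor.IsDenseSubsite.isCoverDense J K G
  have := Functor.IsDenseSubsite.isLocallyFull J K G
  intro Z hZ
  let Z' : Sheaf K (Type w) := ⟨Z, hZ⟩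
  let e {P : Dᵒᵖ ⥤ Type w} : (P ⟶ Z) ≃ (G.op ⋙ P ⟶ G.op ⋙ Z) :=
    (Functor.IsCoverDense.restrictHomEquivHom (G := G) (ℱ' := Z')).symm
  have hb := h (G.op ⋙ Z) ((G.sheafPushforwardContinuous (Type w) J K).obj Z').property
  exact (Function.Bijective.of_comp_iff' e.bijective _).1 (hb.comp e.bijective)

/-- Restriction along a cocontinuous functor out of a small site preserves local isomorphisms: by
adjunction, maps into a sheaf `Z` correspond to maps into the right Kan extension of `Z`, which is
again a sheaf. -/
theorem W_whiskerLeft_of_isCocontinuous {C : Type u} [SmallCategory C] {D : Type w}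
    [Category.{u} D] (J : GrothendieckTopology C) (K : GrothendieckTopology D) (G : C ⥤ D)
    [G.IsCocontinuous J K] {P Q : Dᵒᵖ ⥤ Type u} (α : P ⟶ Q) (h : K.W α) :
    J.W (Functor.whiskerLeft G.op α) := by
  intro Z hZ
  have hb := h _ (ran_isSheaf_of_isCocontinuous (J := J) K (G := G) ⟨Z, hZ⟩)
  let e {P : Dᵒᵖ ⥤ Type u} := (G.op.ranAdjunction (Type u)).homEquiv P Z
  have key : e ∘ (fun β : G.op ⋙ Q ⟶ Z => Functor.whiskerLeft G.op α ≫ β) =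
      (fun β => α ≫ β) ∘ e :=
    funext fun β => (G.op.ranAdjunction (Type u)).homEquiv_naturality_left α β
  exact (Function.Bijective.of_comp_iff' (e (P := P)).bijective _).1
    (key ▸ hb.comp (e (P := Q)).bijective)

end DenseSubsites

/-! ### Inverse images along comorphisms of sites -/

namespace SmallGenSite
variable {X Y Z : SmallGenSite.{u, w}}

/-- Restricting along a comorphism of sites and sheafifying inverts local isomorphisms. -/
theorem IsComorphism.isIso_map {F : X ⟶ Y} (hF : IsComorphism F) {P Q : Y.Cᵒᵖ ⥤ Type u}
    (α : P ⟶ Q) (h : Y.J.W α) :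
    IsIso ((rest F ⋙ presheafToSheaf X.J (Type u)).map α) := by
  have : F.functor.IsCocontinuous X.J Y.J := hF
  obtain ⟨C₀, _, J₀, G, _⟩ := X.exists_smallSite
  have := isCocontinuous_comp G F.functor J₀ X.J (L := Y.J)
  exact (X.J.W_iff _).1 (W_of_whiskerLeft_of_isDenseSubsite J₀ X.J G _
    (W_whiskerLeft_of_isCocontinuous J₀ Y.J (G ⋙ F.functor) α h))

theorem preservesFiniteLimits_rest (F : X ⟶ Y) : PreservesFiniteLimits (rest F) :=
  ⟨fun _ _ _ => inferInstanceAs (PreservesLimitsOfShape _ ((Functor.whiskeringLeft _ _ _).obj _))⟩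

theorem preservesFiniteLimits_restSheaf (F : X ⟶ Y) : PreservesFiniteLimits (restSheaf F) := by
  have := preservesFiniteLimits_rest F
  have : PreservesFiniteLimits (sheafToPresheaf Y.J (Type u)) :=
    ⟨fun _ _ _ => inferInstance⟩
  exact comp_preservesFiniteLimits _ _

/-- For a comorphism of sites out of a small site the right adjoint is the right Kan extension; the
general case follows by restriction to a small dense subsite. -/
theorem IsComorphism.isLeftAdjoint_restSheaf {F : X ⟶ Y} (hF : IsComorphism F) :
    (restSheaf F).IsLeftAdjoint := by
  have : F.functor.IsCocontinuous X.J Y.J := hF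
  obtain ⟨C₀, _, J₀, G, _⟩ := X.exists_smallSite
  have := isCocontinuous_comp G F.functor J₀ X.J (L := Y.J)
  have := X.pushforward_isEquivalence J₀ G
  let H := G ⋙ F.functor
  let L : Sheaf Y.J (Type u) ⥤ Sheaf J₀ (Type u) :=
    sheafToPresheaf Y.J (Type u) ⋙ (Functor.whiskeringLeft _ _ _).obj H.op ⋙
      presheafToSheaf J₀ (Type u)
  let adj : L ⊣ H.sheafPushforwardCocontinuous (Type u) J₀ Y.J :=
    ((H.op.ranAdjunction (Type u)).comp
      (sheafificationAdjunction J₀ (Type u))).restrictFullyFaithful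
      (fullyFaithfulSheafToPresheaf Y.J (Type u)) (Functor.FullyFaithful.id _)
      (Iso.refl _) (Iso.refl _)
  let E := G.sheafPushforwardContinuous (Type u) J₀ X.J
  let e : restSheaf F ⋙ E ≅ L :=
    Functor.isoWhiskerLeft (sheafToPresheaf Y.J (Type u) ⋙ rest F)
      (G.pushforwardContinuousSheafificationCompatibility (Type u) J₀ X.J).symm
  have : L.IsLeftAdjoint := adj.isLeftAdjoint
  let e' : L ⋙ E.inv ≅ restSheaf F :=
    Functor.isoWhiskerRight e.symm E.inv ≪≫ Functor.associator _ _ _ ≪≫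
      Functor.isoWhiskerLeft (restSheaf F) E.asEquivalence.unitIso.symm ≪≫ Functor.rightUnitor _
  exact Functor.isLeftAdjoint_of_iso e'

end SmallGenSite

/-! ### Inverse images along morphisms of sites -/

section CommaSite

variable {C : Type u₁} [Category.{v₁} C] {D : Type u₂} [Category.{v₂} D]
  {f : C ⥤ D} {K : GrothendieckTopology D}

/-- A covering-flat functor `f` makes the comma category of arrows `d ⟶ f c` cover-dense in `D`:
apply covering-flatness to empty diagrams. -/
theorem CoveringFlat.isCoverDense_comma_fst (hf : CoveringFlat K f) :
    (Comma.fst (𝟭 D) f).IsCoverDense K where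
  is_cover d := by
    let c : Discrete PEmpty.{1} ⥤ C := Functor.empty C
    let v : Cone (c ⋙ f) := ⟨d, ⟨fun i => i.as.elim, fun i => i.as.elim⟩⟩
    refine K.superset_covering ?_ (hf _ c v)
    rintro d' w ⟨a, t, -⟩
    exact ⟨⟨⟨d', a.pt, t⟩, 𝟙 d', w, Category.id_comp w⟩⟩

/-- Covering-flatness for pairs of objects. -/
theorem CoveringFlat.isLocallyFull_comma_fst (hf : CoveringFlat K f) :
    (Comma.fst (𝟭 D) f).IsLocallyFull K where
  functorPushforward_imageSieve_mem {U V} g := by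
    let c : Discrete WalkingPair ⥤ C := pair U.right V.right
    let v : Cone (c ⋙ f) := ⟨U.left, ⟨fun i => match i with
      | ⟨WalkingPair.left⟩ => U.hom
      | ⟨WalkingPair.right⟩ => g ≫ V.hom, by
        rintro ⟨_ | _⟩ ⟨_ | _⟩ ⟨⟨⟨⟩⟩⟩ <;> simp [c]⟩⟩
    refine K.superset_covering ?_ (hf _ c v)
    rintro d' (w : d' ⟶ U.left) ⟨a, t, ht⟩
    have h₁ : t ≫ f.map (a.π.app ⟨WalkingPair.left⟩) = w ≫ U.hom := ht ⟨WalkingPair.left⟩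
    have h₂ : t ≫ f.map (a.π.app ⟨WalkingPair.right⟩) = w ≫ g ≫ V.hom := ht ⟨WalkingPair.right⟩
    let T : Comma (𝟭 D) f := ⟨d', a.pt, t⟩
    let p : T ⟶ U := ⟨w, a.π.app ⟨WalkingPair.left⟩, h₁.symm⟩
    let q : T ⟶ V := ⟨w ≫ g, a.π.app ⟨WalkingPair.right⟩, (Category.assoc _ _ _).trans h₂.symm⟩
    exact ⟨T, p, 𝟙 d', ⟨q, rfl⟩, (Category.id_comp w).symm⟩

/-- Covering-flatness for parallel pairs of arrows. -/
theorem CoveringFlat.isLocallyFaithful_comma_fst (hf : CoveringFlat K f) :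
    (Comma.fst (𝟭 D) f).IsLocallyFaithful K where
  functorPushforward_equalizer_mem {U V} g₁ g₂ h := by
    have h' : g₁.left = g₂.left := h
    have hw : U.hom ≫ f.map g₁.right = U.hom ≫ f.map g₂.right := by
      have e₁ : g₁.left ≫ V.hom = U.hom ≫ f.map g₁.right := g₁.w
      have e₂ : g₂.left ≫ V.hom = U.hom ≫ f.map g₂.right := g₂.w
      rw [← e₁, ← e₂, h']
    let c : WalkingParallelPair ⥤ C := parallelPair g₁.right g₂.right
    let v : Cone (c ⋙ f) := ⟨U.left, ⟨fun i => match i with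
      | WalkingParallelPair.zero => U.hom
      | WalkingParallelPair.one => U.hom ≫ f.map g₁.right, by
        rintro _ _ (_ | _ | _) <;> simp [c, hw]⟩⟩
    refine K.superset_covering ?_ (hf _ c v)
    rintro d' (w : d' ⟶ U.left) ⟨a, t, ht⟩
    have h₁ : t ≫ f.map (a.π.app WalkingParallelPair.zero) = w ≫ U.hom :=
      ht WalkingParallelPair.zero
    have h₂ : a.π.app WalkingParallelPair.zero ≫ g₁.right =
        a.π.app WalkingParallelPair.zero ≫ g₂.right :=
      (a.w WalkingParallelPairHom.left).trans (a.w WalkingParallelPairHom.right).symm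
    let T : Comma (𝟭 D) f := ⟨d', a.pt, t⟩
    let p : T ⟶ U := ⟨w, a.π.app WalkingParallelPair.zero, h₁.symm⟩
    refine ⟨T, p, 𝟙 d', ?_, (Category.id_comp w).symm⟩
    exact Comma.hom_ext _ _ (congrArg (w ≫ ·) h') h₂

end CommaSite

section CommaSite
variable {C : Type u₁} [Category.{v₁} C] {D : Type u₂} [Category.{v₂} D]

/-- The functor `c ↦ (f c, c, 𝟙)` to the comma category of arrows `d ⟶ f c`. -/
@[simps]
def commaIdSection (f : C ⥤ D) : C ⥤ Comma (𝟭 D) f where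
  obj c := ⟨f.obj c, c, 𝟙 _⟩
  map g := ⟨f.map g, g, by simp⟩

/-- The projection from the comma category of arrows `d ⟶ f c` to `c` is left adjoint to
`c ↦ (f c, c, 𝟙)`. -/
def commaSndAdjunction (f : C ⥤ D) : Comma.snd (𝟭 D) f ⊣ commaIdSection f where
  unit :=
    { app := fun T => ⟨T.hom, 𝟙 _, (Category.comp_id T.hom).trans
        ((Category.comp_id T.hom).symm.trans (congrArg (T.hom ≫ ·) (f.map_id _).symm))⟩
      naturality := fun _ _ g => Comma.hom_ext _ _ g.w
        ((Category.comp_id g.right).trans (Category.id_comp g.right).symm) }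
  counit :=
    { app := fun c => 𝟙 c
      naturality := fun _ _ g => (Category.comp_id g).trans (Category.id_comp g).symm }
  left_triangle_components T := Category.comp_id (𝟙 T.right)
  right_triangle_components c := Comma.hom_ext _ _
    ((Category.id_comp (f.map (𝟙 c))).trans (f.map_id c))
    (Category.comp_id (𝟙 c))

end CommaSite

namespace SmallGenSite
variable {X Y Z : SmallGenSite.{u, w}}

/-- The comma category of arrows `d ⟶ f c`, for a morphism of sites `f : X ⟶ Y`, with the topology
induced along the projection to `Y`. -/
def commaSite (f : X ⟶ Y) (hf : IsMorphism f) : SmallGenSite.{u, max w u} where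
  C := Comma (𝟭 Y.C) f.functor
  J := (Comma.fst (𝟭 Y.C) f.functor).inducedTopology Y.J
  exists_small_dense := by
    obtain ⟨P, hP, hPd⟩ := X.exists_small_dense
    obtain ⟨Q, hQ, hQd⟩ := Y.exists_small_dense
    have := hf.coveringFlat.isCoverDense_comma_fst
    have := hf.coveringFlat.isLocallyFull_comma_fst
    have := hf.coveringFlat.isLocallyFaithful_comma_fst
    have hP' : Small.{u} {c // P c} := hP
    have hQ' : Small.{u} {d // Q d} := hQ
    let S := Σ (c : {c // P c}) (d : {d // Q d}), (d.1 ⟶ f.functor.obj c.1)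
    let o : S → Comma (𝟭 Y.C) f.functor := fun s => ⟨s.2.1.1, s.1.1, s.2.2⟩
    refine ⟨fun T => T ∈ Set.range o, small_range o, ⟨fun T => ?_⟩⟩
    rw [Functor.mem_inducedTopology_iff_of_isCoverDense]
    -- Cover `T.right` by objects in `P`, pull the image of this cover back to `T.left`, and refine
    -- the result by objects in `Q`.
    refine Y.J.transitive (Y.J.pullback_stable T.hom
      (hf.coverPreserving.cover_preserve (hPd.is_cover T.right))) _ ?_
    rintro d w ⟨c, p, q, ⟨⟨c₀, a, b, rfl⟩⟩, hw⟩
    refine Y.J.superset_covering ?_ (hQd.is_cover d)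
    rintro d' _ ⟨⟨d₀, r, s, rfl⟩⟩
    have hsq : (s ≫ w) ≫ T.hom = (s ≫ q ≫ f.functor.map a) ≫ f.functor.map b := by
      have h : w ≫ T.hom = q ≫ f.functor.map (a ≫ b) := hw
      rw [Category.assoc, h, Functor.map_comp, Category.assoc, Category.assoc]
    let T₀ : Comma (𝟭 Y.C) f.functor := o ⟨⟨c₀.1, c₀.2⟩, ⟨d₀.1, d₀.2⟩, s ≫ q ≫ f.functor.map a⟩
    let g : T₀ ⟶ T := ⟨s ≫ w, b, hsq⟩
    exact ⟨T₀, g, r, ⟨⟨⟨T₀, ⟨_, rfl⟩⟩, 𝟙 _, g, Category.id_comp g⟩⟩, Category.assoc _ _ _⟩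

theorem isDenseSubsite_commaSite (f : X ⟶ Y) (hf : IsMorphism f) :
    (Comma.fst (𝟭 Y.C) f.functor).IsDenseSubsite (commaSite f hf).J Y.J := by
  have := hf.coveringFlat.isCoverDense_comma_fst
  have := hf.coveringFlat.isLocallyFull_comma_fst
  have := hf.coveringFlat.isLocallyFaithful_comma_fst
  exact inferInstanceAs ((Comma.fst (𝟭 Y.C) f.functor).IsDenseSubsite
    ((Comma.fst (𝟭 Y.C) f.functor).inducedTopology Y.J) Y.J)

/-- The comparison lemma for a dense functor between small-generated sites: both are compared with a
small dense subsite. -/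
theorem isEquivalence_of_isDenseSubsite (X : SmallGenSite.{u, w}) {D : Type a} [Category.{u} D]
    (K : GrothendieckTopology D) (G : X.C ⥤ D) [G.IsDenseSubsite X.J K] :
    (G.sheafPushforwardContinuous (Type u) X.J K).IsEquivalence := by
  obtain ⟨C₀, _, J₀, H, _⟩ := X.exists_smallSite
  have := isDenseSubsite_comp J₀ X.J K H G
  have : (H.sheafPushforwardContinuous (Type u) J₀ X.J).IsEquivalence := inferInstance
  have : ((H ⋙ G).sheafPushforwardContinuous (Type u) J₀ K).IsEquivalence := inferInstance
  have : (G.sheafPushforwardContinuous (Type u) X.J K ⋙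
    H.sheafPushforwardContinuous (Type u) J₀ X.J).IsEquivalence := this
  exact Functor.isEquivalence_of_comp_right _ (H.sheafPushforwardContinuous (Type u) J₀ X.J)

/-- The direct image along a morphism of sites `f : X ⟶ Y` has a left adjoint that preserves finite
limits: restrict a sheaf on `X` to the comma site, sheafify, and pass to `Y` by the comparison
lemma. -/
theorem exists_inverseImage (f : X ⟶ Y) (hf : IsMorphism f) :
    ∃ L : Sheaf X.J (Type u) ⥤ Sheaf Y.J (Type u),
      Nonempty (L ⊣ directImage f hf) ∧ PreservesFiniteLimits L := by
  let T := commaSite f hf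
  let p : T.C ⥤ Y.C := Comma.fst (𝟭 Y.C) f.functor
  let q : T.C ⥤ X.C := Comma.snd (𝟭 Y.C) f.functor
  have : p.IsDenseSubsite T.J Y.J := isDenseSubsite_commaSite f hf
  have := T.isEquivalence_of_isDenseSubsite Y.J p
  let E := p.sheafPushforwardContinuous (Type u) T.J Y.J
  let Q : (X.Cᵒᵖ ⥤ Type u) ⥤ (T.Cᵒᵖ ⥤ Type u) := (Functor.whiskeringLeft _ _ _).obj q.op
  let adj := (((commaSndAdjunction f.functor).op.whiskerLeft (Type u)).comp
    (sheafificationAdjunction T.J (Type u))).comp E.asEquivalence.symm.toAdjunction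
  let L := sheafToPresheaf X.J (Type u) ⋙ (Q ⋙ presheafToSheaf T.J (Type u)) ⋙ E.inv
  let adj' : L ⊣ directImage f hf := adj.restrictFullyFaithful
    (fullyFaithfulSheafToPresheaf X.J (Type u)) (Functor.FullyFaithful.id _)
    (Iso.refl _) (Iso.refl _)
  have h₁ : PreservesFiniteLimits (sheafToPresheaf X.J (Type u)) := ⟨fun _ _ _ => inferInstance⟩
  have h₂ : PreservesFiniteLimits Q :=
    ⟨fun _ _ _ => inferInstanceAs (PreservesLimitsOfShape _ ((Functor.whiskeringLeft _ _ _).obj _))⟩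
  have h₃ : PreservesFiniteLimits E.inv := inferInstance
  have := comp_preservesFiniteLimits Q (presheafToSheaf T.J (Type u))
  have := comp_preservesFiniteLimits (Q ⋙ presheafToSheaf T.J (Type u)) E.inv
  exact ⟨L, ⟨adj'⟩, comp_preservesFiniteLimits _ _⟩

end SmallGenSite

/-! ### Restriction followed by sheafification -/

section Pasting

variable {C : Type u₁} [Category.{v₁} C] {D : Type u₂} [Category.{v₂} D]

theorem map_comp_eq (F : C ⥤ D) {X Y Y' Z : C} {a : X ⟶ Y} {b : Y ⟶ Z} {a' : X ⟶ Y'} {b' : Y' ⟶ Z}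
    (h : a ≫ b = a' ≫ b') : F.map a ≫ F.map b = F.map a' ≫ F.map b' := by
  rw [← F.map_comp, h, F.map_comp]

theorem map_comp_eq_id (F : C ⥤ D) {X Y : C} {a : X ⟶ Y} {b : Y ⟶ X} (h : a ≫ b = 𝟙 X) :
    F.map a ≫ F.map b = 𝟙 (F.obj X) := by
  rw [← F.map_comp, h, F.map_id]

/-- Adjacent commutative squares may be pasted. -/
theorem paste {X₀ X₁ X₂ Y₀ Y₁ Y₂ : C} {a₁ : X₀ ⟶ X₁} {a₂ : X₁ ⟶ X₂} {b₁ : Y₀ ⟶ Y₁} {b₂ : Y₁ ⟶ Y₂}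
    {c₀ : X₀ ⟶ Y₀} {c₁ : X₁ ⟶ Y₁} {c₂ : X₂ ⟶ Y₂} (h₁ : c₀ ≫ b₁ = a₁ ≫ c₁)
    (h₂ : c₁ ≫ b₂ = a₂ ≫ c₂) : c₀ ≫ b₁ ≫ b₂ = (a₁ ≫ a₂) ≫ c₂ := by
  rw [reassoc_of% h₁, h₂, Category.assoc]

theorem unit_comp_map_counit {a : C ⥤ D} {i : D ⥤ C} (adj : a ⊣ i) {P Q : C} {T : D} (s : P ⟶ Q)
    (t : Q ⟶ i.obj T) :
    adj.unit.app P ≫ i.map (a.map s ≫ a.map t ≫ adj.counit.app T) = s ≫ t := by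
  simp

theorem hom_ext_of_unit {a : C ⥤ D} {i : D ⥤ C} (adj : a ⊣ i) {P : C} {T : D}
    {x y : a.obj P ⟶ T} (h : adj.unit.app P ≫ i.map x = adj.unit.app P ≫ i.map y) : x = y :=
  (adj.homEquiv _ _).injective (by rwa [adj.homEquiv_unit, adj.homEquiv_unit])

end Pasting

namespace SmallGenSite
variable {X Y Z W : SmallGenSite.{u, w}}

/-- The unit of sheafification on the restriction of a sheaf along a functor. -/
noncomputable def toRestSheaf (F : X ⟶ Y) (S : Sheaf Y.J (Type u)) :
    (rest F).obj S.obj ⟶ ((restSheaf F).obj S).obj :=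
  (sheafificationAdjunction X.J (Type u)).unit.app ((rest F).obj S.obj)

theorem restSheaf_hom_ext {F : X ⟶ Y} {S : Sheaf Y.J (Type u)} {T : Sheaf X.J (Type u)}
    {α β : (restSheaf F).obj S ⟶ T}
    (h : toRestSheaf F S ≫ α.hom = toRestSheaf F S ≫ β.hom) : α = β :=
  hom_ext_of_unit (sheafificationAdjunction X.J (Type u)) h

theorem toRestSheaf_map (F : X ⟶ Y) {S T : Sheaf Y.J (Type u)} (g : S ⟶ T) :
    toRestSheaf F S ≫ ((restSheaf F).map g).hom = (rest F).map g.hom ≫ toRestSheaf F T :=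
  ((sheafificationAdjunction X.J (Type u)).unit.naturality ((rest F).map g.hom)).symm

theorem toRestSheaf_restSheafId (S : Sheaf X.J (Type u)) :
    toRestSheaf (𝟙 X) S ≫ ((restSheafId X).app S).hom = 𝟙 S.obj :=
  (sheafificationAdjunction X.J (Type u)).right_triangle_components S

theorem toRestSheaf_restSheafComp (F : X ⟶ Y) (G : Y ⟶ Z) (S : Sheaf Z.J (Type u)) :
    toRestSheaf (F ≫ G) S ≫ ((restSheafComp F G).app S).hom =
      (rest F).map (toRestSheaf G S) ≫ toRestSheaf F ((restSheaf G).obj S) :=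
  ((sheafificationAdjunction X.J (Type u)).unit.naturality ((rest F).map (toRestSheaf G S))).symm

theorem toRestSheaf_crossCell {A B C D : SmallGenSite.{u, w}} {f : A ⟶ B} (hf : IsMorphism f)
    {G : A ⟶ C} {K : B ⟶ D} {h : C ⟶ D} (hh : IsMorphism h) (φ : f ≫ K ⟶ G ≫ h)
    (S : Sheaf D.J (Type u)) :
    toRestSheaf G ((directImage h hh).obj S) ≫ ((crossCell hf hh φ).app S).hom =
      (restCell φ).app S.obj ≫ (rest f).map (toRestSheaf K S) :=
  unit_comp_map_counit (sheafificationAdjunction A.J (Type u))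
    (T := (directImage f hf).obj ((restSheaf K).obj S)) ((restCell φ).app S.obj)
    ((rest f).map (toRestSheaf K S))

theorem restSheafComp_assoc (F : X ⟶ Y) (G : Y ⟶ Z) (K : Z ⟶ W) (S : Sheaf W.J (Type u)) :
    (restSheafComp (F ≫ G) K).app S ≫ (restSheafComp F G).app ((restSheaf K).obj S) =
      (restSheafComp F (G ≫ K)).app S ≫ (restSheaf F).map ((restSheafComp G K).app S) := by
  refine restSheaf_hom_ext (F := F ≫ G ≫ K) ((paste (toRestSheaf_restSheafComp (F ≫ G) K S)
    (toRestSheaf_restSheafComp F G ((restSheaf K).obj S))).trans ?_)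
  have h := map_comp_eq (rest F) (toRestSheaf_restSheafComp G K S)
  exact (congrArg (· ≫ toRestSheaf F _) h.symm).trans
    (paste (toRestSheaf_restSheafComp F (G ≫ K) S) (toRestSheaf_map F _)).symm

theorem restSheafComp_id_left (F : X ⟶ Y) (S : Sheaf Y.J (Type u)) :
    (restSheafComp (𝟙 X) F).app S ≫ (restSheafId X).app ((restSheaf F).obj S) =
      𝟙 ((restSheaf F).obj S) :=
  restSheaf_hom_ext (F := F) ((paste (toRestSheaf_restSheafComp (𝟙 X) F S)
    ((toRestSheaf_restSheafId ((restSheaf F).obj S)).trans (Category.id_comp (𝟙 _)).symm)).trans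
    (Category.comp_id (toRestSheaf F S ≫ 𝟙 _)))

theorem restSheafComp_id_right (F : X ⟶ Y) (S : Sheaf Y.J (Type u)) :
    (restSheafComp F (𝟙 Y)).app S ≫ (restSheaf F).map ((restSheafId Y).app S) =
      𝟙 ((restSheaf F).obj S) := by
  refine restSheaf_hom_ext (F := F) ((paste (toRestSheaf_restSheafComp F (𝟙 Y) S)
    (toRestSheaf_map F ((restSheafId Y).app S))).trans ?_)
  exact (congrArg (· ≫ toRestSheaf F S) (map_comp_eq_id (rest F)
    (toRestSheaf_restSheafId S))).trans ((Category.id_comp _).trans (Category.comp_id _).symm)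

instance isIso_restSheafId (X : SmallGenSite.{u, w}) : IsIso (restSheafId X) :=
  inferInstanceAs (IsIso (sheafificationAdjunction X.J (Type u)).counit)

theorem IsComorphism.isIso_restSheafComp {F : X ⟶ Y} (hF : IsComorphism F) (G : Y ⟶ Z) :
    IsIso (restSheafComp F G) := by
  have : ∀ S, IsIso ((restSheafComp F G).app S) := fun S =>
    hF.isIso_map _ (Y.J.W_toSheafify ((rest G).obj S.obj))
  exact NatIso.isIso_of_isIso_app _

end SmallGenSite

/-! ### Cells between restriction functors -/

namespace SmallGenSite
variable {X Y Z : SmallGenSite.{u, w}}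

/-- The transformation of restriction functors of presheaves induced by a natural transformation. -/
def restMap {f g : X ⟶ Y} (η : f ⟶ g) : rest g ⟶ rest f :=
  (Functor.whiskeringLeft _ _ (Type u)).map (NatTrans.op (Hom₂.hom η))

/-- The transformation of restriction functors of sheaves along morphisms of sites induced by a
natural transformation. -/
noncomputable def directImageMap {f g : X ⟶ Y} (hf : IsMorphism f) (hg : IsMorphism g)
    (η : f ⟶ g) : directImage g hg ⟶ directImage f hf where
  app S := ⟨(restMap η).app S.obj⟩
  naturality _ _ α := Sheaf.hom_ext ((restMap η).naturality α.hom)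

/-- The transformation between restrictions followed by sheafification induced by a natural
transformation. -/
noncomputable def restSheafMap {F G : X ⟶ Y} (η : F ⟶ G) : restSheaf G ⟶ restSheaf F :=
  Functor.whiskerLeft (sheafToPresheaf Y.J (Type u))
    (Functor.whiskerRight (restMap η) (presheafToSheaf X.J (Type u)))

theorem toRestSheaf_restSheafMap {F G : X ⟶ Y} (η : F ⟶ G) (S : Sheaf Y.J (Type u)) :
    toRestSheaf G S ≫ ((restSheafMap η).app S).hom = (restMap η).app S.obj ≫ toRestSheaf F S :=
  ((sheafificationAdjunction X.J (Type u)).unit.naturality ((restMap η).app S.obj)).symm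

theorem restMap_app_eq {f g : X ⟶ Y} (η : f ⟶ g) (P : Y.Cᵒᵖ ⥤ Type u)
    {α : (rest g).obj P ⟶ (rest f).obj P}
    (h : ∀ c : X.C, P.map (η.hom.app c).op = α.app (op c)) : (restMap η).app P = α :=
  NatTrans.ext (funext fun c => h c.unop)

theorem restMap_id (f : X ⟶ Y) (P : Y.Cᵒᵖ ⥤ Type u) : (restMap (𝟙 f)).app P = 𝟙 _ :=
  restMap_app_eq _ _ fun _ => P.map_id _

theorem restMap_comp {f g h : X ⟶ Y} (η : f ⟶ g) (θ : g ⟶ h) (P : Y.Cᵒᵖ ⥤ Type u) :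
    (restMap (η ≫ θ)).app P = (restMap θ).app P ≫ (restMap η).app P :=
  restMap_app_eq _ _ fun _ => P.map_comp _ _

section Cells
variable {A B A' B' A'' B'' : SmallGenSite.{u, w}}

theorem restCell_sqV {f : siteLax.H A B} {F : siteLax.V A A'} {G : siteLax.V B B'}
    {f' : siteLax.H A' B'} {F' : siteLax.V A' A''} {G' : siteLax.V B' B''} {f'' : siteLax.H A'' B''}
    (α : siteLax.Sq f F G f') (β : siteLax.Sq f' F' G' f'') (P : B''.Cᵒᵖ ⥤ Type u) :
    (restCell (G := F.1 ≫ F'.1) (K := G.1 ≫ G'.1) (siteLax.sqV α β)).app P =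
      (rest F.1).map ((restCell β).app P) ≫ (restCell α).app ((rest G'.1).obj P) := by
  refine restMap_app_eq _ _ fun c => ?_
  refine Eq.trans (congrArg (fun x => P.map (Quiver.Hom.op x)) (?_ : _ =
    G'.1.functor.map ((Hom₂.hom α).app c) ≫ (Hom₂.hom β).app (F.1.functor.obj c))) (P.map_comp _ _)
  exact (Category.id_comp _).trans (congrArg (G'.1.functor.map ((Hom₂.hom α).app c) ≫ ·)
    ((Category.id_comp _).trans (Category.comp_id _)))

theorem restCell_sqH {f : siteLax.H A A'} {f' : siteLax.H A' A''} {F : siteLax.V A B}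
    {F' : siteLax.V A' B'} {F'' : siteLax.V A'' B''} {g : siteLax.H B B'} {g' : siteLax.H B' B''}
    (α : siteLax.Sq f F F' g) (β : siteLax.Sq f' F' F'' g') (P : B''.Cᵒᵖ ⥤ Type u) :
    (restCell (f := f.1 ≫ f'.1) (h := g.1 ≫ g'.1) (siteLax.sqH α β)).app P =
      (restCell α).app ((rest g'.1).obj P) ≫ (rest f.1).map ((restCell β).app P) := by
  refine restMap_app_eq _ _ fun c => ?_
  refine Eq.trans (congrArg (fun x => P.map (Quiver.Hom.op x)) (?_ : _ =
    (Hom₂.hom β).app (f.1.functor.obj c) ≫ g'.1.functor.map ((Hom₂.hom α).app c))) (P.map_comp _ _)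
  exact (Category.id_comp _).trans (congrArg ((Hom₂.hom β).app (f.1.functor.obj c) ≫ ·)
    ((Category.id_comp _).trans (Category.comp_id _)))

theorem restCell_hCell {f g : X ⟶ Y} (η : f ⟶ g) (P : Y.Cᵒᵖ ⥤ Type u) :
    (restCell (hCell η)).app P = (restMap η).app P :=
  restMap_app_eq _ _ fun c => congrArg (fun x => P.map (Quiver.Hom.op x))
    ((Category.id_comp _).trans (Category.comp_id ((Hom₂.hom η).app c)))

theorem restCell_vCell {F G : X ⟶ Y} (η : F ⟶ G) (P : Y.Cᵒᵖ ⥤ Type u) :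
    (restCell (vCell η)).app P = (restMap η).app P :=
  restMap_app_eq _ _ fun c => congrArg (fun x => P.map (Quiver.Hom.op x))
    ((Category.id_comp _).trans (Category.comp_id ((Hom₂.hom η).app c)))

/-- Vertical pasting of lax squares is compatible with the comparisons for composites of
comorphisms of sites. -/
theorem crossCell_sqV {f : siteLax.H A B} {F : siteLax.V A A'} {G : siteLax.V B B'}
    {f' : siteLax.H A' B'} {F' : siteLax.V A' A''} {G' : siteLax.V B' B''} {f'' : siteLax.H A'' B''}
    (α : siteLax.Sq f F G f') (β : siteLax.Sq f' F' G' f'') (S : Sheaf B''.J (Type u)) :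
    (crossCell (G := F.1 ≫ F'.1) (K := G.1 ≫ G'.1) f.2 f''.2 (siteLax.sqV α β)).app S ≫
        (directImage f.1 f.2).map ((restSheafComp G.1 G'.1).app S) =
      (restSheafComp F.1 F'.1).app ((directImage f''.1 f''.2).obj S) ≫
        (restSheaf F.1).map ((crossCell f'.2 f''.2 β).app S) ≫
          (crossCell f.2 f'.2 α).app ((restSheaf G'.1).obj S) := by
  refine restSheaf_hom_ext (F := F.1 ≫ F'.1) ?_
  have l := paste (toRestSheaf_crossCell (G := F.1 ≫ F'.1) (K := G.1 ≫ G'.1) f.2 f''.2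
      (siteLax.sqV α β) S)
    (map_comp_eq (rest f.1) (toRestSheaf_restSheafComp G.1 G'.1 S))
  have r := paste (toRestSheaf_restSheafComp F.1 F'.1 ((directImage f''.1 f''.2).obj S))
    (paste (toRestSheaf_map F.1 ((crossCell f'.2 f''.2 β).app S))
      (toRestSheaf_crossCell f.2 f'.2 α ((restSheaf G'.1).obj S)))
  have m := map_comp_eq (rest F.1) (toRestSheaf_crossCell f'.2 f''.2 β S)
  have n := (restCell α).naturality (toRestSheaf G'.1 S)
  exact l.trans ((congrArg (· ≫ (rest f.1).map (toRestSheaf G.1 ((restSheaf G'.1).obj S)))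
    ((congrArg (· ≫ (rest f.1).map ((rest G.1).map (toRestSheaf G'.1 S)))
      (restCell_sqV α β S.obj)).trans (paste m n).symm)).trans r.symm)

/-- Horizontal pasting of lax squares is compatible with restriction along composites of morphisms
of sites. -/
theorem crossCell_sqH {f : siteLax.H A A'} {f' : siteLax.H A' A''} {F : siteLax.V A B}
    {F' : siteLax.V A' B'} {F'' : siteLax.V A'' B''} {g : siteLax.H B B'} {g' : siteLax.H B' B''}
    (α : siteLax.Sq f F F' g) (β : siteLax.Sq f' F' F'' g') (S : Sheaf B''.J (Type u)) :
    (crossCell (f := f.1 ≫ f'.1) (h := g.1 ≫ g'.1) (siteLax.hComp f f').2 (siteLax.hComp g g').2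
        (siteLax.sqH α β)).app S =
      (crossCell f.2 g.2 α).app ((directImage g'.1 g'.2).obj S) ≫
        (directImage f.1 f.2).map ((crossCell f'.2 g'.2 β).app S) := by
  refine restSheaf_hom_ext (F := F.1) ?_
  have l := toRestSheaf_crossCell (f := f.1 ≫ f'.1) (h := g.1 ≫ g'.1) (siteLax.hComp f f').2
    (siteLax.hComp g g').2 (siteLax.sqH α β) S
  have r := paste (toRestSheaf_crossCell f.2 g.2 α ((directImage g'.1 g'.2).obj S))
    (map_comp_eq (rest f.1) (toRestSheaf_crossCell f'.2 g'.2 β S))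
  exact l.trans ((congrArg (· ≫ (rest f.1).map ((rest f'.1).map (toRestSheaf F''.1 S)))
    (restCell_sqH α β S.obj)).trans r.symm)

/-- On a horizontally globular cell, `crossCell` is restriction of sheaves along the natural
transformation, up to the counit of sheafification. -/
theorem crossCell_hCell {f g : X ⟶ Y} (hf : IsMorphism f) (hg : IsMorphism g) (η : f ⟶ g)
    (S : Sheaf Y.J (Type u)) :
    (crossCell hf hg (hCell η)).app S ≫ (directImage f hf).map ((restSheafId Y).app S) =
      (restSheafId X).app ((directImage g hg).obj S) ≫ (directImageMap hf hg η).app S := by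
  refine restSheaf_hom_ext (F := 𝟙 X) ?_
  have l := paste (toRestSheaf_crossCell hf hg (hCell η) S)
    ((map_comp_eq_id (rest f) (toRestSheaf_restSheafId S)).trans (Category.comp_id (𝟙 _)).symm)
  have r : toRestSheaf (𝟙 X) ((directImage g hg).obj S) ≫
      ((restSheafId X).app ((directImage g hg).obj S)).hom ≫ (restMap η).app S.obj =
        (restMap η).app S.obj :=
    (Category.assoc _ _ _).symm.trans ((congrArg (· ≫ (restMap η).app S.obj)
      (toRestSheaf_restSheafId ((directImage g hg).obj S))).trans (Category.id_comp _))
  exact l.trans ((Category.comp_id _).trans ((Category.comp_id _).trans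
    ((restCell_hCell η S.obj).trans r.symm)))

theorem crossCell_vCell {F G : X ⟶ Y} (η : F ⟶ G) (h : IsMorphism (𝟙 X)) (h' : IsMorphism (𝟙 Y))
    (S : Sheaf Y.J (Type u)) :
    (crossCell h h' (vCell η)).app S = (restSheafMap η).app S := by
  refine restSheaf_hom_ext (F := G) ?_
  exact (toRestSheaf_crossCell h h' (vCell η) S).trans ((congrArg (· ≫ toRestSheaf F S)
    (restCell_vCell η S.obj)).trans (toRestSheaf_restSheafMap η S).symm)

end Cells
end SmallGenSite

/-! ### Inverse images along morphisms of sites: coherence -/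

section Transposition

variable {C : Type u₁} [Category.{v₁} C] {D : Type u₂} [Category.{v₂} D] {E : Type u₃}
  [Category.{v₃} E] {E' : Type u₄} [Category.{v₄} E']

theorem unit_comp_map_map_comp {L : C ⥤ D} {R : D ⥤ C} (adj : L ⊣ R) {P Q : C} {T : D} (s : P ⟶ Q)
    (d : L.obj Q ⟶ T) :
    adj.unit.app P ≫ R.map (L.map s ≫ d) = s ≫ adj.unit.app Q ≫ R.map d := by
  simp

/-- Two maps out of a threefold inverse image agree if their transposes do. -/
theorem comp_eq_comp_of_unit {L₁ : C ⥤ D} {R₁ : D ⥤ C} {L₂ : D ⥤ E} {R₂ : E ⥤ D} {L₃ : E ⥤ E'}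
    {R₃ : E' ⥤ E} (adj₁ : L₁ ⊣ R₁) (adj₂ : L₂ ⊣ R₂) (adj₃ : L₃ ⊣ R₃) {S : C} {M : E} {N T : E'}
    {c : L₂.obj (L₁.obj S) ⟶ M} {m : S ⟶ R₁.obj (R₂.obj M)} {d : L₃.obj M ⟶ T}
    {t : S ⟶ R₁.obj (R₂.obj (R₃.obj T))} {c' : L₃.obj (L₂.obj (L₁.obj S)) ⟶ N}
    {n : L₁.obj S ⟶ R₂.obj (R₃.obj N)} {d' : N ⟶ T}
    (hc : adj₁.unit.app S ≫ R₁.map (adj₂.unit.app (L₁.obj S)) ≫ R₁.map (R₂.map c) = m)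
    (hd : m ≫ R₁.map (R₂.map (adj₃.unit.app M)) ≫ R₁.map (R₂.map (R₃.map d)) = t)
    (hc' : adj₂.unit.app (L₁.obj S) ≫ R₂.map (adj₃.unit.app _) ≫ R₂.map (R₃.map c') = n)
    (hd' : adj₁.unit.app S ≫ R₁.map n ≫ R₁.map (R₂.map (R₃.map d')) = t) :
    L₃.map c ≫ d = c' ≫ d' := by
  apply hom_ext_of_unit adj₃
  apply hom_ext_of_unit adj₂
  apply hom_ext_of_unit adj₁
  subst hc hc'
  refine Eq.trans ?_ (hd.trans (hd'.symm.trans ?_))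
  · rw [unit_comp_map_map_comp]
    simp only [Functor.map_comp, Category.assoc]
  · simp only [Functor.map_comp, Category.assoc]

theorem comp_eq_id_of_unit {L : C ⥤ D} {R : D ⥤ C} (adj : L ⊣ R) {S : C} {T : D}
    {c : L.obj S ⟶ T} {d : T ⟶ L.obj S}
    (h : adj.unit.app S ≫ R.map c ≫ R.map d = adj.unit.app S) : c ≫ d = 𝟙 _ := by
  apply hom_ext_of_unit adj
  simpa using h

theorem map_comp_eq_id_of_unit {L : C ⥤ D} {R : D ⥤ C} (adj : L ⊣ R) {S S' : C}
    {c : S ⟶ S'} {d : L.obj S' ⟶ L.obj S}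
    (h : c ≫ adj.unit.app S' ≫ R.map d = adj.unit.app S) : L.map c ≫ d = 𝟙 _ := by
  apply hom_ext_of_unit adj
  simpa using h

theorem comp_eq_map_comp_of_unit {L : C ⥤ D} {R : D ⥤ C} (adj : L ⊣ R) {P Q : C} {M N N₁ : D}
    {v : P ⟶ Q} {s : L.obj P ⟶ M} {w : M ⟶ N} {s₁ : L.obj Q ⟶ N₁} {s₂ : N₁ ⟶ N}
    {x : P ⟶ R.obj M} {x₁ : Q ⟶ R.obj N₁} (hs : adj.unit.app P ≫ R.map s = x)
    (hs₁ : adj.unit.app Q ≫ R.map s₁ = x₁) (h : x ≫ R.map w = v ≫ x₁ ≫ R.map s₂) :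
    s ≫ w = L.map v ≫ s₁ ≫ s₂ := by
  apply hom_ext_of_unit adj
  subst hs hs₁
  simpa using h

/-- Two maps out of a twofold inverse image agree if their transposes do. -/
theorem comp_eq_map_comp_comp_of_unit {L₁ : C ⥤ D} {R₁ : D ⥤ C} {L₂ : D ⥤ E} {R₂ : E ⥤ D}
    (adj₁ : L₁ ⊣ R₁) (adj₂ : L₂ ⊣ R₂) {P : C} {Q : D} {M N T : E}
    {c : L₂.obj (L₁.obj P) ⟶ M} {m : P ⟶ R₁.obj (R₂.obj M)} {s : M ⟶ T}
    {s₁ : L₁.obj P ⟶ Q} {s₂ : L₂.obj Q ⟶ N} {k : N ⟶ T} {x₁ : P ⟶ R₁.obj Q} {x₂ : Q ⟶ R₂.obj N}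
    (hc : adj₁.unit.app P ≫ R₁.map (adj₂.unit.app (L₁.obj P)) ≫ R₁.map (R₂.map c) = m)
    (hs₁ : adj₁.unit.app P ≫ R₁.map s₁ = x₁) (hs₂ : adj₂.unit.app Q ≫ R₂.map s₂ = x₂)
    (h : m ≫ R₁.map (R₂.map s) = x₁ ≫ R₁.map x₂ ≫ R₁.map (R₂.map k)) :
    c ≫ s = L₂.map s₁ ≫ s₂ ≫ k := by
  apply hom_ext_of_unit adj₂
  apply hom_ext_of_unit adj₁
  subst hc hs₁ hs₂
  refine Eq.trans ?_ (h.trans ?_)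
  · simp only [Functor.map_comp, Category.assoc]
  · rw [unit_comp_map_map_comp]
    simp only [Functor.map_comp, Category.assoc]

/-- Pasting of four squares. -/
theorem paste_four {X₀ X₁ X₂ X₃ Y₀ Y₁ Y₂ Y₃ Z : C} {t : X₀ ⟶ X₁} {c : X₁ ⟶ Y₃} {k : Y₃ ⟶ Z}
    {p : X₁ ⟶ X₂} {q : X₂ ⟶ X₃} {r : X₃ ⟶ Z} {v : X₀ ⟶ Y₀} {t' : Y₀ ⟶ X₂} {y : Y₀ ⟶ Y₁}
    {z : Y₁ ⟶ X₃} {r' : Y₁ ⟶ Y₂} {k' : Y₂ ⟶ Z} (h₁ : c ≫ k = p ≫ q ≫ r) (h₂ : t ≫ p = v ≫ t')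
    (h₃ : t' ≫ q = y ≫ z) (h₄ : z ≫ r = r' ≫ k') : (t ≫ c) ≫ k = v ≫ (y ≫ r') ≫ k' := by
  rw [Category.assoc, h₁, reassoc_of% h₂, reassoc_of% h₃, h₄, Category.assoc]

/-- Pasting of two squares. -/
theorem paste_two {X₀ X₁ X₂ Y₀ Y₁ Z : C} {t : X₀ ⟶ X₁} {c : X₁ ⟶ Y₁} {k : Y₁ ⟶ Z} {p : X₁ ⟶ X₂}
    {q : X₂ ⟶ Z} {v : X₀ ⟶ Y₀} {t' : Y₀ ⟶ X₂} {i : Z ⟶ Z} (h₁ : c ≫ k = p ≫ q)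
    (h₂ : t ≫ p = v ≫ t') (hi : i = 𝟙 Z) : (t ≫ c) ≫ k = v ≫ (t' ≫ q) ≫ i := by
  rw [Category.assoc, h₁, reassoc_of% h₂, hi, Category.comp_id]

/-- Pasting of images of squares under two functors. -/
theorem paste_map {Φ : E ⥤ C} {R : D ⥤ C} {Q₀ Q₁ Q₂ Q₃ : E} {M₀ M₁ M₂ : D} {T : C}
    {x : Φ.obj Q₀ ⟶ T} {η : Q₀ ⟶ Q₃} {a : Q₀ ⟶ Q₁} {b : Q₁ ⟶ Q₂} {c : Q₂ ⟶ Q₃}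
    {γ : Φ.obj Q₃ ⟶ T} {γ' : Φ.obj Q₂ ⟶ R.obj M₂} {k : R.obj M₂ ⟶ T} {α : Φ.obj Q₁ ⟶ R.obj M₀}
    {α' : Φ.obj Q₂ ⟶ R.obj M₁} {d : M₀ ⟶ M₁} {β : M₁ ⟶ M₂} (h₁ : x = Φ.map η ≫ γ)
    (h₂ : a ≫ b ≫ c = η) (h₃ : Φ.map c ≫ γ = γ' ≫ k) (h₄ : γ' = α' ≫ R.map β)
    (h₅ : Φ.map b ≫ α' = α ≫ R.map d) : x = (Φ.map a ≫ α) ≫ R.map (d ≫ β) ≫ k := by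
  subst h₂
  rw [h₁, Functor.map_comp, Functor.map_comp, Category.assoc, Category.assoc, h₃, h₄,
    Category.assoc, reassoc_of% h₅, Functor.map_comp, Category.assoc, Category.assoc]

end Transposition

namespace SmallGenSite
variable {X Y Z W : SmallGenSite.{u, w}}

/-- A left adjoint of the direct image along a morphism of sites. -/
noncomputable def inverseImage (f : X ⟶ Y) (hf : IsMorphism f) :
    Sheaf X.J (Type u) ⥤ Sheaf Y.J (Type u) :=
  (exists_inverseImage f hf).choose

/-- The adjunction of inverse and direct image along a morphism of sites. -/
noncomputable def inverseImageAdjunction (f : X ⟶ Y) (hf : IsMorphism f) :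
    inverseImage f hf ⊣ directImage f hf :=
  (exists_inverseImage f hf).choose_spec.1.some

theorem preservesFiniteLimits_inverseImage (f : X ⟶ Y) (hf : IsMorphism f) :
    PreservesFiniteLimits (inverseImage f hf) :=
  (exists_inverseImage f hf).choose_spec.2

/-- The unit of the adjunction of inverse and direct image. -/
noncomputable abbrev inverseImageUnit (f : X ⟶ Y) (hf : IsMorphism f) (S : Sheaf X.J (Type u)) :
    S ⟶ (directImage f hf).obj ((inverseImage f hf).obj S) :=
  (inverseImageAdjunction f hf).unit.app S

/-- The conjugate of the identification of restriction along an identity. -/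
noncomputable def inverseImageId (X : SmallGenSite.{u, w}) (h : IsMorphism (𝟙 X)) :
    𝟭 (Sheaf X.J (Type u)) ≅ inverseImage (𝟙 X) h :=
  (conjugateIsoEquiv (inverseImageAdjunction (𝟙 X) h) Adjunction.id).symm (directImageId X h)

/-- The conjugate of the identification of restriction along a composite. -/
noncomputable def inverseImageComp (f : X ⟶ Y) (hf : IsMorphism f) (g : Y ⟶ Z) (hg : IsMorphism g)
    (hfg : IsMorphism (f ≫ g)) :
    inverseImage f hf ⋙ inverseImage g hg ≅ inverseImage (f ≫ g) hfg :=
  (conjugateIsoEquiv (inverseImageAdjunction (f ≫ g) hfg)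
    ((inverseImageAdjunction f hf).comp (inverseImageAdjunction g hg))).symm
      (directImageComp f hf g hg hfg)

/-- The conjugate of the transformation of direct images induced by a natural transformation. -/
noncomputable def inverseImageMap {f g : X ⟶ Y} (hf : IsMorphism f) (hg : IsMorphism g)
    (η : f ⟶ g) : inverseImage f hf ⟶ inverseImage g hg :=
  (conjugateEquiv (inverseImageAdjunction g hg) (inverseImageAdjunction f hf)).symm
    (directImageMap hf hg η)

/-- The mate of `crossCell φ` under the adjunctions of inverse and direct images. -/
noncomputable def inverseImageCell {A B C D : SmallGenSite.{u, w}} {f : A ⟶ B} (hf : IsMorphism f)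
    {G : A ⟶ C} {K : B ⟶ D} {h : C ⟶ D} (hh : IsMorphism h) (φ : f ≫ K ⟶ G ≫ h) :
    restSheaf G ⋙ inverseImage f hf ⟶ inverseImage h hh ⋙ restSheaf K :=
  ((mateEquiv (inverseImageAdjunction h hh) (inverseImageAdjunction f hf)).symm
    (TwoSquare.mk _ _ _ _ (crossCell hf hh φ))).natTrans

theorem inverseImageId_app (h : IsMorphism (𝟙 X)) (S : Sheaf X.J (Type u)) :
    (inverseImageId X h).hom.app S = inverseImageUnit (𝟙 X) h S :=
  (conjugateEquiv_adjunction_id_symm (inverseImageAdjunction (𝟙 X) h)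
    (directImageId X h).hom S).trans (Category.comp_id _)

theorem inverseImageUnit_inverseImageComp (f : X ⟶ Y) (hf : IsMorphism f) (g : Y ⟶ Z)
    (hg : IsMorphism g) (hfg : IsMorphism (f ≫ g)) (S : Sheaf X.J (Type u)) :
    inverseImageUnit f hf S ≫ (directImage f hf).map (inverseImageUnit g hg _) ≫
      (directImage f hf).map ((directImage g hg).map ((inverseImageComp f hf g hg hfg).hom.app S)) =
    inverseImageUnit (f ≫ g) hfg S := by
  have h := unit_conjugateEquiv_symm (inverseImageAdjunction (f ≫ g) hfg)
    ((inverseImageAdjunction f hf).comp (inverseImageAdjunction g hg))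
    (directImageComp f hf g hg hfg).hom S
  rw [Adjunction.comp_unit_app] at h
  exact (Category.assoc _ _ _).symm.trans (h.symm.trans (Category.comp_id _))

theorem inverseImageUnit_inverseImageMap {f g : X ⟶ Y} (hf : IsMorphism f) (hg : IsMorphism g)
    (η : f ⟶ g) (S : Sheaf X.J (Type u)) :
    inverseImageUnit f hf S ≫ (directImage f hf).map ((inverseImageMap hf hg η).app S) =
      inverseImageUnit g hg S ≫ (directImageMap hf hg η).app ((inverseImage g hg).obj S) :=
  (unit_conjugateEquiv_symm (inverseImageAdjunction g hg) (inverseImageAdjunction f hf)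
    (directImageMap hf hg η) S).symm

theorem inverseImageUnit_inverseImageCell {A B C D : SmallGenSite.{u, w}} {f : A ⟶ B}
    (hf : IsMorphism f) {G : A ⟶ C} {K : B ⟶ D} {h : C ⟶ D} (hh : IsMorphism h)
    (φ : f ≫ K ⟶ G ≫ h) (S : Sheaf C.J (Type u)) :
    inverseImageUnit f hf ((restSheaf G).obj S) ≫
        (directImage f hf).map ((inverseImageCell hf hh φ).app S) =
      (restSheaf G).map (inverseImageUnit h hh S) ≫
        (crossCell hf hh φ).app ((inverseImage h hh).obj S) :=
  (unit_mateEquiv_symm (inverseImageAdjunction h hh) (inverseImageAdjunction f hf)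
    (TwoSquare.mk _ _ _ _ (crossCell hf hh φ)) S).symm

theorem inverseImageComp_assoc (f : X ⟶ Y) (hf : IsMorphism f) (g : Y ⟶ Z) (hg : IsMorphism g)
    (k : Z ⟶ W) (hk : IsMorphism k) (hfg : IsMorphism (f ≫ g)) (hgk : IsMorphism (g ≫ k))
    (hfgk : IsMorphism (f ≫ g ≫ k)) (S : Sheaf X.J (Type u)) :
    (inverseImage k hk).map ((inverseImageComp f hf g hg hfg).hom.app S) ≫
        (inverseImageComp (f ≫ g) hfg k hk hfgk).hom.app S =
      (inverseImageComp g hg k hk hgk).hom.app ((inverseImage f hf).obj S) ≫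
        (inverseImageComp f hf (g ≫ k) hgk hfgk).hom.app S :=
  comp_eq_comp_of_unit (inverseImageAdjunction f hf) (inverseImageAdjunction g hg)
    (inverseImageAdjunction k hk) (inverseImageUnit_inverseImageComp f hf g hg hfg S)
    (inverseImageUnit_inverseImageComp (f ≫ g) hfg k hk hfgk S)
    (inverseImageUnit_inverseImageComp g hg k hk hgk _)
    (inverseImageUnit_inverseImageComp f hf (g ≫ k) hgk hfgk S)

theorem inverseImageId_comp (f : X ⟶ Y) (hf : IsMorphism f) (hY : IsMorphism (𝟙 Y))
    (S : Sheaf X.J (Type u)) :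
    (inverseImageId Y hY).hom.app ((inverseImage f hf).obj S) ≫
      (inverseImageComp f hf (𝟙 Y) hY hf).hom.app S = 𝟙 _ := by
  rw [inverseImageId_app]
  exact comp_eq_id_of_unit (inverseImageAdjunction f hf)
    (inverseImageUnit_inverseImageComp f hf (𝟙 Y) hY hf S)

theorem inverseImageComp_id (f : X ⟶ Y) (hf : IsMorphism f) (hX : IsMorphism (𝟙 X))
    (S : Sheaf X.J (Type u)) :
    (inverseImage f hf).map ((inverseImageId X hX).hom.app S) ≫
      (inverseImageComp (𝟙 X) hX f hf hf).hom.app S = 𝟙 _ := by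
  rw [inverseImageId_app]
  exact map_comp_eq_id_of_unit (inverseImageAdjunction f hf)
    (inverseImageUnit_inverseImageComp (𝟙 X) hX f hf hf S)

section Cells
variable {A B A' B' A'' B'' : SmallGenSite.{u, w}}

/-- The transpose of `crossCell_sqV`. -/
theorem inverseImageCell_sqV {f : siteLax.H A B} {F : siteLax.V A A'} {G : siteLax.V B B'}
    {f' : siteLax.H A' B'} {F' : siteLax.V A' A''} {G' : siteLax.V B' B''} {f'' : siteLax.H A'' B''}
    (α : siteLax.Sq f F G f') (β : siteLax.Sq f' F' G' f'') (S : Sheaf A''.J (Type u)) :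
    (inverseImageCell (G := F.1 ≫ F'.1) (K := G.1 ≫ G'.1) f.2 f''.2 (siteLax.sqV α β)).app S ≫
        (restSheafComp G.1 G'.1).app ((inverseImage f''.1 f''.2).obj S) =
      (inverseImage f.1 f.2).map ((restSheafComp F.1 F'.1).app S) ≫
        (inverseImageCell f.2 f'.2 α).app ((restSheaf F'.1).obj S) ≫
          (restSheaf G.1).map ((inverseImageCell f'.2 f''.2 β).app S) :=
  comp_eq_map_comp_of_unit (inverseImageAdjunction f.1 f.2)
    (inverseImageUnit_inverseImageCell (G := F.1 ≫ F'.1) (K := G.1 ≫ G'.1) f.2 f''.2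
      (siteLax.sqV α β) S)
    (inverseImageUnit_inverseImageCell f.2 f'.2 α ((restSheaf F'.1).obj S))
    (paste_four (crossCell_sqV α β ((inverseImage f''.1 f''.2).obj S))
      ((restSheafComp F.1 F'.1).naturality (inverseImageUnit f''.1 f''.2 S))
      (map_comp_eq (restSheaf F.1) (inverseImageUnit_inverseImageCell f'.2 f''.2 β S).symm)
      ((crossCell f.2 f'.2 α).naturality ((inverseImageCell f'.2 f''.2 β).app S)))

/-- The transpose of `crossCell_sqH`. Two transpositions are needed, as the comparisons for
composites of inverse images are conjugates of identities. -/
theorem inverseImageCell_sqH {f : siteLax.H A A'} {f' : siteLax.H A' A''} {F : siteLax.V A B}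
    {F' : siteLax.V A' B'} {F'' : siteLax.V A'' B''} {g : siteLax.H B B'} {g' : siteLax.H B' B''}
    (α : siteLax.Sq f F F' g) (β : siteLax.Sq f' F' F'' g') (S : Sheaf B.J (Type u)) :
    (inverseImageComp f.1 f.2 f'.1 f'.2 (siteLax.hComp f f').2).hom.app ((restSheaf F.1).obj S) ≫
        (inverseImageCell (f := f.1 ≫ f'.1) (h := g.1 ≫ g'.1) (siteLax.hComp f f').2
          (siteLax.hComp g g').2 (siteLax.sqH α β)).app S =
      (inverseImage f'.1 f'.2).map ((inverseImageCell f.2 g.2 α).app S) ≫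
        (inverseImageCell f'.2 g'.2 β).app ((inverseImage g.1 g.2).obj S) ≫
          (restSheaf F''.1).map
            ((inverseImageComp g.1 g.2 g'.1 g'.2 (siteLax.hComp g g').2).hom.app S) := by
  refine comp_eq_map_comp_comp_of_unit (inverseImageAdjunction f.1 f.2)
    (inverseImageAdjunction f'.1 f'.2)
    (inverseImageUnit_inverseImageComp f.1 f.2 f'.1 f'.2 (siteLax.hComp f f').2 _)
    (inverseImageUnit_inverseImageCell f.2 g.2 α S)
    (inverseImageUnit_inverseImageCell f'.2 g'.2 β ((inverseImage g.1 g.2).obj S)) ?_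
  have e₁ := inverseImageUnit_inverseImageCell (f := f.1 ≫ f'.1) (h := g.1 ≫ g'.1)
    (siteLax.hComp f f').2 (siteLax.hComp g g').2 (siteLax.sqH α β) S
  have e₂ := inverseImageUnit_inverseImageComp g.1 g.2 g'.1 g'.2 (siteLax.hComp g g').2 S
  let c := (directImage g.1 g.2).map ((directImage g'.1 g'.2).map
    ((inverseImageComp g.1 g.2 g'.1 g'.2 (siteLax.hComp g g').2).hom.app S))
  let k := (directImage f.1 f.2).map ((directImage f'.1 f'.2).map ((restSheaf F''.1).map
    ((inverseImageComp g.1 g.2 g'.1 g'.2 (siteLax.hComp g g').2).hom.app S)))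
  have e₃ : (restSheaf F.1).map c ≫ _ = _ ≫ k :=
    (crossCell (f := f.1 ≫ f'.1) (h := g.1 ≫ g'.1) (siteLax.hComp f f').2
      (siteLax.hComp g g').2 (siteLax.sqH α β)).naturality
        ((inverseImageComp g.1 g.2 g'.1 g'.2 (siteLax.hComp g g').2).hom.app S)
  have e₄ := crossCell_sqH α β ((inverseImage g'.1 g'.2).obj ((inverseImage g.1 g.2).obj S))
  have e₅ : (restSheaf F.1).map ((directImage g.1 g.2).map
        (inverseImageUnit g'.1 g'.2 ((inverseImage g.1 g.2).obj S))) ≫ _ =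
      _ ≫ (directImage f.1 f.2).map ((restSheaf F'.1).map _) :=
    (crossCell f.2 g.2 α).naturality (inverseImageUnit g'.1 g'.2 ((inverseImage g.1 g.2).obj S))
  exact paste_map (Φ := restSheaf F.1) (R := directImage f.1 f.2) (c := c) (k := k) e₁ e₂ e₃ e₄ e₅

theorem inverseImageCell_vCell {F G : X ⟶ Y} (η : F ⟶ G) (h : IsMorphism (𝟙 X))
    (h' : IsMorphism (𝟙 Y)) (S : Sheaf Y.J (Type u)) :
    (inverseImageId X h).hom.app ((restSheaf G).obj S) ≫ (inverseImageCell h h' (vCell η)).app S =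
      (restSheafMap η).app S ≫ (restSheaf F).map ((inverseImageId Y h').hom.app S) := by
  rw [inverseImageId_app, inverseImageId_app]
  exact (inverseImageUnit_inverseImageCell h h' (vCell η) S).trans
    ((congrArg ((restSheaf G).map (inverseImageUnit (𝟙 Y) h' S) ≫ ·)
      (crossCell_vCell η h h' ((inverseImage (𝟙 Y) h').obj S))).trans
    ((restSheafMap η).naturality (inverseImageUnit (𝟙 Y) h' S)))

theorem inverseImageCell_hCell {f g : X ⟶ Y} (hf : IsMorphism f) (hg : IsMorphism g) (η : f ⟶ g)
    (S : Sheaf X.J (Type u)) :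
    (inverseImageCell hf hg (hCell η)).app S ≫
        (restSheafId Y).app ((inverseImage g hg).obj S) =
      (inverseImage f hf).map ((restSheafId X).app S) ≫ (inverseImageMap hf hg η).app S := by
  refine (comp_eq_map_comp_of_unit (inverseImageAdjunction f hf) (s₂ := 𝟙 _)
    (inverseImageUnit_inverseImageCell hf hg (hCell η) S)
    (inverseImageUnit_inverseImageMap hf hg η S) ?_).trans (congrArg _ (Category.comp_id _))
  exact paste_two (crossCell_hCell hf hg η ((inverseImage g hg).obj S))
    ((restSheafId X).naturality (inverseImageUnit g hg S)) ((directImage f hf).map_id _)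

end Cells
end SmallGenSite

/-! ### Globular cells in quintets -/

section Quintets
variable {K : Type u₁} [Bicategory.{v₂, v₁} K] [Bicategory.Strict K] {x y z x' y' : K}

theorem hCell_id (f : x ⟶ y) : hCell (𝟙 f) = (quintet K).sqIdH f :=
  congrArg ((ρ_ f).hom ≫ ·) (Category.id_comp _)

theorem vCell_id (F : x ⟶ y) : vCell (𝟙 F) = (quintet K).sqIdV F :=
  congrArg ((λ_ F).hom ≫ ·) (Category.id_comp _)

theorem hCell_heq {f g f' g' : x ⟶ y} {η : f ⟶ g} {θ : f' ⟶ g'} (hf : f = f') (hg : g = g')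
    (h : HEq η θ) : HEq (hCell η) (hCell θ) := by
  subst hf hg
  cases h
  rfl

theorem vCell_heq {f g f' g' : x ⟶ y} {η : f ⟶ g} {θ : f' ⟶ g'} (hf : f = f') (hg : g = g')
    (h : HEq η θ) : HEq (vCell η) (vCell θ) := by
  subst hf hg
  cases h
  rfl

theorem invertibleV_hCell {f g : x ⟶ y} (e : f ≅ g) : (quintet K).InvertibleV (hCell e.hom) :=
  ⟨hCell e.inv, (hCell_comp e.hom e.inv).symm.trans (heq_of_eq (by rw [e.hom_inv_id, hCell_id])),
    (hCell_comp e.inv e.hom).symm.trans (heq_of_eq (by rw [e.inv_hom_id, hCell_id]))⟩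

theorem invertibleH_vCell {f g : x ⟶ y} (e : f ≅ g) : (quintet K).InvertibleH (vCell e.hom) :=
  ⟨vCell e.inv, (vCell_comp e.hom e.inv).symm.trans (heq_of_eq (by rw [e.inv_hom_id, vCell_id])),
    (vCell_comp e.inv e.hom).symm.trans (heq_of_eq (by rw [e.hom_inv_id, vCell_id]))⟩

theorem hCell_whiskerRight_comp {f f' : x ⟶ y} {h : y ⟶ z} {g : x ⟶ z} (η : f ⟶ f')
    (θ : f' ≫ h ⟶ g) :
    HEq ((quintet K).sqV ((quintet K).sqH (hCell η) ((quintet K).sqIdH h)) (hCell θ))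
      (hCell (η ▷ h ≫ θ)) := by
  rw [← hCell_whiskerRight]
  exact (hCell_comp _ _).symm

theorem hCell_whiskerLeft_comp {f : x ⟶ y} {h h' : y ⟶ z} {g : x ⟶ z} (η : h ⟶ h')
    (θ : f ≫ h' ⟶ g) :
    HEq ((quintet K).sqV ((quintet K).sqH ((quintet K).sqIdH f) (hCell η)) (hCell θ))
      (hCell (f ◁ η ≫ θ)) := by
  rw [← hCell_whiskerLeft]
  exact (hCell_comp _ _).symm

theorem vCell_comp_whiskerRight {F F' : x ⟶ y} {H : y ⟶ z} {G : x ⟶ z} (η : F' ⟶ F)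
    (θ : G ⟶ F' ≫ H) :
    HEq ((quintet K).sqH ((quintet K).sqV (vCell η) ((quintet K).sqIdV H)) (vCell θ))
      (vCell (θ ≫ η ▷ H)) := by
  rw [← vCell_whiskerRight]
  exact (vCell_comp _ _).symm

theorem vCell_comp_whiskerLeft {F : x ⟶ y} {H H' : y ⟶ z} {G : x ⟶ z} (η : H' ⟶ H)
    (θ : G ⟶ F ≫ H') :
    HEq ((quintet K).sqH ((quintet K).sqV ((quintet K).sqIdV F) (vCell η)) (vCell θ))
      (vCell (θ ≫ F ◁ η)) := by
  rw [← vCell_whiskerLeft]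
  exact (vCell_comp _ _).symm

/-- Pasting a globular cell to the top of a lax square whiskers it with the right side. The laws of
a double functor involving `unitH` and `compH` are in this way equations of 2-cells. -/
theorem sqV_hCell_left {f f' : x ⟶ y} {F : x ⟶ x'} {G : y ⟶ y'} {g : x' ⟶ y'} (θ : f ⟶ f')
    (α : f' ≫ G ⟶ F ≫ g) :
    HEq ((quintet K).sqV (f' := f') (F' := F) (G' := G) (f'' := g) (hCell θ) α) (θ ▷ G ≫ α) := by
  refine heq_of_iso_comm (K := K) (whiskerLeftIso f (λ_ G)) (whiskerRightIso (λ_ F) g)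
    (by simp only [Bicategory.Strict.id_comp]) (by simp only [Bicategory.Strict.id_comp])
    (by simp [Bicategory.Strict.leftUnitor_eqToIso])
    (by simp [Bicategory.Strict.leftUnitor_eqToIso])
    ((α_ f (𝟙 y) G).inv ≫ ((ρ_ f).hom ≫ θ ≫ (λ_ f').inv) ▷ G ≫ (α_ (𝟙 x) f' G).hom ≫
      𝟙 x ◁ α ≫ (α_ (𝟙 x) F g).inv) _ ?_
  simp only [whiskerLeftIso_hom, whiskerRightIso_hom]
  bicategory

theorem sqV_hCell_right {f : x ⟶ y} {F : x ⟶ x'} {G : y ⟶ y'} {g g' : x' ⟶ y'}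
    (α : f ≫ G ⟶ F ≫ g) (θ : g ⟶ g') :
    HEq ((quintet K).sqV (f := f) (F := F) (G := G) (f' := g) α (hCell θ)) (α ≫ F ◁ θ) := by
  refine heq_of_iso_comm (K := K) (whiskerLeftIso f (ρ_ G)) (whiskerRightIso (ρ_ F) g')
    (by simp only [Bicategory.Strict.comp_id]) (by simp only [Bicategory.Strict.comp_id])
    (by simp [Bicategory.Strict.rightUnitor_eqToIso])
    (by simp [Bicategory.Strict.rightUnitor_eqToIso])
    ((α_ f G (𝟙 y')).inv ≫ α ▷ 𝟙 y' ≫ (α_ F g (𝟙 y')).hom ≫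
      F ◁ ((ρ_ g).hom ≫ θ ≫ (λ_ g').inv) ≫ (α_ F (𝟙 x') g').inv) _ ?_
  simp only [whiskerLeftIso_hom, whiskerRightIso_hom]
  bicategory

/-- Pasting a globular cell to the left of a lax square whiskers it with the bottom. The laws of a
double functor involving `unitV` and `compV` are in this way equations of 2-cells. -/
theorem sqH_vCell_left {f : x ⟶ y} {F F' : x ⟶ x'} {G : y ⟶ y'} {g : x' ⟶ y'} (θ : F' ⟶ F)
    (α : f ≫ G ⟶ F' ≫ g) :
    HEq ((quintet K).sqH (f' := f) (F' := F') (F'' := G) (g' := g) (vCell θ) α) (α ≫ θ ▷ g) := by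
  refine heq_of_iso_comm (K := K) (whiskerRightIso (λ_ f) G) (whiskerLeftIso F (λ_ g))
    (by simp only [Bicategory.Strict.id_comp]) (by simp only [Bicategory.Strict.id_comp])
    (by simp [Bicategory.Strict.leftUnitor_eqToIso])
    (by simp [Bicategory.Strict.leftUnitor_eqToIso])
    ((α_ (𝟙 x) f G).hom ≫ 𝟙 x ◁ α ≫ (α_ (𝟙 x) F' g).inv ≫
      ((λ_ F').hom ≫ θ ≫ (ρ_ F).inv) ▷ g ≫ (α_ F (𝟙 x') g).hom) _ ?_
  simp only [whiskerLeftIso_hom, whiskerRightIso_hom]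
  bicategory

theorem sqH_vCell_right {f : x ⟶ y} {F : x ⟶ x'} {G G' : y ⟶ y'} {g : x' ⟶ y'}
    (α : f ≫ G ⟶ F ≫ g) (θ : G' ⟶ G) :
    HEq ((quintet K).sqH (f := f) (F := F) (F' := G) (g := g) α (vCell θ)) (f ◁ θ ≫ α) := by
  refine heq_of_iso_comm (K := K) (whiskerRightIso (ρ_ f) G') (whiskerLeftIso F (ρ_ g))
    (by simp only [Bicategory.Strict.comp_id]) (by simp only [Bicategory.Strict.comp_id])
    (by simp [Bicategory.Strict.rightUnitor_eqToIso])
    (by simp [Bicategory.Strict.rightUnitor_eqToIso])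
    ((α_ f (𝟙 y) G').hom ≫ f ◁ ((λ_ G').hom ≫ θ ≫ (ρ_ G).inv) ≫ (α_ f G (𝟙 y')).inv ≫
      α ▷ 𝟙 y' ≫ (α_ F g (𝟙 y')).hom) _ ?_
  simp only [whiskerLeftIso_hom, whiskerRightIso_hom]
  bicategory

end Quintets

/-! ### The double functor of sheaf topoi -/

/-- The identities inserted on the right are the components of the associators in a horizontal
pasting of lax squares of topoi. -/
theorem comp_comp_eq_padded_comp {C : Type u₁} [Category.{v₁} C] {P Q R T : C} (p : P ⟶ Q)
    (q : Q ⟶ R) (r : R ⟶ T) : p ≫ q ≫ r = (𝟙 P ≫ p ≫ 𝟙 Q ≫ q ≫ 𝟙 R) ≫ r := by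
  simp

/-- The identities inserted on the right are the components of the associators in a vertical pasting
of lax squares of topoi. -/
theorem comp_comp_eq_comp_padded {C : Type u₁} [Category.{v₁} C] {P Q R T : C} (p : P ⟶ Q)
    (q : Q ⟶ R) (r : R ⟶ T) : p ≫ q ≫ r = p ≫ 𝟙 Q ≫ q ≫ 𝟙 R ≫ r ≫ 𝟙 T := by
  simp

/-- Composition of geometric morphisms is associative and unital definitionally on inverse images,
but only propositionally on adjunctions; the hypothesis `h` is thus typically an equality. -/
theorem GeomMorph.hom₂_heq {E F : GrothTopos.{u, a, b}} {f g f' g' : E ⟶ F} (hf : f = f')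
    (hg : g = g') {α : f ⟶ g} {β : f' ⟶ g'} (h : HEq (Hom₂.hom α) (Hom₂.hom β)) : HEq α β := by
  subst hf hg
  exact heq_of_eq (hom₂_ext (eq_of_heq h))

namespace SmallGenSite
variable {X Y Z W : SmallGenSite.{u, w}}

theorem restSheafMap_id (F : X ⟶ Y) : restSheafMap (𝟙 F) = 𝟙 _ :=
  NatTrans.ext (funext fun S => (congrArg (presheafToSheaf X.J (Type u)).map
    (restMap_id F S.obj)).trans (CategoryTheory.Functor.map_id _ _))

theorem restSheafMap_comp {F G H : X ⟶ Y} (η : F ⟶ G) (θ : G ⟶ H) :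
    restSheafMap (η ≫ θ) = restSheafMap θ ≫ restSheafMap η :=
  NatTrans.ext (funext fun S => (congrArg (presheafToSheaf X.J (Type u)).map
    (restMap_comp η θ S.obj)).trans (Functor.map_comp _ _ _))

theorem directImageMap_id {f : X ⟶ Y} (hf : IsMorphism f) : directImageMap hf hf (𝟙 f) = 𝟙 _ :=
  NatTrans.ext (funext fun S => Sheaf.hom_ext (restMap_id f S.obj))

theorem directImageMap_comp {f g h : X ⟶ Y} (hf : IsMorphism f) (hg : IsMorphism g)
    (hh : IsMorphism h) (η : f ⟶ g) (θ : g ⟶ h) :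
    directImageMap hf hh (η ≫ θ) = directImageMap hg hh θ ≫ directImageMap hf hg η :=
  NatTrans.ext (funext fun S => Sheaf.hom_ext (restMap_comp η θ S.obj))

theorem inverseImageMap_id {f : X ⟶ Y} (hf : IsMorphism f) : inverseImageMap hf hf (𝟙 f) = 𝟙 _ := by
  rw [inverseImageMap, directImageMap_id, CategoryTheory.conjugateEquiv_symm_id]

theorem inverseImageMap_comp {f g h : X ⟶ Y} (hf : IsMorphism f) (hg : IsMorphism g)
    (hh : IsMorphism h) (η : f ⟶ g) (θ : g ⟶ h) :
    inverseImageMap hf hh (η ≫ θ) = inverseImageMap hf hg η ≫ inverseImageMap hg hh θ := by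
  rw [inverseImageMap, directImageMap_comp hf hg hh, inverseImageMap, inverseImageMap,
    CategoryTheory.conjugateEquiv_symm_comp]

/-- The right adjoint of the inverse image along a comorphism of sites. -/
noncomputable def restSheafRightAdjoint (G : X ⟶ Y) (hG : IsComorphism G) :
    Sheaf X.J (Type u) ⥤ Sheaf Y.J (Type u) :=
  have := hG.isLeftAdjoint_restSheaf
  (restSheaf G).rightAdjoint

/-- The adjunction of inverse and direct image along a comorphism of sites. -/
noncomputable def restSheafAdjunction (G : X ⟶ Y) (hG : IsComorphism G) :
    restSheaf G ⊣ restSheafRightAdjoint G hG :=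
  have := hG.isLeftAdjoint_restSheaf
  Adjunction.ofIsLeftAdjoint (restSheaf G)

/-- The counit of sheafification as an isomorphism. -/
noncomputable def restSheafIdIso (X : SmallGenSite.{u, w}) :
    restSheaf (𝟙 X) ≅ 𝟭 (Sheaf X.J (Type u)) :=
  asIso (restSheafId X)

/-- The comparison for a composite, invertible if the first functor is a comorphism of sites. -/
noncomputable def restSheafCompIso (F : X ⟶ Y) (hF : IsComorphism F) (G : Y ⟶ Z) :
    restSheaf (F ≫ G) ≅ restSheaf G ⋙ restSheaf F :=
  have := hF.isIso_restSheafComp G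
  asIso (restSheafComp F G)

/-- The geometric morphism with the given direct image induced by a morphism of sites. -/
noncomputable def morphismGeom (f : siteLax.H X Y) :
    (show GTop.{u, w} from Y.sheafTopos) ⟶ X.sheafTopos :=
  GeomMorph.mk (E := Y.sheafTopos) (F := X.sheafTopos) (directImage f.1 f.2)
    (inverseImage f.1 f.2) (inverseImageAdjunction f.1 f.2)
    (preservesFiniteLimits_inverseImage f.1 f.2)

/-- The geometric morphism with the given inverse image induced by a comorphism of sites. -/
noncomputable def comorphismGeom (G : siteLax.V X Y) :
    (show GTop.{u, w} from X.sheafTopos) ⟶ Y.sheafTopos :=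
  GeomMorph.mk (E := X.sheafTopos) (F := Y.sheafTopos) (restSheafRightAdjoint G.1 G.2)
    (restSheaf G.1) (restSheafAdjunction G.1 G.2) (preservesFiniteLimits_restSheaf G.1)

/-- The coherence isomorphism of `morphismGeom` for an identity. -/
noncomputable def morphismGeomId (X : SmallGenSite.{u, w}) :
    𝟙 (show GTop.{u, w} from X.sheafTopos) ≅ morphismGeom (siteLax.hId X) :=
  GeomMorph.isoMk (f := 𝟙 (show GTop.{u, w} from X.sheafTopos)) (inverseImageId X _)

/-- The coherence isomorphism of `morphismGeom` for a composite. -/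
noncomputable def morphismGeomComp (f : siteLax.H X Y) (g : siteLax.H Y Z) :
    morphismGeom g ≫ morphismGeom f ≅ morphismGeom (siteLax.hComp f g) :=
  GeomMorph.isoMk (f := morphismGeom g ≫ morphismGeom f)
    (inverseImageComp f.1 f.2 g.1 g.2 (siteLax.hComp f g).2)

/-- The coherence isomorphism of `comorphismGeom` for an identity. -/
noncomputable def comorphismGeomId (X : SmallGenSite.{u, w}) :
    comorphismGeom (siteLax.vId X) ≅ 𝟙 (show GTop.{u, w} from X.sheafTopos) :=
  GeomMorph.isoMk (g := 𝟙 (show GTop.{u, w} from X.sheafTopos)) (restSheafIdIso X)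

/-- The coherence isomorphism of `comorphismGeom` for a composite. -/
noncomputable def comorphismGeomComp (F : siteLax.V X Y) (G : siteLax.V Y Z) :
    comorphismGeom (siteLax.vComp F G) ≅ comorphismGeom F ≫ comorphismGeom G :=
  GeomMorph.isoMk (g := comorphismGeom F ≫ comorphismGeom G) (restSheafCompIso F.1 F.2 G.1)

/-- The lax square of topoi induced by a lax square of sites. -/
noncomputable def geomCell {A B C D : SmallGenSite.{u, w}} {f : siteLax.H A B} {G : siteLax.V A C}
    {K : siteLax.V B D} {h : siteLax.H C D} (φ : siteLax.Sq f G K h) :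
    morphismGeom f ≫ comorphismGeom G ⟶ comorphismGeom K ≫ morphismGeom h :=
  GeomMorph.Hom₂.mk (inverseImageCell f.2 h.2 φ)

/-- Equality of geometric transformations may be checked on the components of the underlying
natural transformations. -/
theorem geom_hom_ext {E F : GTop.{u, w}} {f g : E ⟶ F} {α β : f ⟶ g}
    (h : ∀ S, (GeomMorph.Hom₂.hom α).app S = (GeomMorph.Hom₂.hom β).app S) : α = β :=
  GeomMorph.hom₂_ext (NatTrans.ext (funext h))

section Cells
variable {A B A' B' A'' B'' : SmallGenSite.{u, w}}

theorem geomCell_sqIdV (F : siteLax.V X Y) :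
    (morphismGeomId X).hom ▷ comorphismGeom F ≫ geomCell (siteLax.sqIdV F) =
      ((λ_ (comorphismGeom F)).hom ≫ (ρ_ (comorphismGeom F)).inv) ≫
        comorphismGeom F ◁ (morphismGeomId Y).hom :=
  geom_hom_ext fun S => by
    let G : X ⟶ Y := F.1
    have e : vCell (𝟙 G) = siteLax.sqIdV F := vCell_id G
    have h := inverseImageCell_vCell (𝟙 G) (siteLax.hId X).2 (siteLax.hId Y).2 S
    rw [e, restSheafMap_id] at h
    exact h.trans (congrArg (· ≫ _) (Category.id_comp (𝟙 _)).symm)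

theorem geomCell_sqH {f : siteLax.H A A'} {f' : siteLax.H A' A''} {F : siteLax.V A B}
    {F' : siteLax.V A' B'} {F'' : siteLax.V A'' B''} {g : siteLax.H B B'} {g' : siteLax.H B' B''}
    (α : siteLax.Sq f F F' g) (β : siteLax.Sq f' F' F'' g') :
    (morphismGeomComp f f').hom ▷ comorphismGeom F ≫ geomCell (siteLax.sqH α β) =
      (show (morphismGeom f' ≫ morphismGeom f) ≫ comorphismGeom F ⟶
        comorphismGeom F'' ≫ (morphismGeom g' ≫ morphismGeom g) from
        toposLax.sqH (geomCell β) (geomCell α)) ≫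
          comorphismGeom F'' ◁ (morphismGeomComp g g').hom :=
  geom_hom_ext fun S => by
    refine (inverseImageCell_sqH α β S).trans ?_
    exact comp_comp_eq_padded_comp _ _ _

theorem geomCell_sqIdH (f : siteLax.H X Y) :
    geomCell (siteLax.sqIdH f) ≫ (comorphismGeomId Y).hom ▷ morphismGeom f =
      morphismGeom f ◁ (comorphismGeomId X).hom ≫
        (ρ_ (morphismGeom f)).hom ≫ (λ_ (morphismGeom f)).inv :=
  geom_hom_ext fun S => by
    let g : X ⟶ Y := f.1
    have e : hCell (𝟙 g) = siteLax.sqIdH f := hCell_id g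
    have hg : IsMorphism g := f.2
    have h := inverseImageCell_hCell hg hg (𝟙 g) S
    rw [e, inverseImageMap_id] at h
    exact h.trans (congrArg (_ ≫ ·) (Category.id_comp (𝟙 _)).symm)

theorem geomCell_sqV {f : siteLax.H A B} {F : siteLax.V A A'} {G : siteLax.V B B'}
    {f' : siteLax.H A' B'} {F' : siteLax.V A' A''} {G' : siteLax.V B' B''} {f'' : siteLax.H A'' B''}
    (α : siteLax.Sq f F G f') (β : siteLax.Sq f' F' G' f'') :
    geomCell (siteLax.sqV α β) ≫ (comorphismGeomComp G G').hom ▷ morphismGeom f'' =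
      morphismGeom f ◁ (comorphismGeomComp F F').hom ≫
        (show morphismGeom f ≫ comorphismGeom F ≫ comorphismGeom F' ⟶
          (comorphismGeom G ≫ comorphismGeom G') ≫ morphismGeom f'' from
          toposLax.sqV (geomCell α) (geomCell β)) :=
  geom_hom_ext fun S => by
    refine (inverseImageCell_sqV α β S).trans ?_
    exact comp_comp_eq_comp_padded _ _ _

end Cells
end SmallGenSite

namespace SmallGenSite
variable {X Y Z W : SmallGenSite.{u, w}}

theorem morphismGeomComp_assoc (f : siteLax.H X Y) (g : siteLax.H Y Z) (k : siteLax.H Z W) :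
    HEq ((morphismGeomComp g k).hom ▷ morphismGeom f ≫
        (morphismGeomComp f (siteLax.hComp g k)).hom)
      (morphismGeom k ◁ (morphismGeomComp f g).hom ≫
        (morphismGeomComp (siteLax.hComp f g) k).hom) :=
  GeomMorph.hom₂_heq (Bicategory.Strict.assoc (morphismGeom k) (morphismGeom g) (morphismGeom f))
    rfl (heq_of_eq (NatTrans.ext (funext fun S =>
      (inverseImageComp_assoc f.1 f.2 g.1 g.2 k.1 k.2 (siteLax.hComp f g).2 (siteLax.hComp g k).2
        (siteLax.hComp f (siteLax.hComp g k)).2 S).symm)))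

theorem morphismGeomId_comp (f : siteLax.H X Y) :
    HEq ((morphismGeomId Y).hom ▷ morphismGeom f ≫
      (morphismGeomComp f (siteLax.hId Y)).hom) (𝟙 (morphismGeom f)) :=
  GeomMorph.hom₂_heq (Bicategory.Strict.id_comp (morphismGeom f)) rfl
    (heq_of_eq (NatTrans.ext (funext fun S =>
      inverseImageId_comp f.1 f.2 (siteLax.hId Y).2 S)))

theorem morphismGeomComp_id (f : siteLax.H X Y) :
    HEq (morphismGeom f ◁ (morphismGeomId X).hom ≫
      (morphismGeomComp (siteLax.hId X) f).hom) (𝟙 (morphismGeom f)) :=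
  GeomMorph.hom₂_heq (Bicategory.Strict.comp_id (morphismGeom f)) rfl
    (heq_of_eq (NatTrans.ext (funext fun S =>
      inverseImageComp_id f.1 f.2 (siteLax.hId X).2 S)))

theorem comorphismGeomComp_assoc (F : siteLax.V X Y) (G : siteLax.V Y Z) (K : siteLax.V Z W) :
    HEq ((comorphismGeomComp (siteLax.vComp F G) K).hom ≫
        (comorphismGeomComp F G).hom ▷ comorphismGeom K)
      ((comorphismGeomComp F (siteLax.vComp G K)).hom ≫
        comorphismGeom F ◁ (comorphismGeomComp G K).hom) :=
  GeomMorph.hom₂_heq rfl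
    (Bicategory.Strict.assoc (comorphismGeom F) (comorphismGeom G) (comorphismGeom K))
    (heq_of_eq (NatTrans.ext (funext fun S => restSheafComp_assoc F.1 G.1 K.1 S)))

theorem comorphismGeomComp_id_left (F : siteLax.V X Y) :
    HEq ((comorphismGeomComp (siteLax.vId X) F).hom ≫ (comorphismGeomId X).hom ▷ comorphismGeom F)
      (𝟙 (comorphismGeom F)) :=
  GeomMorph.hom₂_heq rfl (Bicategory.Strict.id_comp (comorphismGeom F))
    (heq_of_eq (NatTrans.ext (funext fun S => restSheafComp_id_left F.1 S)))

theorem comorphismGeomComp_id_right (F : siteLax.V X Y) :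
    HEq ((comorphismGeomComp F (siteLax.vId Y)).hom ≫ comorphismGeom F ◁ (comorphismGeomId Y).hom)
      (𝟙 (comorphismGeom F)) :=
  GeomMorph.hom₂_heq rfl (Bicategory.Strict.comp_id (comorphismGeom F))
    (heq_of_eq (NatTrans.ext (funext fun S => restSheafComp_id_right F.1 S)))

end SmallGenSite

section DoubleFunctor
open SmallGenSite

/-- The double functor sending a site to its topos of sheaves, a morphism of sites to the geometric
morphism with direct image the restriction of sheaves, a comorphism of sites to the geometric
morphism with inverse image restriction followed by sheafification, and a lax square to the mate
of `crossCell`. -/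
noncomputable def sheafDouble :
    DoublePseudofunctor siteLax.{u, w}.hop toposLax.{u, w} SmallGenSite.sheafTopos where
  mapH {A B} f := morphismGeom (X := B) (Y := A) f
  mapV {A B} F := comorphismGeom (X := A) (Y := B) F
  mapSq {_ _ _ _ f F G g} φ := geomCell (f := f) (G := G) (K := F) (h := g) φ
  unitH A := hCell (morphismGeomId A).hom
  compH {A B C} f g := hCell (morphismGeomComp (X := C) (Y := B) (Z := A) g f).hom
  unitV A := vCell (comorphismGeomId A).hom
  compV {A B C} F G := vCell (comorphismGeomComp (X := A) (Y := B) (Z := C) F G).hom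
  unitH_invertible A := invertibleV_hCell (morphismGeomId A)
  compH_invertible {A B C} f g :=
    invertibleV_hCell (morphismGeomComp (X := C) (Y := B) (Z := A) g f)
  unitV_invertible A := invertibleH_vCell (comorphismGeomId A)
  compV_invertible {A B C} F G :=
    invertibleH_vCell (comorphismGeomComp (X := A) (Y := B) (Z := C) F G)
  compH_assoc {A B C A'} f g h :=
    (hCell_whiskerRight_comp _ _).trans ((hCell_heq (Bicategory.Strict.assoc _ _ _) rfl
      (morphismGeomComp_assoc (X := A') (Y := C) (Z := B) (W := A) h g f)).trans
        (hCell_whiskerLeft_comp _ _).symm)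
  unitH_compH {A B} f :=
    (hCell_whiskerRight_comp _ _).trans ((hCell_heq (Bicategory.Strict.id_comp _) rfl
      (morphismGeomId_comp (X := B) (Y := A) f)).trans (heq_of_eq (hCell_id _)))
  compH_unitH {A B} f :=
    (hCell_whiskerLeft_comp _ _).trans ((hCell_heq (Bicategory.Strict.comp_id _) rfl
      (morphismGeomComp_id (X := B) (Y := A) f)).trans (heq_of_eq (hCell_id _)))
  compV_assoc {A B C A'} F G K :=
    (vCell_comp_whiskerRight _ _).trans ((vCell_heq rfl (Bicategory.Strict.assoc _ _ _)
      (comorphismGeomComp_assoc (X := A) (Y := B) (Z := C) (W := A') F G K)).trans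
        (vCell_comp_whiskerLeft _ _).symm)
  unitV_compV {A B} F :=
    (vCell_comp_whiskerRight _ _).trans ((vCell_heq rfl (Bicategory.Strict.id_comp _)
      (comorphismGeomComp_id_left (X := A) (Y := B) F)).trans (heq_of_eq (vCell_id _)))
  compV_unitV {A B} F :=
    (vCell_comp_whiskerLeft _ _).trans ((vCell_heq rfl (Bicategory.Strict.comp_id _)
      (comorphismGeomComp_id_right (X := A) (Y := B) F)).trans (heq_of_eq (vCell_id _)))
  mapSq_sqIdV {A B} F :=
    (sqV_hCell_left _ _).trans ((heq_of_eq (geomCell_sqIdV (X := A) (Y := B) F)).trans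
      (sqV_hCell_right _ _).symm)
  mapSq_sqH α β :=
    (sqV_hCell_left _ _).trans ((heq_of_eq (geomCell_sqH β α)).trans (sqV_hCell_right _ _).symm)
  mapSq_sqIdH {A B} f :=
    (sqH_vCell_left _ _).trans ((heq_of_eq (geomCell_sqIdH (X := B) (Y := A) f)).trans
      (sqH_vCell_right _ _).symm)
  mapSq_sqV α β :=
    (sqH_vCell_left _ _).trans ((heq_of_eq (geomCell_sqV α β)).trans (sqH_vCell_right _ _).symm)

theorem comp_id_hcomp_id {C : Type u₁} [Category.{v₁} C] {D : Type u₂} [Category.{v₂} D]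
    {E : Type u₃} [Category.{v₃} E] {H : C ⥤ E} {F : C ⥤ D} {G : D ⥤ E} {x y : H ⟶ F ⋙ G}
    (h : x = y) : x ≫ (𝟙 F ◫ 𝟙 G) = 𝟙 H ≫ y := by
  subst h
  simp

theorem comp_id_hcomp_id_eq {C : Type u₁} [Category.{v₁} C] {D : Type u₂} [Category.{v₂} D]
    {E : Type u₃} [Category.{v₃} E] {D' : Type u₄} [Category.{v₄} D'] {F : C ⥤ D} {G : D ⥤ E}
    {F' : C ⥤ D'} {G' : D' ⥤ E} {x y : F' ⋙ G' ⟶ F ⋙ G}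
    (h : x = y) : x ≫ (𝟙 F ◫ 𝟙 G) = (𝟙 F' ◫ 𝟙 G') ≫ y := by
  subst h
  simp

/-- The identifications exhibiting `sheafDouble` as sheafification are identities. -/
noncomputable def sheafificationDatum : SheafificationDatum sheafDouble.{u, w} where
  dir _ := Iso.refl _
  inv _ := Iso.refl _
  unitH X := by
    have h : hCell.symm (sheafDouble.unitH X) = (morphismGeomId X).hom := Equiv.symm_apply_apply _ _
    rw [h]
    exact (Equiv.apply_symm_apply (CategoryTheory.conjugateEquiv
      (inverseImageAdjunction (𝟙 X) (siteLax.hId X).2) Adjunction.id)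
        (directImageId X _).hom).trans (Category.id_comp _).symm
  compH {X Y Z} f g := by
    have h : hCell.symm (sheafDouble.compH g f) = (morphismGeomComp f g).hom :=
      Equiv.symm_apply_apply _ _
    rw [h]
    exact comp_id_hcomp_id (Equiv.apply_symm_apply (CategoryTheory.conjugateEquiv
      (inverseImageAdjunction (f.1 ≫ g.1) (siteLax.hComp f g).2)
      ((inverseImageAdjunction f.1 f.2).comp (inverseImageAdjunction g.1 g.2)))
        (directImageComp f.1 f.2 g.1 g.2 _).hom)
  unitV X := by
    have h : vCell.symm (sheafDouble.unitV X) = (comorphismGeomId X).hom :=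
      Equiv.symm_apply_apply _ _
    rw [h]
    exact (Category.id_comp _).symm
  compV {X Y Z} G K := by
    have h : vCell.symm (sheafDouble.compV G K) = (comorphismGeomComp G K).hom :=
      Equiv.symm_apply_apply _ _
    rw [h]
    exact comp_id_hcomp_id rfl
  cell {A B C D f G K h} φ :=
    comp_id_hcomp_id_eq (congrArg TwoSquare.natTrans (Equiv.apply_symm_apply
      (CategoryTheory.mateEquiv (inverseImageAdjunction h.1 h.2) (inverseImageAdjunction f.1 f.2))
      (TwoSquare.mk _ _ _ _ (crossCell f.2 h.2 φ))))

end DoubleFunctor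

/-! ### The pseudofunctors on morphisms and on comorphisms of sites -/

section Conjugates
variable {A : Type u₁} [Category.{v₁} A] {B : Type u₂} [Category.{v₂} B] {C : Type u₃}
  [Category.{v₃} C]

/-- Whiskering on the left is compatible with conjugation. -/
theorem conjugateEquiv_symm_whiskerLeft {L : A ⥤ B} {R : B ⥤ A} {L₁ L₂ : B ⥤ C} {R₁ R₂ : C ⥤ B}
    {M₁ M₂ : A ⥤ C} {N₁ N₂ : C ⥤ A} (adj : L ⊣ R) (adj₁ : L₁ ⊣ R₁) (adj₂ : L₂ ⊣ R₂)
    (adjM₁ : M₁ ⊣ N₁) (adjM₂ : M₂ ⊣ N₂) {c₁ : N₁ ⟶ R₁ ⋙ R} {c₂ : N₂ ⟶ R₂ ⋙ R} {θ : R₂ ⟶ R₁}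
    {ψ : N₂ ⟶ N₁} (h : ψ ≫ c₁ = c₂ ≫ Functor.whiskerRight θ R) :
    (CategoryTheory.conjugateEquiv adjM₁ (adj.comp adj₁)).symm c₁ ≫
        (CategoryTheory.conjugateEquiv adjM₂ adjM₁).symm ψ =
      Functor.whiskerLeft L ((CategoryTheory.conjugateEquiv adj₂ adj₁).symm θ) ≫
        (CategoryTheory.conjugateEquiv adjM₂ (adj.comp adj₂)).symm c₂ := by
  have e : Functor.whiskerLeft L ((CategoryTheory.conjugateEquiv adj₂ adj₁).symm θ) =
      (CategoryTheory.conjugateEquiv (adj.comp adj₂) (adj.comp adj₁)).symm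
        (Functor.whiskerRight θ R) := by
    rw [Equiv.eq_symm_apply, CategoryTheory.conjugateEquiv_whiskerLeft, Equiv.apply_symm_apply]
  rw [e, CategoryTheory.conjugateEquiv_symm_comp, CategoryTheory.conjugateEquiv_symm_comp, h]

/-- Whiskering on the right is compatible with conjugation. -/
theorem conjugateEquiv_symm_whiskerRight {L : B ⥤ C} {R : C ⥤ B} {L₁ L₂ : A ⥤ B} {R₁ R₂ : B ⥤ A}
    {M₁ M₂ : A ⥤ C} {N₁ N₂ : C ⥤ A} (adj : L ⊣ R) (adj₁ : L₁ ⊣ R₁) (adj₂ : L₂ ⊣ R₂)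
    (adjM₁ : M₁ ⊣ N₁) (adjM₂ : M₂ ⊣ N₂) {c₁ : N₁ ⟶ R ⋙ R₁} {c₂ : N₂ ⟶ R ⋙ R₂} {θ : R₂ ⟶ R₁}
    {ψ : N₂ ⟶ N₁} (h : ψ ≫ c₁ = c₂ ≫ Functor.whiskerLeft R θ) :
    (CategoryTheory.conjugateEquiv adjM₁ (adj₁.comp adj)).symm c₁ ≫
        (CategoryTheory.conjugateEquiv adjM₂ adjM₁).symm ψ =
      Functor.whiskerRight ((CategoryTheory.conjugateEquiv adj₂ adj₁).symm θ) L ≫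
        (CategoryTheory.conjugateEquiv adjM₂ (adj₂.comp adj)).symm c₂ := by
  have e : Functor.whiskerRight ((CategoryTheory.conjugateEquiv adj₂ adj₁).symm θ) L =
      (CategoryTheory.conjugateEquiv (adj₂.comp adj) (adj₁.comp adj)).symm
        (Functor.whiskerLeft R θ) := by
    rw [Equiv.eq_symm_apply, CategoryTheory.conjugateEquiv_whiskerRight, Equiv.apply_symm_apply]
  rw [e, CategoryTheory.conjugateEquiv_symm_comp, CategoryTheory.conjugateEquiv_symm_comp, h]

end Conjugates

section Coherence
variable {C : Type u₁} [Category.{v₁} C]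

/-- With a componentwise trivial associator, the associativity of comparisons of inverse images
yields the associativity law of a pseudofunctor whose comparisons are their inverses. -/
theorem id_eq_inv_comp_inv_comp {P Q R S : C} {b : Q ⟶ P} {a : P ⟶ S} {b' : P ⟶ Q} {a' : S ⟶ P}
    {c : Q ⟶ R} {d : R ⟶ S} (h : b ≫ a = c ≫ d) (hb : b' ≫ b = 𝟙 P) (ha : a' ≫ a = 𝟙 S) :
    𝟙 S = a' ≫ b' ≫ 𝟙 Q ≫ c ≫ d := by
  rw [Category.id_comp, ← h, reassoc_of% hb, ha]

/-- The associativity law of a pseudofunctor, for a componentwise trivial associator. -/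
theorem id_eq_comp_comp_inv {P Q R S : C} {a : P ⟶ Q} {b : Q ⟶ S} {c : P ⟶ R} {d : R ⟶ S}
    {d' : S ⟶ R} {c' : R ⟶ P} (h : a ≫ b = c ≫ d) (hd : d ≫ d' = 𝟙 R) (hc : c ≫ c' = 𝟙 P) :
    𝟙 P = a ≫ b ≫ 𝟙 S ≫ d' ≫ c' := by
  rw [Category.id_comp, reassoc_of% h, reassoc_of% hd, hc]

theorem id_eq_inv_comp_inv {P Q : C} {b : P ⟶ Q} {a : Q ⟶ P} {b' : Q ⟶ P} {a' : P ⟶ Q}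
    (h : b ≫ a = 𝟙 P) (hb : b' ≫ b = 𝟙 Q) (ha : a' ≫ a = 𝟙 P) : 𝟙 P = a' ≫ b' ≫ 𝟙 P := by
  have : a = b' := by rw [← Category.id_comp a, ← hb, Category.assoc, h, Category.comp_id]
  rw [Category.comp_id, ← this, ha]

theorem id_eq_comp_comp_id {P Q : C} {b : P ⟶ Q} {a : Q ⟶ P} (h : b ≫ a = 𝟙 P) :
    𝟙 P = b ≫ a ≫ 𝟙 P := by
  rw [Category.comp_id, h]

end Coherence

namespace SmallGenSite
variable {X Y Z W : SmallGenSite.{u, w}}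

theorem inverseImageComp_whiskerLeft (f : X ⟶ Y) (hf : IsMorphism f) {g g' : Y ⟶ Z}
    (hg : IsMorphism g) (hg' : IsMorphism g') (hfg : IsMorphism (f ≫ g))
    (hfg' : IsMorphism (f ≫ g')) (θ : g ⟶ g') :
    (inverseImageComp f hf g hg hfg).hom ≫ inverseImageMap hfg hfg' (f ◁ θ) =
      Functor.whiskerLeft (inverseImage f hf) (inverseImageMap hg hg' θ) ≫
        (inverseImageComp f hf g' hg' hfg').hom :=
  conjugateEquiv_symm_whiskerLeft (inverseImageAdjunction f hf) (inverseImageAdjunction g hg)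
    (inverseImageAdjunction g' hg') (inverseImageAdjunction (f ≫ g) hfg)
    (inverseImageAdjunction (f ≫ g') hfg')
    ((Category.comp_id _).trans (Category.id_comp
      (Functor.whiskerRight (directImageMap hg hg' θ) (directImage f hf))).symm)

theorem inverseImageComp_whiskerRight {f f' : X ⟶ Y} (hf : IsMorphism f) (hf' : IsMorphism f')
    (g : Y ⟶ Z) (hg : IsMorphism g) (hfg : IsMorphism (f ≫ g))
    (hfg' : IsMorphism (f' ≫ g)) (θ : f ⟶ f') :
    (inverseImageComp f hf g hg hfg).hom ≫ inverseImageMap hfg hfg' (θ ▷ g) =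
      Functor.whiskerRight (inverseImageMap hf hf' θ) (inverseImage g hg) ≫
        (inverseImageComp f' hf' g hg hfg').hom :=
  conjugateEquiv_symm_whiskerRight (inverseImageAdjunction g hg) (inverseImageAdjunction f hf)
    (inverseImageAdjunction f' hf') (inverseImageAdjunction (f ≫ g) hfg)
    (inverseImageAdjunction (f' ≫ g) hfg')
    ((Category.comp_id _).trans (Category.id_comp
      (Functor.whiskerLeft (directImage g hg) (directImageMap hf hf' θ))).symm)

theorem restSheafComp_whiskerLeft (F : X ⟶ Y) {G G' : Y ⟶ Z} (θ : G ⟶ G')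
    (S : Sheaf Z.J (Type u)) :
    (restSheafMap (F ◁ θ)).app S ≫ (restSheafComp F G).app S =
      (restSheafComp F G').app S ≫ (restSheaf F).map ((restSheafMap θ).app S) :=
  map_comp_eq (rest F ⋙ presheafToSheaf X.J (Type u))
    ((sheafificationAdjunction Y.J (Type u)).unit.naturality ((restMap θ).app S.obj))

theorem restSheafComp_whiskerRight {F F' : X ⟶ Y} (θ : F ⟶ F') (G : Y ⟶ Z)
    (S : Sheaf Z.J (Type u)) :
    (restSheafMap (θ ▷ G)).app S ≫ (restSheafComp F G).app S =
      (restSheafComp F' G).app S ≫ (restSheafMap θ).app ((restSheaf G).obj S) :=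
  map_comp_eq (presheafToSheaf X.J (Type u)) ((restMap θ).naturality
    ((sheafificationAdjunction Y.J (Type u)).unit.app ((rest G).obj S.obj))).symm

/-- The geometric transformation induced by a natural transformation of morphisms of sites. -/
noncomputable def morphismGeomMap {f g : X ⟶ Y} (hf : IsMorphism f) (hg : IsMorphism g)
    (η : f ⟶ g) : morphismGeom ⟨f, hf⟩ ⟶ morphismGeom ⟨g, hg⟩ :=
  GeomMorph.Hom₂.mk (inverseImageMap hf hg η)

/-- The geometric transformation induced by a natural transformation of comorphisms of sites. -/
noncomputable def comorphismGeomMap {F G : X ⟶ Y} (hF : IsComorphism F) (hG : IsComorphism G)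
    (η : F ⟶ G) : comorphismGeom ⟨G, hG⟩ ⟶ comorphismGeom ⟨F, hF⟩ :=
  GeomMorph.Hom₂.mk (restSheafMap η)

end SmallGenSite

section Pseudofunctors
open SmallGenSite

/-- The pseudofunctor of sheaf topoi on sites and morphisms of sites. -/
noncomputable def sheafPseudofunctor : SiteFlat.{u, w}ᵒᵖ ⥤ᵖ GTop.{u, w} where
  obj x := x.unop.of.sheafTopos
  map {x y} f := morphismGeom (X := y.unop.of) (Y := x.unop.of) f.unop
  map₂ {x y f g} η := morphismGeomMap f.unop.2 g.unop.2 η.unop2.hom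
  map₂_id {x y} f := GeomMorph.hom₂_ext (inverseImageMap_id f.unop.2)
  map₂_comp {x y f g h} η θ := GeomMorph.hom₂_ext
    (inverseImageMap_comp f.unop.2 g.unop.2 h.unop.2 η.unop2.hom θ.unop2.hom)
  mapId x := (morphismGeomId x.unop.of).symm
  mapComp {x y z} f g := (morphismGeomComp (X := z.unop.of) (Y := y.unop.of) (Z := x.unop.of)
    g.unop f.unop).symm
  map₂_whisker_left {x y z} f {g h} η := by
    refine (Iso.eq_inv_comp _).2 ?_
    exact GeomMorph.hom₂_ext (inverseImageComp_whiskerRight g.unop.2 h.unop.2 f.unop.1 f.unop.2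
      (siteLax.hComp g.unop f.unop).2 (siteLax.hComp h.unop f.unop).2 η.unop2.hom)
  map₂_whisker_right {x y z f g} η h := by
    refine (Iso.eq_inv_comp _).2 ?_
    exact GeomMorph.hom₂_ext (inverseImageComp_whiskerLeft h.unop.1 h.unop.2 f.unop.2 g.unop.2
      (siteLax.hComp h.unop f.unop).2 (siteLax.hComp h.unop g.unop).2 η.unop2.hom)
  -- The associators of sites are the identity natural transformations.
  map₂_associator {x y z t} f g h := geom_hom_ext fun S =>
    (congrArg (fun η => NatTrans.app η S)
      (inverseImageMap_id (siteLax.hComp h.unop (siteLax.hComp g.unop f.unop)).2)).trans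
    (id_eq_inv_comp_inv_comp
      (inverseImageComp_assoc h.unop.1 h.unop.2 g.unop.1 g.unop.2 f.unop.1 f.unop.2
        (siteLax.hComp h.unop g.unop).2 (siteLax.hComp g.unop f.unop).2
        (siteLax.hComp h.unop (siteLax.hComp g.unop f.unop)).2 S).symm
      ((inverseImageComp g.unop.1 g.unop.2 f.unop.1 f.unop.2
        (siteLax.hComp g.unop f.unop).2).inv_hom_id_app _)
      ((inverseImageComp h.unop.1 h.unop.2 (g.unop.1 ≫ f.unop.1)
        (siteLax.hComp g.unop f.unop).2
        (siteLax.hComp h.unop (siteLax.hComp g.unop f.unop)).2).inv_hom_id_app S))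
  map₂_left_unitor {x y} f := geom_hom_ext fun S =>
    (congrArg (fun η => NatTrans.app η S) (inverseImageMap_id f.unop.2)).trans
    (id_eq_inv_comp_inv (inverseImageId_comp f.unop.1 f.unop.2 (siteLax.hId x.unop.of).2 S)
      ((inverseImageId x.unop.of _).inv_hom_id_app _)
      ((inverseImageComp f.unop.1 f.unop.2 (𝟙 x.unop.of) (siteLax.hId x.unop.of).2
        f.unop.2).inv_hom_id_app S))
  map₂_right_unitor {x y} f := geom_hom_ext fun S =>
    (congrArg (fun η => NatTrans.app η S) (inverseImageMap_id f.unop.2)).trans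
    (id_eq_inv_comp_inv (inverseImageComp_id f.unop.1 f.unop.2 (siteLax.hId y.unop.of).2 S)
      (map_comp_eq_id (inverseImage f.unop.1 f.unop.2)
        ((inverseImageId y.unop.of (siteLax.hId y.unop.of).2).inv_hom_id_app S))
      ((inverseImageComp (𝟙 y.unop.of) (siteLax.hId y.unop.of).2 f.unop.1 f.unop.2
        f.unop.2).inv_hom_id_app S))

/-- The pseudofunctor of sheaf topoi on sites and comorphisms of sites. -/
noncomputable def sheafPseudofunctorCo : Co SiteSharp.{u, w} ⥤ᵖ GTop.{u, w} where
  obj x := x.of.of.sheafTopos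
  map {x y} F := comorphismGeom (X := x.of.of) (Y := y.of.of) F.hom
  map₂ {x y F G} η := comorphismGeomMap G.hom.2 F.hom.2 η.hom.hom
  map₂_id {x y} F := GeomMorph.hom₂_ext (restSheafMap_id F.hom.1)
  map₂_comp {x y F G H} η θ := GeomMorph.hom₂_ext (restSheafMap_comp θ.hom.hom η.hom.hom)
  mapId x := comorphismGeomId x.of.of
  mapComp {x y z} F G := comorphismGeomComp (X := x.of.of) (Y := y.of.of) (Z := z.of.of)
    F.hom G.hom
  map₂_whisker_left {x y z} F {G H} η := by
    rw [← Category.assoc]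
    refine (Iso.eq_comp_inv _).2 ?_
    exact GeomMorph.hom₂_ext (NatTrans.ext (funext
      (restSheafComp_whiskerLeft F.hom.1 η.hom.hom)))
  map₂_whisker_right {x y z F G} η H := by
    rw [← Category.assoc]
    refine (Iso.eq_comp_inv _).2 ?_
    exact GeomMorph.hom₂_ext (NatTrans.ext (funext
      (restSheafComp_whiskerRight η.hom.hom H.hom.1)))
  map₂_associator {x y z t} F G K := geom_hom_ext fun S =>
    (congrArg (fun η => NatTrans.app η S) (restSheafMap_id (F.hom.1 ≫ G.hom.1 ≫ K.hom.1))).trans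
    (id_eq_comp_comp_inv (restSheafComp_assoc F.hom.1 G.hom.1 K.hom.1 S)
      (map_comp_eq_id (restSheaf F.hom.1)
        ((restSheafCompIso G.hom.1 G.hom.2 K.hom.1).hom_inv_id_app S))
      ((restSheafCompIso F.hom.1 F.hom.2 (G.hom.1 ≫ K.hom.1)).hom_inv_id_app S))
  map₂_left_unitor {x y} F := geom_hom_ext fun S =>
    (congrArg (fun η => NatTrans.app η S) (restSheafMap_id F.hom.1)).trans
    (id_eq_comp_comp_id (restSheafComp_id_left F.hom.1 S))
  map₂_right_unitor {x y} F := geom_hom_ext fun S =>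
    (congrArg (fun η => NatTrans.app η S) (restSheafMap_id F.hom.1)).trans
    (id_eq_comp_comp_id (restSheafComp_id_right F.hom.1 S))

/-- The double functor sends a globular cell between morphisms of sites to the transformation
induced by it. -/
theorem geomCell_hCell {X Y : SmallGenSite.{u, w}} {f g : X ⟶ Y} (hf : IsMorphism f)
    (hg : IsMorphism g) (η : f ⟶ g) :
    geomCell (f := ⟨f, hf⟩) (G := siteLax.vId X) (K := siteLax.vId Y) (h := ⟨g, hg⟩) (hCell η) ≫
        (comorphismGeomId Y).hom ▷ morphismGeom ⟨g, hg⟩ =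
      morphismGeom ⟨f, hf⟩ ◁ (comorphismGeomId X).hom ≫ (ρ_ (morphismGeom ⟨f, hf⟩)).hom ≫
        morphismGeomMap hf hg η ≫ (λ_ (morphismGeom ⟨g, hg⟩)).inv :=
  geom_hom_ext fun S => (inverseImageCell_hCell hf hg η S).trans
    (congrArg (_ ≫ ·) ((Category.comp_id _).symm.trans (Category.id_comp _).symm))

/-- The double functor sends a globular cell between comorphisms of sites to the transformation
induced by it. -/
theorem geomCell_vCell {X Y : SmallGenSite.{u, w}} {F G : X ⟶ Y} (hF : IsComorphism F)
    (hG : IsComorphism G) (η : F ⟶ G) :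
    (morphismGeomId X).hom ▷ comorphismGeom ⟨G, hG⟩ ≫
      geomCell (f := siteLax.hId X) (G := ⟨G, hG⟩) (K := ⟨F, hF⟩) (h := siteLax.hId Y) (vCell η) =
      ((λ_ (comorphismGeom ⟨G, hG⟩)).hom ≫ comorphismGeomMap hF hG η ≫
        (ρ_ (comorphismGeom ⟨F, hF⟩)).inv) ≫ comorphismGeom ⟨F, hF⟩ ◁ (morphismGeomId Y).hom :=
  geom_hom_ext fun S => (inverseImageCell_vCell η (siteLax.hId X).2 (siteLax.hId Y).2 S).trans
    (congrArg (· ≫ _) ((Category.comp_id _).symm.trans (Category.id_comp _).symm))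

theorem restrictsAlongHorizontal_sheafDouble :
    RestrictsAlongHorizontal siteLaxH.{u, w} sheafDouble sheafPseudofunctor where
  obj _ := rfl
  map _ := HEq.rfl
  map₂ {_ _ f g} η := ⟨morphismGeomMap f.2 g.2 η.hom, HEq.rfl,
    (sqH_vCell_left _ _).trans ((heq_of_eq (geomCell_hCell f.2 g.2 η.hom)).trans
      (sqH_vCell_right _ _).symm)⟩
  mapId x := ⟨(morphismGeomId x.of).hom, HEq.rfl, rfl⟩
  mapComp {x y z} f g :=
    ⟨(morphismGeomComp (X := x.of) (Y := y.of) (Z := z.of) f g).hom, HEq.rfl, rfl⟩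

theorem restrictsAlongVertical_sheafDouble :
    RestrictsAlongVertical siteLaxV.{u, w} sheafDouble sheafPseudofunctorCo where
  obj _ := rfl
  map _ := HEq.rfl
  map₂ {_ _ F G} η := ⟨comorphismGeomMap G.hom.2 F.hom.2 η.hom.hom, HEq.rfl,
    (sqV_hCell_left _ _).trans ((heq_of_eq (geomCell_vCell G.hom.2 F.hom.2 η.hom.hom)).trans
      (sqV_hCell_right _ _).symm)⟩
  mapId x := ⟨(comorphismGeomId x.of.of).hom, HEq.rfl, rfl⟩
  mapComp {x y z} F G :=
    ⟨(comorphismGeomComp (X := x.of.of) (Y := y.of.of) (Z := z.of.of) F.hom G.hom).hom,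
      HEq.rfl, rfl⟩

end Pseudofunctors

theorem mainTheorem1 :
    ∃ (F : DoublePseudofunctor siteLax.{u, w}.hop toposLax.{u, w} SmallGenSite.sheafTopos.{u, w})
      (Sh : SiteFlat.{u, w}ᵒᵖ ⥤ᵖ GTop.{u, w}) (C : Co SiteSharp.{u, w} ⥤ᵖ GTop.{u, w}),
      Nonempty (SheafificationDatum F) ∧
      RestrictsAlongHorizontal siteLaxH F Sh ∧
      RestrictsAlongVertical siteLaxV F C :=
  ⟨sheafDouble, sheafPseudofunctor, sheafPseudofunctorCo, ⟨sheafificationDatum⟩,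
    restrictsAlongHorizontal_sheafDouble, restrictsAlongVertical_sheafDouble⟩
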